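/- **Setting.** Let $u_t=u_{xx}$ on $\Omega\times(0,T]$, $\Omega=[0,2\pi]$, $T>0$, with $u$ continuous up to $t=0$, under one of the boundary conditions (for $t\in[0,T]$) - (P) periodic: $u(0,t)=u(2\pi,t)$, $u_x(0,t)=u_x(2\pi,t)$; - (M1) $u(0,t)=g_0(t)$, $u_x(2\pi,t)=g_1(t)$; - (M2) $u_x(0,t)=g_0(t)$, $u(2\pi,t)=g_1(t)$. Put $q=u_x$. Let $0=x_{1/2}<x_{3/2}<\dots<x_{N+1/2}=2\pi$ be a mesh with cells $\tau_j=(x_{j-1/2},x_{j+1/2})$, $h_j=x_{j+1/2}-x_{j-1/2}$, $\bar h_j=h_j/2$, $h=\max_j h_j$, quasi-uniform with constant $c$: $h\le c\,h_j$ for all $j$. Let $V_h$ be the space of functions that are polynomials of degree at most $k$ on each cell, and write $(f,g)_j=\int_{\tau_j}fg\,dx$. The semidiscrete LDG solution $u_h(\cdot,t),q_h(\cdot,t)\in V_h$, with $u_h$ continuous in $t\in[0,T]$ and differentiable in $t\in(0,T]$, satisfies for all $v,w\in V_h$ and all $j$ $$(u_{ht},v)_j=-(q_h,v_x)_j+\hat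 q_hv^-|_{j+\frac12}-\hat q_hv^+|_{j-\frac12}\quad(0<t\le T),$$ $$(q_h,w)_j=-(u_h,w_x)_j+\hat u_hw^-|_{j+\frac12}-\hat u_hw^+|_{j-\frac12}\quad(0\le t\le T),$$ with the fluxes (A) $\hat u_h=u_h^-,\ \hat q_h=q_h^+$ or (B) $\hat u_h=u_h^+,\ \hat q_h=q_h^-$. Either choice is allowed for (P), where traces from outside $\Omega$ are taken by periodicity; (A) is used for (M1) and (B) for (M2), where the traces from outside $\Omega$ are the boundary data $g_0,g_1$. **Interpolants.** On $\tau_j$ let $L_{j,m}$ be the Legendre polynomial of degree $m$ with value $1$ at $x_{j+1/2}$, and $D_s^{-1}v(x)=\bar h_j^{-1}\int_{x_{j-1/2}}^x v$. Let $P_h^\mp v\in V_h$ be the Gauss–Radau projections: $P_h^\mp v-v$ is orthogonal on $\tau_j$ to all polynomials of degree at most $k-1$, and $P_h^-v=v$ at $x_{j+1/2}^-$, respectively $P_h^+v=v$ at $x_{j-1/2}^+$. Let $\bar v_{j,k}$ and $\tilde v_{j,k}$ be the coefficients of $L_{j,k}$ in the Legendre expansions of $v-P_h^-v$ and $v-P_h^+v$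 on $\tau_j$. For $i\ge1$ put $$F_{1,i}=(P_h^+D_s^{-1}P_h^-D_s^{-1})^{i-1}P_h^+D_s^{-1}L_{j,k},\qquad F_{2,i}=(P_h^-D_s^{-1}P_h^+D_s^{-1})^{i-1}P_h^-D_s^{-1}L_{j,k},$$ $\bar F_{1,i}=P_h^-D_s^{-1}F_{1,i}$ and $\bar F_{2,i}=P_h^+D_s^{-1}F_{2,i}$. For $1\le l\le k$ define on $\tau_j$, for the fluxes (A), with $G_i=\partial_t^i\bar u_{j,k}$ and $Q_i=\partial_t^i\tilde q_{j,k}$, $$W_1^l=\sum_{i=1}^{\lceil l/2\rceil}\bar h_j^{2i-1}G_iF_{1,i}+\sum_{i=1}^{\lfloor l/2\rfloor}\bar h_j^{2i}Q_i\bar F_{2,i},\quad W_2^l=\sum_{i=1}^{\lceil l/2\rceil}\bar h_j^{2i-1}Q_{i-1}F_{2,i}+\sum_{i=1}^{\lfloor l/2\rfloor}\bar h_j^{2i}G_i\bar F_{1,i},$$ $u_I^l=P_h^-u-W_2^l$, $q_I^l=P_h^+q-W_1^l$; and for the fluxes (B), with $G_i=\partial_t^i\tilde u_{j,k}$ and $Q_i=\partial_t^i\bar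 q_{j,k}$, $$W_1^l=\sum_{i=1}^{\lceil l/2\rceil}\bar h_j^{2i-1}G_iF_{2,i}+\sum_{i=1}^{\lfloor l/2\rfloor}\bar h_j^{2i}Q_i\bar F_{1,i},\quad W_2^l=\sum_{i=1}^{\lceil l/2\rceil}\bar h_j^{2i-1}Q_{i-1}F_{1,i}+\sum_{i=1}^{\lfloor l/2\rfloor}\bar h_j^{2i}G_i\bar F_{2,i},$$ $u_I^l=P_h^+u-W_2^l$, $q_I^l=P_h^-q-W_1^l$. **Theorem.** Let $1\le l\le k$. There is a constant $K>0$ depending only on $k$, $l$ and $c$ such that, for every such mesh, every $T>0$, each of the above combinations of boundary conditions and fluxes, every solution $u$ with $\sup_{0\le s\le T}\|u(\cdot,s)\|_{W^{k+l+2,\infty}(\Omega)}<\infty$ and every LDG solution $(u_h,q_h)$ with $u_h(\cdot,0)=u_I^l(\cdot,0)$, for all $t\in[0,T]$, $$\|(u_I^l-u_h)(\cdot,t)\|_{L^2(\Omega)}\le K(1+t)\,h^{k+l+1}\sup_{0\le s\le t}\|u(\cdot,s)\|_{W^{k+l+2,\infty}(\Omega)},$$ $$\|(q_I^l-q_h)(\cdot,t)\|_{L^2(\Omega)}\le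 K(1+t^{1/2})\,h^{k+l+1}\sup_{0\le s\le t}\|u(\cdot,s)\|_{W^{k+l+2,\infty}(\Omega)}.$$ In particular, for $l=k$ the order is $2k+1$. -/

import Mathlib

open Polynomial MeasureTheory
open scoped ENNReal ContDiff

noncomputable section

namespace LDG

/-! ## Sobolev spaces on the interval `(0, 2π)` -/

/-- `g` is the weak derivative of order `i` of `f` on `(0, 2π)`. -/
def IsWeakDeriv (i : ℕ) (f g : ℝ → ℝ) : Prop :=
  ∀ φ : ℝ → ℝ, ContDiff ℝ ∞ φ → HasCompactSupport φ →
    tsupport φ ⊆ Set.Ioo 0 (2 * Real.pi) →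
      ∫ x in Set.Ioo 0 (2 * Real.pi), f x * iteratedDeriv i φ x =
        (-1) ^ i * ∫ x in Set.Ioo 0 (2 * Real.pi), g x * φ x

/-- `D 0, …, D m` are essentially bounded functions that are the weak derivatives of `f`
of orders `0, …, m` on `(0, 2π)`. -/
def IsWeakDerivFamily (m : ℕ) (f : ℝ → ℝ) (D : ℕ → ℝ → ℝ) : Prop :=
  ∀ i ≤ m, MemLp (D i) ⊤ (volume.restrict (Set.Ioo 0 (2 * Real.pi))) ∧ IsWeakDeriv i f (D i)

/-- The norm `‖f‖_{m,∞}` of `W^{m,∞}(0, 2π)`: the maximum of the essential suprema of the weak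
derivatives of orders `0, …, m`. Weak derivatives are unique almost everywhere, so the infimum only
selects them; for continuous `f` it is `∞` when `f` is not in `W^{m,∞}`. -/
def sobolevNorm (m : ℕ) (f : ℝ → ℝ) : ℝ≥0∞ :=
  ⨅ (D : ℕ → ℝ → ℝ) (_ : IsWeakDerivFamily m f D),
    ⨆ i ∈ Finset.range (m + 1), eLpNorm (D i) ⊤ (volume.restrict (Set.Ioo 0 (2 * Real.pi)))

/-- `sup_{0 ≤ s ≤ t} ‖u(·, s)‖_{m,∞}`. -/
def supSobolevNorm (m : ℕ) (u : ℝ → ℝ → ℝ) (t : ℝ) : ℝ≥0∞ :=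
  ⨆ s ∈ Set.Icc 0 t, sobolevNorm m (fun x => u x s)

/-! ## The heat equation -/

/-- The auxiliary variable `q = u_x` (one-sided derivatives at `0` and `2π`). -/
def spaceDeriv (u : ℝ → ℝ → ℝ) (x t : ℝ) : ℝ :=
  derivWithin (fun y => u y t) (Set.Icc 0 (2 * Real.pi)) x

/-- The two pairs of alternating numerical fluxes:
`minusPlus` is `û = u⁻, q̂ = q⁺` and `plusMinus` is `û = u⁺, q̂ = q⁻`. -/
inductive Flux
  | minusPlus
  | plusMinus

/-- Periodic boundary conditions, or mixed ones with data `g₀` at `x = 0` and `g₁` at `x = 2π`. -/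
inductive Boundary
  | periodic
  | mixed (g₀ g₁ : ℝ → ℝ)

/-- The boundary condition for `u` at time `t`. In the mixed case the Dirichlet condition is at the
end at which the flux `û` has to be supplied from outside. -/
def SatisfiesBoundary (fl : Flux) (bc : Boundary) (u : ℝ → ℝ → ℝ) (t : ℝ) : Prop :=
  match bc, fl with
  | .periodic, _ =>
      u 0 t = u (2 * Real.pi) t ∧ spaceDeriv u 0 t = spaceDeriv u (2 * Real.pi) t
  | .mixed g₀ g₁, .minusPlus => u 0 t = g₀ t ∧ spaceDeriv u (2 * Real.pi) t = g₁ t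
  | .mixed g₀ g₁, .plusMinus => spaceDeriv u 0 t = g₀ t ∧ u (2 * Real.pi) t = g₁ t

/-- `u` solves `u_t = u_xx` on `[0, 2π] × (0, T]` with the given boundary condition, is continuous
in each variable up to `t = 0`, and `u ∈ L^∞(0, T; W^{m,∞}(0, 2π))`. -/
structure IsHeatSolution (fl : Flux) (bc : Boundary) (m : ℕ) (T : ℝ) (u : ℝ → ℝ → ℝ) : Prop where
  continuous_space : ∀ t ∈ Set.Icc 0 T, ContinuousOn (fun x => u x t) (Set.Icc 0 (2 * Real.pi))
  continuous_time : ∀ x ∈ Set.Icc 0 (2 * Real.pi), ContinuousOn (fun t => u x t) (Set.Icc 0 T)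
  regular : supSobolevNorm m u T ≠ ⊤
  heat : ∀ t ∈ Set.Ioc 0 T, ∀ x ∈ Set.Icc 0 (2 * Real.pi),
    HasDerivWithinAt (fun s => u x s)
      (iteratedDerivWithin 2 (fun y => u y t) (Set.Icc 0 (2 * Real.pi)) x) (Set.Icc 0 T) t
  boundary : ∀ t ∈ Set.Icc 0 T, SatisfiesBoundary fl bc u t

/-! ## Meshes and the finite element space -/

/-- A mesh of `[0, 2π]` with `N` cells; cell `j` is `(node j.castSucc, node j.succ)`. -/
structure Mesh (N : ℕ) where
  node : Fin (N + 1) → ℝ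
  strictMono : StrictMono node
  node_zero : node 0 = 0
  node_last : node (Fin.last N) = 2 * Real.pi

variable {N : ℕ}

/-- Left end of cell `j`. -/
def Mesh.left (M : Mesh N) (j : Fin N) : ℝ := M.node j.castSucc

/-- Right end of cell `j`. -/
def Mesh.right (M : Mesh N) (j : Fin N) : ℝ := M.node j.succ

/-- The cell length `h_j`. -/
def Mesh.cellSize (M : Mesh N) (j : Fin N) : ℝ := M.right j - M.left j

/-- The mesh size `h = max_j h_j`. -/
def Mesh.size (M : Mesh N) : ℝ := ⨆ j, M.cellSize j

/-- Quasi-uniformity with constant `c`. -/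
def Mesh.QuasiUniform (M : Mesh N) (c : ℝ) : Prop := ∀ j, M.size ≤ c * M.cellSize j

/-- The finite element space `V_h`: a function is given by its polynomial on each cell. -/
def feSpace (N k : ℕ) : Set (Fin N → ℝ[X]) := {v | ∀ j, (v j).natDegree ≤ k}

/-- The norm `‖v‖₀` of `L²(0, 2π)` for a piecewise polynomial `v`. -/
def l2Norm (M : Mesh N) (v : Fin N → ℝ[X]) : ℝ :=
  Real.sqrt (∑ j, ∫ x in M.left j..M.right j, ((v j).eval x) ^ 2)

/-! ## The LDG scheme -/

/-- The left limit `v⁻` at node `i`; `ext` is its value at the node `0`. -/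
def traceMinus (M : Mesh N) (ext : ℝ) (v : Fin N → ℝ[X]) (i : Fin (N + 1)) : ℝ :=
  Fin.cases (motive := fun _ => ℝ) ext (fun j => (v j).eval (M.right j)) i

/-- The right limit `v⁺` at node `i`; `ext` is its value at the last node. -/
def tracePlus (M : Mesh N) (ext : ℝ) (v : Fin N → ℝ[X]) (i : Fin (N + 1)) : ℝ :=
  Fin.lastCases (motive := fun _ => ℝ) ext (fun j => (v j).eval (M.left j)) i

/-- The numerical flux `û_h` at the nodes, at time `t`. Values from outside `[0, 2π]` come from
periodicity or from the Dirichlet datum. -/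
def fluxU (M : Mesh N) (fl : Flux) (bc : Boundary) (t : ℝ) (v : Fin N → ℝ[X]) :
    Fin (N + 1) → ℝ :=
  match fl, bc with
  | .minusPlus, .periodic => traceMinus M (traceMinus M 0 v (Fin.last N)) v
  | .minusPlus, .mixed g₀ _ => traceMinus M (g₀ t) v
  | .plusMinus, .periodic => tracePlus M (tracePlus M 0 v 0) v
  | .plusMinus, .mixed _ g₁ => tracePlus M (g₁ t) v

/-- The numerical flux `q̂_h` at the nodes, at time `t`. Values from outside `[0, 2π]` come from
periodicity or from the Neumann datum. -/
def fluxQ (M : Mesh N) (fl : Flux) (bc : Boundary) (t : ℝ) (v : Fin N → ℝ[X]) :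
    Fin (N + 1) → ℝ :=
  match fl, bc with
  | .minusPlus, .periodic => tracePlus M (tracePlus M 0 v 0) v
  | .minusPlus, .mixed _ g₁ => tracePlus M (g₁ t) v
  | .plusMinus, .periodic => traceMinus M (traceMinus M 0 v (Fin.last N)) v
  | .plusMinus, .mixed g₀ _ => traceMinus M (g₀ t) v

/-- On cell `j`: `(z, v)_j = -(p, v_x)_j + P v⁻|_{right end} - P v⁺|_{left end}`, where `P` are the
values at the nodes of the numerical flux of `p`. -/
def CellEquation (M : Mesh N) (z p : Fin N → ℝ[X]) (P : Fin (N + 1) → ℝ) (v : Fin N → ℝ[X])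
    (j : Fin N) : Prop :=
  ∫ x in M.left j..M.right j, (z j).eval x * (v j).eval x =
    -(∫ x in M.left j..M.right j, (p j).eval x * (v j).derivative.eval x)
      + P j.succ * (v j).eval (M.right j) - P j.castSucc * (v j).eval (M.left j)

/-- `(u_h, q_h)` is a solution of the semidiscrete LDG scheme on `[0, T]`. -/
structure IsLDGSolution (M : Mesh N) (k : ℕ) (fl : Flux) (bc : Boundary) (T : ℝ)
    (uh qh : ℝ → Fin N → ℝ[X]) : Prop where
  uh_mem : ∀ t ∈ Set.Icc 0 T, uh t ∈ feSpace N k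
  qh_mem : ∀ t ∈ Set.Icc 0 T, qh t ∈ feSpace N k
  continuous_uh : ∀ j x, ContinuousOn (fun t => (uh t j).eval x) (Set.Icc 0 T)
  eq_u : ∀ t ∈ Set.Ioc 0 T, ∃ uht ∈ feSpace N k,
    (∀ j x, HasDerivWithinAt (fun s => (uh s j).eval x) ((uht j).eval x) (Set.Icc 0 T) t) ∧
    ∀ v ∈ feSpace N k, ∀ j, CellEquation M uht (qh t) (fluxQ M fl bc t (qh t)) v j
  eq_q : ∀ t ∈ Set.Icc 0 T,
    ∀ w ∈ feSpace N k, ∀ j, CellEquation M (qh t) (uh t) (fluxU M fl bc t (uh t)) w j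

/-! ## Legendre polynomials and Gauss–Radau projections on a cell `[a, b]` -/

/-- The Legendre polynomial of degree `m` on `[-1, 1]`, with value `1` at `1` (Rodrigues formula). -/
def legendre (m : ℕ) : ℝ[X] :=
  C (1 / (2 ^ m * (m.factorial : ℝ))) * derivative^[m] ((X ^ 2 - 1) ^ m)

/-- The Legendre polynomial of degree `m` on `[a, b]`. -/
def legendreOn (a b : ℝ) (m : ℕ) : ℝ[X] :=
  (legendre m).comp (C (2 / (b - a)) * (X - C ((a + b) / 2)))

/-- `p` has degree at most `k`, `p - f` is orthogonal on `[a, b]` to all polynomials of degree at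
most `k - 1`, and `p` agrees with `f` at the point `e`. -/
def IsGaussRadau (k : ℕ) (a b e : ℝ) (f : ℝ → ℝ) (p : ℝ[X]) : Prop :=
  p.natDegree ≤ k ∧
  (∀ w : ℝ[X], w.degree < k →
    ∫ x in a..b, p.eval x * w.eval x = ∫ x in a..b, f x * w.eval x) ∧
  p.eval e = f e

theorem IsGaussRadau.eq_zero {k : ℕ} {a b e : ℝ} (hab : a < b) (he : e = a ∨ e = b) {p : ℝ[X]}
    (h : IsGaussRadau k a b e 0 p) : p = 0 := by
  obtain ⟨hdeg, horth, hend⟩ := h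
  obtain ⟨q, rfl⟩ : X - C e ∣ p := dvd_iff_isRoot.mpr (by simpa using hend)
  by_contra hne
  have hq : q ≠ 0 := right_ne_zero_of_mul hne
  have hqd : q.degree < k := by
    have h1 : ((X - C e) * q).natDegree = 1 + q.natDegree := by
      rw [natDegree_mul (X_sub_C_ne_zero e) hq, natDegree_X_sub_C]
    rw [degree_eq_natDegree hq]
    exact_mod_cast (by omega : q.natDegree < k)
  have h0 := horth q hqd
  simp only [eval_mul, eval_sub, eval_X, eval_C, Pi.zero_apply, zero_mul,
    intervalIntegral.integral_zero] at h0
  obtain ⟨c, hc, hcr⟩ : ∃ c ∈ Set.Ioo a b, q.eval c ≠ 0 := by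
    by_contra! hall
    apply hq
    refine q.eq_zero_of_infinite_isRoot ((Set.Ioo_infinite hab).mono fun x hx => ?_)
    exact hall x hx
  rcases he with rfl | rfl
  · have hpos : 0 < ∫ x in e..b, (x - e) * q.eval x * q.eval x := by
      apply intervalIntegral.integral_pos hab (by fun_prop)
      · intro x hx
        nlinarith [mul_self_nonneg (q.eval x), hx.1]
      · refine ⟨c, ⟨hc.1.le, hc.2.le⟩, ?_⟩
        have := mul_self_pos.mpr hcr
        nlinarith [mul_pos (sub_pos.mpr hc.1) this]
    exact hpos.ne' h0
  · have hpos : 0 < ∫ x in a..e, -((x - e) * q.eval x * q.eval x) := by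
      apply intervalIntegral.integral_pos hab (by fun_prop)
      · intro x hx
        nlinarith [mul_self_nonneg (q.eval x), hx.2]
      · refine ⟨c, ⟨hc.1.le, hc.2.le⟩, ?_⟩
        have := mul_self_pos.mpr hcr
        nlinarith [mul_pos (sub_pos.mpr hc.2) this]
    rw [intervalIntegral.integral_neg, h0] at hpos
    simp at hpos

/-- Existence and uniqueness of the Gauss–Radau projection of a continuous function. -/
theorem existsUnique_isGaussRadau (k : ℕ) {a b e : ℝ} (hab : a < b) (he : e = a ∨ e = b)
    {f : ℝ → ℝ} (hf : ContinuousOn f (Set.Icc a b)) : ∃! p, IsGaussRadau k a b e f p := by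
  have hfi : ∀ w : ℝ[X], IntervalIntegrable (fun x => f x * w.eval x) volume a b := fun w =>
    ContinuousOn.intervalIntegrable (by
      rw [Set.uIcc_of_le hab.le]; exact hf.mul w.continuous.continuousOn)
  have hpi : ∀ p w : ℝ[X], IntervalIntegrable (fun x => p.eval x * w.eval x) volume a b :=
    fun p w => (p.continuous.mul w.continuous).intervalIntegrable a b
  let B : degreeLT ℝ (k + 1) →ₗ[ℝ] Module.Dual ℝ (degreeLT ℝ k) × ℝ :=
    { toFun := fun p =>
        ({ toFun := fun w => ∫ x in a..b, p.1.eval x * w.1.eval x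
           map_add' := fun w w' => by
            simp only [Submodule.coe_add, eval_add, mul_add]
            exact intervalIntegral.integral_add (hpi _ _) (hpi _ _)
           map_smul' := fun r w => by
            simp only [Submodule.coe_smul, eval_smul, smul_eq_mul, RingHom.id_apply]
            rw [← intervalIntegral.integral_const_mul]
            congr 1; ext x; ring }, p.1.eval e)
      map_add' := fun p p' => by
        refine Prod.ext (LinearMap.ext fun w => ?_) (by simp)
        simp only [Submodule.coe_add, eval_add, add_mul]
        exact intervalIntegral.integral_add (hpi _ _) (hpi _ _)
      map_smul' := fun r p => by
        refine Prod.ext (LinearMap.ext fun w => ?_) (by simp)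
        simp only [Submodule.coe_smul, eval_smul, smul_eq_mul, RingHom.id_apply, Prod.smul_fst,
          LinearMap.smul_apply, LinearMap.coe_mk, AddHom.coe_mk]
        rw [← intervalIntegral.integral_const_mul]
        congr 1; ext x; ring }
  have hdim : ∀ n, Module.finrank ℝ (degreeLT ℝ n) = n := fun n => by
    rw [LinearEquiv.finrank_eq (degreeLTEquiv ℝ n)]; simp
  have hfd : ∀ n, FiniteDimensional ℝ (degreeLT ℝ n) := fun n =>
    Module.Finite.equiv (degreeLTEquiv ℝ n).symm
  have := hfd k
  have := hfd (k + 1)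
  have hdeg : ∀ p : ℝ[X], p.natDegree ≤ k ↔ p ∈ degreeLT ℝ (k + 1) := fun p => by
    rw [mem_degreeLT]
    rcases eq_or_ne p 0 with rfl | hp
    · simp
    · rw [← natDegree_lt_iff_degree_lt hp, Nat.lt_succ_iff]
  have hinj : Function.Injective B := by
    rw [← LinearMap.ker_eq_bot, LinearMap.ker_eq_bot']
    intro p hp
    apply Subtype.ext
    refine IsGaussRadau.eq_zero (k := k) hab he ⟨(hdeg _).mpr p.2, fun w hw => ?_, ?_⟩
    · have := LinearMap.congr_fun (congrArg Prod.fst hp) ⟨w, mem_degreeLT.mpr hw⟩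
      simpa [B] using this
    · simpa [B] using congrArg Prod.snd hp
  have hsurj : Function.Surjective B := by
    refine (LinearMap.injective_iff_surjective_of_finrank_eq_finrank ?_).mp hinj
    rw [Module.finrank_prod, Subspace.dual_finrank_eq, hdim, hdim, Module.finrank_self]
  let L : Module.Dual ℝ (degreeLT ℝ k) :=
    { toFun := fun w => ∫ x in a..b, f x * w.1.eval x
      map_add' := fun w w' => by
        simp only [Submodule.coe_add, eval_add, mul_add]
        exact intervalIntegral.integral_add (hfi _) (hfi _)
      map_smul' := fun r w => by
        simp only [Submodule.coe_smul, eval_smul, smul_eq_mul, RingHom.id_apply]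
        rw [← intervalIntegral.integral_const_mul]
        congr 1; ext x; ring }
  obtain ⟨p, hp⟩ := hsurj (L, f e)
  refine ⟨p.1, ⟨(hdeg _).mpr p.2, fun w hw => ?_, ?_⟩, fun p' hp' => ?_⟩
  · exact LinearMap.congr_fun (congrArg Prod.fst hp) ⟨w, mem_degreeLT.mpr hw⟩
  · exact congrArg Prod.snd hp
  · have : (⟨p', (hdeg _).mp hp'.1⟩ : degreeLT ℝ (k + 1)) = p := by
      apply hinj
      rw [hp]
      exact Prod.ext (LinearMap.ext fun w => hp'.2.1 w.1 (mem_degreeLT.mp w.2)) hp'.2.2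
    exact congrArg Subtype.val this

open Classical in
/-- The Gauss–Radau projection of `f` on `[a, b]` that interpolates at `e`. -/
def gaussRadau (k : ℕ) (a b e : ℝ) (f : ℝ → ℝ) : ℝ[X] :=
  if h : ∃ p, IsGaussRadau k a b e f p then h.choose else 0

theorem isGaussRadau_gaussRadau (k : ℕ) {a b e : ℝ} (hab : a < b) (he : e = a ∨ e = b)
    {f : ℝ → ℝ} (hf : ContinuousOn f (Set.Icc a b)) :
    IsGaussRadau k a b e f (gaussRadau k a b e f) := by
  have h := (existsUnique_isGaussRadau k hab he hf).exists
  rw [gaussRadau, dif_pos h]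
  exact h.choose_spec

/-- `P_h^- f` on the cell `[a, b]`: interpolation at the right end. -/
def radauMinus (k : ℕ) (a b : ℝ) (f : ℝ → ℝ) : ℝ[X] := gaussRadau k a b b f

/-- `P_h^+ f` on the cell `[a, b]`: interpolation at the left end. -/
def radauPlus (k : ℕ) (a b : ℝ) (f : ℝ → ℝ) : ℝ[X] := gaussRadau k a b a f

/-- The coefficient `f̄_k` of the Legendre polynomial of degree `k` in `f - P_h^- f` on `[a, b]`. -/
def coefMinus (k : ℕ) (a b : ℝ) (f : ℝ → ℝ) : ℝ :=
  -f b + 1 / (b - a) *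
    ∫ x in a..b, f x * ∑ m ∈ Finset.range (k + 1), (2 * m + 1) * (legendreOn a b m).eval x

/-- The coefficient `f̃_k` of the Legendre polynomial of degree `k` in `f - P_h^+ f` on `[a, b]`. -/
def coefPlus (k : ℕ) (a b : ℝ) (f : ℝ → ℝ) : ℝ :=
  (-1) ^ (k + 1) * f a + 1 / (b - a) *
    ∫ x in a..b, f x *
      ∑ m ∈ Finset.range (k + 1), (-1) ^ (k + m) * (2 * m + 1) * (legendreOn a b m).eval x

/-! ## Correction functions -/

/-- The operator `D_s^{-1}` on the cell `[a, b]`, applied to a polynomial: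
`(2 / (b - a)) ∫_a^x p`. -/
def primitive (a b : ℝ) (p : ℝ[X]) (x : ℝ) : ℝ := 2 / (b - a) * ∫ y in a..x, p.eval y

/-- `P_h^- D_s^{-1} p` on `[a, b]`. -/
def stepMinus (k : ℕ) (a b : ℝ) (p : ℝ[X]) : ℝ[X] := radauMinus k a b (primitive a b p)

/-- `P_h^+ D_s^{-1} p` on `[a, b]`. -/
def stepPlus (k : ℕ) (a b : ℝ) (p : ℝ[X]) : ℝ[X] := radauPlus k a b (primitive a b p)

/-- `F_{1,i} = (P_h^+ D_s^{-1} P_h^- D_s^{-1})^{i-1} P_h^+ D_s^{-1} L_k`, for `i ≥ 1`. -/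
def F₁ (k : ℕ) (a b : ℝ) (i : ℕ) : ℝ[X] :=
  (fun p => stepPlus k a b (stepMinus k a b p))^[i - 1] (stepPlus k a b (legendreOn a b k))

/-- `F_{2,i} = (P_h^- D_s^{-1} P_h^+ D_s^{-1})^{i-1} P_h^- D_s^{-1} L_k`, for `i ≥ 1`. -/
def F₂ (k : ℕ) (a b : ℝ) (i : ℕ) : ℝ[X] :=
  (fun p => stepMinus k a b (stepPlus k a b p))^[i - 1] (stepMinus k a b (legendreOn a b k))

/-- `F̄_{1,i} = P_h^- D_s^{-1} F_{1,i}`. -/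
def Fbar₁ (k : ℕ) (a b : ℝ) (i : ℕ) : ℝ[X] := stepMinus k a b (F₁ k a b i)

/-- `F̄_{2,i} = P_h^+ D_s^{-1} F_{2,i}`. -/
def Fbar₂ (k : ℕ) (a b : ℝ) (i : ℕ) : ℝ[X] := stepPlus k a b (F₂ k a b i)

/-- `∑_{i=1}^{⌈l/2⌉} (h/2)^{2i-1} A_i F_i + ∑_{i=1}^{⌊l/2⌋} (h/2)^{2i} B_i F̄_i`, `h = b - a`. -/
def correctionSum (l : ℕ) (a b : ℝ) (A : ℕ → ℝ) (F : ℕ → ℝ[X]) (B : ℕ → ℝ) (Fbar : ℕ → ℝ[X]) :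
    ℝ[X] :=
  ∑ i ∈ Finset.Icc 1 ((l + 1) / 2), C (((b - a) / 2) ^ (2 * i - 1) * A i) * F i +
    ∑ i ∈ Finset.Icc 1 (l / 2), C (((b - a) / 2) ^ (2 * i) * B i) * Fbar i

/-- `G_i(t)`: the `i`-th time derivative on `[0, T]` of the coefficient of `u` on `[a, b]`. -/
def coefG (fl : Flux) (k : ℕ) (a b T : ℝ) (u : ℝ → ℝ → ℝ) (t : ℝ) (i : ℕ) : ℝ :=
  match fl with
  | .minusPlus => iteratedDerivWithin i (fun s => coefMinus k a b (fun x => u x s)) (Set.Icc 0 T) t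
  | .plusMinus => iteratedDerivWithin i (fun s => coefPlus k a b (fun x => u x s)) (Set.Icc 0 T) t

/-- `Q_i(t)`: the `i`-th time derivative on `[0, T]` of the coefficient of `q = u_x` on `[a, b]`. -/
def coefQ (fl : Flux) (k : ℕ) (a b T : ℝ) (u : ℝ → ℝ → ℝ) (t : ℝ) (i : ℕ) : ℝ :=
  match fl with
  | .minusPlus =>
      iteratedDerivWithin i (fun s => coefPlus k a b (fun x => spaceDeriv u x s)) (Set.Icc 0 T) t
  | .plusMinus =>
      iteratedDerivWithin i (fun s => coefMinus k a b (fun x => spaceDeriv u x s)) (Set.Icc 0 T) t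

/-- The correction `W_1^l` (for `q`) on the cell `[a, b]`. -/
def W₁ (fl : Flux) (k l : ℕ) (a b T : ℝ) (u : ℝ → ℝ → ℝ) (t : ℝ) : ℝ[X] :=
  match fl with
  | .minusPlus => correctionSum l a b
      (fun i => coefG fl k a b T u t i) (F₁ k a b) (fun i => coefQ fl k a b T u t i) (Fbar₂ k a b)
  | .plusMinus => correctionSum l a b
      (fun i => coefG fl k a b T u t i) (F₂ k a b) (fun i => coefQ fl k a b T u t i) (Fbar₁ k a b)

/-- The correction `W_2^l` (for `u`) on the cell `[a, b]`. -/
def W₂ (fl : Flux) (k l : ℕ) (a b T : ℝ) (u : ℝ → ℝ → ℝ) (t : ℝ) : ℝ[X] :=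
  match fl with
  | .minusPlus => correctionSum l a b
      (fun i => coefQ fl k a b T u t (i - 1)) (F₂ k a b)
      (fun i => coefG fl k a b T u t i) (Fbar₁ k a b)
  | .plusMinus => correctionSum l a b
      (fun i => coefQ fl k a b T u t (i - 1)) (F₁ k a b)
      (fun i => coefG fl k a b T u t i) (Fbar₂ k a b)

/-- The corrected interpolant `u_I^l` at time `t`. -/
def interpU (M : Mesh N) (fl : Flux) (k l : ℕ) (T : ℝ) (u : ℝ → ℝ → ℝ) (t : ℝ) (j : Fin N) :
    ℝ[X] :=
  (match fl with
    | .minusPlus => radauMinus k (M.left j) (M.right j) (fun x => u x t)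
    | .plusMinus => radauPlus k (M.left j) (M.right j) (fun x => u x t))
  - W₂ fl k l (M.left j) (M.right j) T u t

/-- The corrected interpolant `q_I^l` at time `t`. -/
def interpQ (M : Mesh N) (fl : Flux) (k l : ℕ) (T : ℝ) (u : ℝ → ℝ → ℝ) (t : ℝ) (j : Fin N) :
    ℝ[X] :=
  (match fl with
    | .minusPlus => radauPlus k (M.left j) (M.right j) (fun x => spaceDeriv u x t)
    | .plusMinus => radauMinus k (M.left j) (M.right j) (fun x => spaceDeriv u x t))
  - W₁ fl k l (M.left j) (M.right j) T u t

end LDG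

end

/-! Expand everything in an orthonormal basis of V_h, and let e, E be the coordinates of u_I^l - u_h
and q_I^l - q_h. The corrections are designed so that E = D e + r, (e - σ)' = -D* E, where D is the
discrete derivative with zero boundary data. Its adjoint is minus the discrete derivative with the
opposite fluxes (`derivForm_flip`), which is what alternating fluxes are for. The vectors r and σ
are the last corrections of q and u, of size h^{k+l+1}.

Why these equations hold: tested against V_h, the error of a Gauss–Radau projection is a single
Legendre moment of degree k (`integral_mul_sub_radau`). The functions `corr n` are orthogonal to
degrees below k - n, so they vanish at the interpolation points, and differentiating the test
function turns the moment of `corr (n+1)` into that of `corr n` with the opposite flux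
(`integral_corr_succ_mul_derivative`). The moments therefore telescope between u and q, and only the
last ones survive (`integral_sub_correctionMoment`). Their coefficients vanish on polynomials of
degree k, which gives the missing powers of h (`exists_coef_approx`, `exists_meshRemainder_bound`).

The difficulty is regularity. Keeping the order h^{k+l+1} in σ' would take k+l+3 space derivatives
of u, while k+l+2 are at hand. So σ is left under the time derivative and Duhamel's formula is used
with increments σ(s) - σ(t) and the smoothing of the semigroups of D*D and DD*
(`exists_smoothing_semigroup`). For e it suffices that ‖σ(s) - σ(t)‖ is of order (t-s)^{1/2}
(`norm_le_of_duhamel`). This comes from an interpolation argument: the space derivative v of order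
k+l+1 is Lipschitz in x, hence Hölder of exponent 1/2 in time (`HeatRegular.abs_time_diff_two_le`).

For E the same argument produces the non-integrable kernel (t-s)^{-1}, so a small additional power
of t-s is needed for the increments of both σ and r (`norm_add_le_of_duhamel`). Pointwise bounds do
not give it. In the interior it follows from parabolic smoothing in L²: weighted energy estimates
with a weight vanishing at 0 and 2π, since the boundary data have no assumed smoothness
(`HeatRegular.weighted_energy`). The estimates are applied to time averages of the solution, and the
strips near the boundary are charged to their small measure (`integral_sq_le_of_weighted`).
Optimizing the width of the strips leaves the gain (t-s)^{1/16}
(`exists_consistency_increment_bound`), which is enough. -/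

noncomputable section

/-! ### Polynomial tools on the reference interval and on one cell -/

namespace LDG

/-! ## Legendre polynomials -/

theorem integral_derivative_mul (p q : ℝ[X]) (a b : ℝ) :
    ∫ x in a..b, p.derivative.eval x * q.eval x =
      p.eval b * q.eval b - p.eval a * q.eval a - ∫ x in a..b, p.eval x * q.derivative.eval x := by
  have h := intervalIntegral.integral_mul_deriv_eq_deriv_mul (a := a) (b := b)
    (u := fun x => q.eval x) (v := fun x => p.eval x) (u' := fun x => q.derivative.eval x)
    (v' := fun x => p.derivative.eval x) (fun x _ => q.hasDerivAt x) (fun x _ => p.hasDerivAt x)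
    (q.derivative.continuous.intervalIntegrable _ _)
    (p.derivative.continuous.intervalIntegrable _ _)
  simp only [mul_comm (q.eval _), mul_comm (q.derivative.eval _)] at h
  exact h

theorem intervalIntegrable_eval_mul (p q : ℝ[X]) (a b : ℝ) :
    IntervalIntegrable (fun x => p.eval x * q.eval x) volume a b :=
  (p.continuous.mul q.continuous).intervalIntegrable a b

/-- (x²-1)^m vanishes to order m at ±1; this removes the boundary terms when Rodrigues' formula is
integrated by parts. -/
theorem eval_iterate_derivative_sq_sub_one_pow {m i : ℕ} (hi : i < m) {x : ℝ} (hx : x ^ 2 = 1) :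
    (derivative^[i] ((X ^ 2 - 1 : ℝ[X]) ^ m)).eval x = 0 := by
  have h := pow_sub_dvd_iterate_derivative_pow (X ^ 2 - 1 : ℝ[X]) m i
  refine eval_eq_zero_of_dvd_of_eval_eq_zero h ?_
  rw [eval_pow]
  simp [hx, (Nat.sub_pos_of_lt hi).ne']

theorem integral_iterate_derivative_mul (m : ℕ) (w : ℝ[X]) {j : ℕ} (hj : j ≤ m) :
    ∫ x in (-1 : ℝ)..1, (derivative^[m] ((X ^ 2 - 1 : ℝ[X]) ^ m)).eval x * w.eval x =
      (-1) ^ j * ∫ x in (-1 : ℝ)..1,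
        (derivative^[m - j] ((X ^ 2 - 1 : ℝ[X]) ^ m)).eval x * (derivative^[j] w).eval x := by
  induction j with
  | zero => simp
  | succ j ih =>
    rw [ih (by omega)]
    have h1 : m - j = (m - (j + 1)) + 1 := by omega
    rw [h1, Function.iterate_succ_apply', integral_derivative_mul,
      eval_iterate_derivative_sq_sub_one_pow (by omega) (by norm_num),
      eval_iterate_derivative_sq_sub_one_pow (by omega) (by norm_num),
      Function.iterate_succ_apply', pow_succ]
    ring

theorem natDegree_legendre_le (m : ℕ) : (legendre m).natDegree ≤ m := by
  unfold legendre
  refine (natDegree_C_mul_le _ _).trans ((natDegree_iterate_derivative _ _).trans ?_)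
  have h1 : ((X ^ 2 - 1 : ℝ[X]) ^ m).natDegree ≤ m * 2 := by
    refine natDegree_pow_le.trans (Nat.mul_le_mul_left _ ?_)
    compute_degree
  omega

theorem integral_legendre_mul_eq_zero {m : ℕ} {w : ℝ[X]} (hw : w.degree < m) :
    ∫ x in (-1 : ℝ)..1, (legendre m).eval x * w.eval x = 0 := by
  have h := integral_iterate_derivative_mul m w le_rfl
  rw [iterate_derivative_eq_zero_of_degree_lt hw] at h
  simp only [legendre, eval_mul, eval_C, mul_assoc, intervalIntegral.integral_const_mul, h]
  simp

theorem legendre_eval_one (m : ℕ) : (legendre m).eval 1 = 1 := by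
  have h1 : (X ^ 2 - 1 : ℝ[X]) ^ m = (X - C 1) ^ m * (X + C 1) ^ m := by
    rw [← mul_pow]; congr 1; simp; ring
  have h2 : (derivative^[m] ((X ^ 2 - 1 : ℝ[X]) ^ m)).eval 1 = m.factorial * 2 ^ m := by
    rw [h1, iterate_derivative_mul, eval_finsetSum, Finset.sum_eq_single 0]
    · simp only [Nat.choose_zero_right, one_smul, tsub_zero, Function.iterate_zero, id_eq,
        iterate_derivative_X_sub_pow_self]
      norm_num
    · intro i hi hi0
      rw [iterate_derivative_X_sub_pow]
      have : m - (m - i) = i := by have := Finset.mem_range.mp hi; omega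
      simp [this, hi0]
    · simp
  rw [legendre, eval_mul, eval_C, h2]
  have : (m.factorial : ℝ) ≠ 0 := by positivity
  field_simp

theorem legendre_eval_neg_one (m : ℕ) : (legendre m).eval (-1) = (-1) ^ m := by
  have h1 : (X ^ 2 - 1 : ℝ[X]) ^ m = (X - C 1) ^ m * (X - C (-1)) ^ m := by
    rw [← mul_pow]; congr 1; simp; ring
  have h2 : (derivative^[m] ((X ^ 2 - 1 : ℝ[X]) ^ m)).eval (-1) = (-2) ^ m * m.factorial := by
    rw [h1, iterate_derivative_mul, eval_finsetSum, Finset.sum_eq_single m]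
    · simp only [Nat.choose_self, one_smul, tsub_self, Function.iterate_zero, id_eq,
        iterate_derivative_X_sub_pow_self]
      norm_num
    · intro i hi him
      rw [iterate_derivative_X_sub_pow (n := m) (k := i)]
      have : m - i ≠ 0 := by have := Finset.mem_range.mp hi; omega
      simp [this]
    · simp
  rw [legendre, eval_mul, eval_C, h2]
  have : (m.factorial : ℝ) ≠ 0 := by positivity
  rw [show (-2 : ℝ) = (-1) * 2 by norm_num, mul_pow]
  field_simp

/-- x L' - m L has degree below m, so it is orthogonal to L and ∫ x L L' = m ∫ L². Integrating (x
L²)' over [-1,1] gives ∫ L² + 2 ∫ x L L' = 2. -/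
theorem integral_legendre_sq (m : ℕ) :
    ∫ x in (-1 : ℝ)..1, (legendre m).eval x * (legendre m).eval x = 2 / (2 * m + 1) := by
  set L := legendre m with hL
  have hlow : (X * derivative L - C (m : ℝ) * L).degree < (m : WithBot ℕ) := by
    rw [degree_lt_iff_coeff_zero]
    intro n hn
    rcases n with _ | n
    · have : m = 0 := by omega
      simp [this]
    · rw [coeff_sub, coeff_X_mul, coeff_derivative, coeff_C_mul]
      rcases hn.eq_or_lt with h | h
      · rw [h]; push_cast; ring
      · rw [coeff_eq_zero_of_natDegree_lt ((natDegree_legendre_le m).trans_lt h)]; ring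
  have h0 := integral_legendre_mul_eq_zero hlow
  have h1 := integral_derivative_mul (X * L) L (-1) 1
  have e1 : ∀ x : ℝ, L.eval x * (X * derivative L - C (m : ℝ) * L).eval x =
      (X * L).eval x * (derivative L).eval x - m * (L.eval x * L.eval x) := fun x => by
    simp; ring
  have e2 : ∀ x : ℝ, (derivative (X * L)).eval x * L.eval x =
      L.eval x * L.eval x + (X * L).eval x * (derivative L).eval x := fun x => by
    simp; ring
  rw [← hL] at h0
  simp only [e1] at h0
  simp only [e2] at h1
  rw [intervalIntegral.integral_sub (intervalIntegrable_eval_mul _ _ _ _)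
    ((intervalIntegrable_eval_mul _ _ _ _).const_mul _), intervalIntegral.integral_const_mul] at h0
  rw [intervalIntegral.integral_add (intervalIntegrable_eval_mul _ _ _ _)
    (intervalIntegrable_eval_mul _ _ _ _)] at h1
  have hv1 : L.eval 1 = 1 := legendre_eval_one m
  have hv2 : L.eval (-1) = (-1) ^ m := legendre_eval_neg_one m
  have hv3 : ((-1 : ℝ) ^ m) * (-1) ^ m = 1 := by rw [← mul_pow]; norm_num
  simp only [eval_mul, eval_X, hv1, hv2] at h1
  rw [eq_div_iff (by positivity)]
  simp only [eval_mul, eval_X] at h0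
  linear_combination (-2 : ℝ) * h0 + h1 + hv3

/-! ### Legendre polynomials on a cell -/

variable {a b : ℝ}

theorem legendreOn_eval (a b : ℝ) (m : ℕ) (x : ℝ) :
    (legendreOn a b m).eval x = (legendre m).eval (2 / (b - a) * (x - (a + b) / 2)) := by
  simp [legendreOn, eval_comp]

theorem natDegree_legendreOn_le (a b : ℝ) (m : ℕ) : (legendreOn a b m).natDegree ≤ m := by
  refine natDegree_comp_le.trans ?_
  have h : (C (2 / (b - a)) * (X - C ((a + b) / 2)) : ℝ[X]).natDegree ≤ 1 := by compute_degree
  exact (Nat.mul_le_mul (natDegree_legendre_le m) h).trans (by simp)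

theorem legendreOn_eval_right (hab : a < b) (m : ℕ) : (legendreOn a b m).eval b = 1 := by
  rw [legendreOn_eval, ← legendre_eval_one m]
  congr 1
  field_simp [(sub_pos.mpr hab).ne']
  ring

theorem legendreOn_eval_left (hab : a < b) (m : ℕ) : (legendreOn a b m).eval a = (-1) ^ m := by
  rw [legendreOn_eval, ← legendre_eval_neg_one m]
  congr 1
  field_simp [(sub_pos.mpr hab).ne']
  ring

theorem integral_comp_affine (hab : a < b) (f : ℝ → ℝ) :
    ∫ x in a..b, f (2 / (b - a) * (x - (a + b) / 2)) = (b - a) / 2 * ∫ x in (-1 : ℝ)..1, f x := by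
  have hne : b - a ≠ 0 := (sub_pos.mpr hab).ne'
  have h := intervalIntegral.integral_comp_mul_sub (a := a) (b := b) f (c := 2 / (b - a))
    (by positivity) (2 / (b - a) * ((a + b) / 2))
  have e1 : 2 / (b - a) * a - 2 / (b - a) * ((a + b) / 2) = -1 := by field_simp; ring
  have e2 : 2 / (b - a) * b - 2 / (b - a) * ((a + b) / 2) = 1 := by field_simp; ring
  rw [e1, e2] at h
  simp only [← mul_sub, smul_eq_mul, inv_div] at h
  exact h

theorem integral_legendreOn_mul_eq_zero (hab : a < b) {m : ℕ} {w : ℝ[X]} (hw : w.degree < m) :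
    ∫ x in a..b, (legendreOn a b m).eval x * w.eval x = 0 := by
  rcases eq_or_ne w 0 with rfl | h0
  · simp
  set w' : ℝ[X] := w.comp (C ((b - a) / 2) * X + C ((a + b) / 2)) with hw'
  have hne : b - a ≠ 0 := (sub_pos.mpr hab).ne'
  have hd : w'.degree < m := by
    rw [degree_eq_natDegree h0] at hw
    have hw : w.natDegree < m := by exact_mod_cast hw
    refine degree_le_natDegree.trans_lt ?_
    have h : (C ((b - a) / 2) * X + C ((a + b) / 2) : ℝ[X]).natDegree ≤ 1 := by compute_degree
    have : w'.natDegree ≤ w.natDegree * 1 := natDegree_comp_le.trans (Nat.mul_le_mul_left _ h)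
    exact_mod_cast (by omega : w'.natDegree < m)
  have e : ∀ x : ℝ, (legendreOn a b m).eval x * w.eval x =
      (fun y => (legendre m).eval y * w'.eval y) (2 / (b - a) * (x - (a + b) / 2)) := fun x => by
    simp only [legendreOn_eval, hw', eval_comp, eval_add, eval_mul, eval_C, eval_X]
    congr 2
    field_simp
    ring
  simp only [e]
  rw [integral_comp_affine hab (fun y => (legendre m).eval y * w'.eval y),
    integral_legendre_mul_eq_zero hd, mul_zero]

theorem integral_legendreOn_sq (hab : a < b) (m : ℕ) :
    ∫ x in a..b, (legendreOn a b m).eval x * (legendreOn a b m).eval x =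
      (b - a) / (2 * m + 1) := by
  simp only [legendreOn_eval]
  rw [integral_comp_affine hab (fun y => (legendre m).eval y * (legendre m).eval y),
    integral_legendre_sq]
  ring

theorem exists_legendreOn_bound (k : ℕ) : ∃ B : ℝ, 1 ≤ B ∧ ∀ m ≤ k, ∀ a b : ℝ, a < b →
    ∀ x ∈ Set.Icc a b, |(legendreOn a b m).eval x| ≤ B := by
  have h : ∀ m : ℕ, ∃ B : ℝ, ∀ y ∈ Set.Icc (-1 : ℝ) 1, |(legendre m).eval y| ≤ B := fun m => by
    obtain ⟨B, hB⟩ := (isCompact_Icc (a := (-1 : ℝ)) (b := 1)).exists_bound_of_continuousOn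
      (legendre m).continuous.continuousOn
    exact ⟨B, hB⟩
  choose B hB using h
  refine ⟨1 + ∑ m ∈ Finset.range (k + 1), |B m|, by
    linarith [Finset.sum_nonneg fun i (_ : i ∈ Finset.range (k + 1)) => abs_nonneg (B i)], ?_⟩
  intro m hm a b hab x hx
  have hp : 0 < b - a := sub_pos.mpr hab
  rw [legendreOn_eval]
  have h1 := hB m (2 / (b - a) * (x - (a + b) / 2)) (by
    constructor
    · rw [div_mul_eq_mul_div, le_div_iff₀ hp]; linarith [hx.1]
    · rw [div_mul_eq_mul_div, div_le_iff₀ hp]; linarith [hx.2])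
  have h2 := Finset.single_le_sum (f := fun i => |B i|) (fun i _ => abs_nonneg (B i))
    (Finset.mem_range.mpr (Nat.lt_succ_of_le hm))
  have h3 := le_abs_self (B m)
  linarith

/-- A polynomial of degree at most `m` is, up to a multiple of the Legendre polynomial of degree
`m`, of degree less than `m`. -/
theorem exists_degree_sub_legendreOn_lt (hab : a < b) {m : ℕ} {p : ℝ[X]} (hp : p.natDegree ≤ m) :
    ∃ c : ℝ, (p - C c * legendreOn a b m).degree < m := by
  have hlead : (legendreOn a b m).coeff m ≠ 0 := by
    intro h0
    have hd : (legendreOn a b m).degree < m := by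
      rw [degree_lt_iff_coeff_zero]
      intro n hn
      rcases hn.eq_or_lt with rfl | h
      · exact h0
      · exact coeff_eq_zero_of_natDegree_lt ((natDegree_legendreOn_le a b m).trans_lt h)
    have h1 := integral_legendreOn_mul_eq_zero hab hd
    rw [integral_legendreOn_sq hab] at h1
    have : 0 < (b - a) / (2 * m + 1) := div_pos (sub_pos.mpr hab) (by positivity)
    exact this.ne' h1
  refine ⟨p.coeff m / (legendreOn a b m).coeff m, ?_⟩
  rw [degree_lt_iff_coeff_zero]
  intro n hn
  rw [coeff_sub, coeff_C_mul]
  rcases hn.eq_or_lt with rfl | h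
  · field_simp; ring
  · rw [coeff_eq_zero_of_natDegree_lt ((natDegree_legendreOn_le a b m).trans_lt h),
      coeff_eq_zero_of_natDegree_lt (hp.trans_lt h)]; ring

theorem eval_eq_sum_legendreOn (hab : a < b) {k : ℕ} {p : ℝ[X]} (hp : p.natDegree ≤ k) (x : ℝ) :
    p.eval x = ∑ m ∈ Finset.range (k + 1), (2 * m + 1) / (b - a) *
      (∫ y in a..b, p.eval y * (legendreOn a b m).eval y) * (legendreOn a b m).eval x := by
  have hne : b - a ≠ 0 := (sub_pos.mpr hab).ne'
  -- Induction on the degree: the top Legendre component is split off, and orthogonality leaves the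
  -- lower coefficients unchanged.
  have key : ∀ n : ℕ, ∀ p : ℝ[X], p.degree < n → p.eval x = ∑ m ∈ Finset.range n,
      (2 * m + 1) / (b - a) * (∫ y in a..b, p.eval y * (legendreOn a b m).eval y) *
        (legendreOn a b m).eval x := by
    intro n
    induction n with
    | zero =>
      intro p hp
      have : p = 0 := by simpa [degree_lt_iff_coeff_zero, Polynomial.ext_iff] using hp
      simp [this]
    | succ n ih =>
      intro p hp
      have hp' : p.natDegree ≤ n := by
        rcases eq_or_ne p 0 with rfl | h0
        · simp
        · rw [degree_eq_natDegree h0] at hp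
          exact Nat.lt_succ_iff.mp (by exact_mod_cast hp)
      obtain ⟨c, hc⟩ := exists_degree_sub_legendreOn_lt hab hp'
      have h1 := ih _ hc
      have hsplit : ∀ m, ∫ y in a..b, p.eval y * (legendreOn a b m).eval y =
          (∫ y in a..b, (p - C c * legendreOn a b n).eval y * (legendreOn a b m).eval y) +
            c * ∫ y in a..b, (legendreOn a b n).eval y * (legendreOn a b m).eval y := fun m => by
        rw [← intervalIntegral.integral_const_mul, ← intervalIntegral.integral_add
          (intervalIntegrable_eval_mul _ _ _ _) ((intervalIntegrable_eval_mul _ _ _ _).const_mul _)]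
        congr 1; ext y; simp; ring
      rw [Finset.sum_range_succ]
      have h2 : ∀ m ∈ Finset.range n, (2 * m + 1) / (b - a) *
          (∫ y in a..b, p.eval y * (legendreOn a b m).eval y) * (legendreOn a b m).eval x =
          (2 * m + 1) / (b - a) * (∫ y in a..b, (p - C c * legendreOn a b n).eval y *
            (legendreOn a b m).eval y) * (legendreOn a b m).eval x := fun m hm => by
        rw [hsplit, integral_legendreOn_mul_eq_zero hab]
        · simp
        · refine degree_le_natDegree.trans_lt ?_
          exact_mod_cast (natDegree_legendreOn_le a b m).trans_lt (Finset.mem_range.mp hm)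
      rw [Finset.sum_congr rfl h2, ← h1, hsplit, integral_legendreOn_sq hab]
      have h3 : ∫ y in a..b, (p - C c * legendreOn a b n).eval y * (legendreOn a b n).eval y = 0 := by
        simp only [mul_comm _ ((legendreOn a b n).eval _)]
        exact integral_legendreOn_mul_eq_zero hab hc
      have h4 : (2 * (n : ℝ) + 1) ≠ 0 := by positivity
      rw [h3]
      simp only [eval_sub, eval_mul, eval_C]
      field_simp
      ring
  refine key (k + 1) p (degree_le_natDegree.trans_lt ?_)
  exact_mod_cast Nat.lt_succ_of_le hp

end LDG
end

noncomputable section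

namespace LDG

/-! ## Gauss–Radau projections and their defect -/

/-- The other choice of alternating fluxes. -/
def Flux.flip : Flux → Flux
  | .minusPlus => .plusMinus
  | .plusMinus => .minusPlus

@[simp] theorem Flux.flip_flip (fl : Flux) : fl.flip.flip = fl := by cases fl <;> rfl

/-- The end of the cell `[a, b]` at which the projection for `u` interpolates. -/
def Flux.endpoint : Flux → ℝ → ℝ → ℝ
  | .minusPlus, _, b => b
  | .plusMinus, a, _ => a

/-- The Gauss–Radau projection used for `u`. -/
def radau (fl : Flux) (k : ℕ) (a b : ℝ) (f : ℝ → ℝ) : ℝ[X] :=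
  match fl with
  | .minusPlus => radauMinus k a b f
  | .plusMinus => radauPlus k a b f

/-- The Legendre coefficient of order `k` of the error of `radau`. -/
def coef (fl : Flux) (k : ℕ) (a b : ℝ) (f : ℝ → ℝ) : ℝ :=
  match fl with
  | .minusPlus => coefMinus k a b f
  | .plusMinus => coefPlus k a b f

def coefSign (fl : Flux) (k : ℕ) : ℝ :=
  match fl with
  | .minusPlus => -1
  | .plusMinus => (-1) ^ (k + 1)

/-- Up to the sign (-1)^k for the left end, the mean of p times this kernel is the value of p at the
interpolation point, for every p of degree at most k. This is why `coef` vanishes on such p. -/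
def coefKernel (fl : Flux) (k : ℕ) (a b : ℝ) : ℝ[X] :=
  match fl with
  | .minusPlus => ∑ m ∈ Finset.range (k + 1), C (2 * m + 1 : ℝ) * legendreOn a b m
  | .plusMinus =>
      ∑ m ∈ Finset.range (k + 1), C ((-1 : ℝ) ^ (k + m) * (2 * m + 1)) * legendreOn a b m

variable {a b : ℝ}

theorem Flux.endpoint_mem (fl : Flux) (hab : a ≤ b) : fl.endpoint a b ∈ Set.Icc a b := by
  cases fl
  · exact ⟨hab, le_rfl⟩
  · exact ⟨le_rfl, hab⟩

theorem isGaussRadau_radau (fl : Flux) (k : ℕ) (hab : a < b) {f : ℝ → ℝ}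
    (hf : ContinuousOn f (Set.Icc a b)) :
    IsGaussRadau k a b (fl.endpoint a b) f (radau fl k a b f) := by
  cases fl
  · exact isGaussRadau_gaussRadau k hab (Or.inr rfl) hf
  · exact isGaussRadau_gaussRadau k hab (Or.inl rfl) hf

theorem coef_eq (fl : Flux) (k : ℕ) (a b : ℝ) (f : ℝ → ℝ) :
    coef fl k a b f = coefSign fl k * f (fl.endpoint a b) +
      1 / (b - a) * ∫ x in a..b, f x * (coefKernel fl k a b).eval x := by
  cases fl
  · simp [coef, coefMinus, coefSign, coefKernel, Flux.endpoint, eval_finsetSum]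
  · simp [coef, coefPlus, coefSign, coefKernel, Flux.endpoint, eval_finsetSum]

theorem intervalIntegrable_mul_eval (hab : a ≤ b) {f : ℝ → ℝ} (hf : ContinuousOn f (Set.Icc a b))
    (w : ℝ[X]) : IntervalIntegrable (fun x => f x * w.eval x) volume a b :=
  ContinuousOn.intervalIntegrable (by
    rw [Set.uIcc_of_le hab]; exact hf.mul w.continuous.continuousOn)

theorem coef_sub (fl : Flux) (k : ℕ) (hab : a ≤ b) {f g : ℝ → ℝ}
    (hf : ContinuousOn f (Set.Icc a b)) (hg : ContinuousOn g (Set.Icc a b)) :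
    coef fl k a b (fun x => f x - g x) = coef fl k a b f - coef fl k a b g := by
  simp only [coef_eq, sub_mul]
  rw [intervalIntegral.integral_sub (intervalIntegrable_mul_eval hab hf _)
    (intervalIntegrable_mul_eval hab hg _)]
  ring

theorem coef_eval_eq_zero (fl : Flux) {k : ℕ} (hab : a < b) {p : ℝ[X]} (hp : p.natDegree ≤ k) :
    coef fl k a b (fun x => p.eval x) = 0 := by
  rw [coef_eq, eval_eq_sum_legendreOn hab hp (fl.endpoint a b)]
  have hint : ∀ c : ℕ → ℝ, ∫ x in a..b, p.eval x *
      (∑ m ∈ Finset.range (k + 1), C (c m) * legendreOn a b m).eval x =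
      ∑ m ∈ Finset.range (k + 1), c m * ∫ x in a..b, p.eval x * (legendreOn a b m).eval x := by
    intro c
    simp only [← intervalIntegral.integral_const_mul]
    rw [← intervalIntegral.integral_finsetSum fun m _ =>
      (intervalIntegrable_eval_mul _ _ _ _).const_mul _]
    congr 1; ext x
    rw [eval_finsetSum, Finset.mul_sum]
    refine Finset.sum_congr rfl fun m _ => ?_
    simp only [eval_mul, eval_C]; ring
  cases fl
  · simp only [coefKernel, coefSign, Flux.endpoint, hint, legendreOn_eval_right hab,
      Finset.mul_sum]
    rw [← Finset.sum_add_distrib]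
    refine Finset.sum_eq_zero fun m _ => ?_
    ring
  · simp only [coefKernel, coefSign, Flux.endpoint, hint, legendreOn_eval_left hab,
      Finset.mul_sum]
    rw [← Finset.sum_add_distrib]
    refine Finset.sum_eq_zero fun m _ => ?_
    rw [pow_add, pow_add]
    ring

/-- The error f - P f is orthogonal to degrees below k, so it sees only the component of w along the
Legendre polynomial of degree k. Its moment with that polynomial is read off from `coef`: the
endpoint terms of f and P f agree, and `coef` of P f is zero. -/
theorem integral_mul_sub_radau (fl : Flux) {k : ℕ} (hab : a < b) {f : ℝ → ℝ}
    (hf : ContinuousOn f (Set.Icc a b)) {w : ℝ[X]} (hw : w.natDegree ≤ k) :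
    (∫ x in a..b, f x * w.eval x) - ∫ x in a..b, (radau fl k a b f).eval x * w.eval x =
      coef fl k a b f * ∫ x in a..b, (legendreOn a b k).eval x * w.eval x := by
  obtain ⟨hdeg, horth, hend⟩ := isGaussRadau_radau fl k hab hf
  set p := radau fl k a b f with hp
  have hne : b - a ≠ 0 := (sub_pos.mpr hab).ne'
  have hpc : ContinuousOn (fun x => p.eval x) (Set.Icc a b) := p.continuous.continuousOn
  have hfi := intervalIntegrable_mul_eval hab.le hf
  have hpi := intervalIntegrable_mul_eval hab.le hpc
  let E : ℝ[X] → ℝ := fun w => (∫ x in a..b, f x * w.eval x) - ∫ x in a..b, p.eval x * w.eval x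
  have hElow : ∀ w : ℝ[X], w.degree < k → E w = 0 := fun w hw => by
    simp only [E, horth w hw, sub_self]
  have hElin : ∀ (c : ℝ) (w v : ℝ[X]), E (C c * w + v) = c * E w + E v := fun c w v => by
    have h1 : ∀ g : ℝ → ℝ, (∀ w : ℝ[X], IntervalIntegrable (fun x => g x * w.eval x) volume a b) →
        ∫ x in a..b, g x * (C c * w + v).eval x =
          c * (∫ x in a..b, g x * w.eval x) + ∫ x in a..b, g x * v.eval x := fun g hg => by
      rw [← intervalIntegral.integral_const_mul, ← intervalIntegral.integral_add
        ((hg w).const_mul c) (hg v)]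
      congr 1; ext x; simp; ring
    simp only [E, h1 f hfi, h1 _ hpi]
    ring
  have htop : E (legendreOn a b k) = coef fl k a b f * ((b - a) / (2 * k + 1)) := by
    have h0 : coef fl k a b f = 1 / (b - a) * E (coefKernel fl k a b) := by
      have h1 := coef_eval_eq_zero fl hab hdeg
      rw [coef_eq] at h1 ⊢
      rw [hend] at h1
      simp only [E]
      linear_combination h1
    -- Modulo degrees below k the kernel is (2k+1) times the top Legendre polynomial; for the left
    -- end the sign is (-1)^{2k} = 1.
    have h2 : ∃ v : ℝ[X], v.degree < (k : WithBot ℕ) ∧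
        coefKernel fl k a b = C (2 * k + 1 : ℝ) * legendreOn a b k + v := by
      have hlow : ∀ c : ℕ → ℝ,
          (∑ m ∈ Finset.range k, C (c m) * legendreOn a b m).degree < (k : WithBot ℕ) := fun c => by
        refine (degree_sum_le _ _).trans_lt ?_
        rw [Finset.sup_lt_iff (by exact WithBot.bot_lt_coe _)]
        intro m hm
        refine degree_le_natDegree.trans_lt ?_
        exact_mod_cast (natDegree_C_mul_le _ _).trans_lt
          ((natDegree_legendreOn_le a b m).trans_lt (Finset.mem_range.mp hm))
      cases fl
      · exact ⟨_, hlow _, by rw [coefKernel, Finset.sum_range_succ, add_comm]⟩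
      · refine ⟨_, hlow fun m => (-1) ^ (k + m) * (2 * m + 1), ?_⟩
        rw [coefKernel, Finset.sum_range_succ, add_comm, ← two_mul k, pow_mul, neg_one_sq, one_pow,
          one_mul]
    obtain ⟨v, hv, hK⟩ := h2
    rw [h0, hK, hElin, hElow v hv]
    have : (2 * (k : ℝ) + 1) ≠ 0 := by positivity
    field_simp
    ring
  obtain ⟨c, hc⟩ := exists_degree_sub_legendreOn_lt hab hw
  have hdec : w = C c * legendreOn a b k + (w - C c * legendreOn a b k) := by ring
  have h3 : ∫ x in a..b, (legendreOn a b k).eval x * w.eval x = c * ((b - a) / (2 * k + 1)) := by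
    rw [← integral_legendreOn_sq hab, ← intervalIntegral.integral_const_mul,
      ← sub_eq_zero, ← intervalIntegral.integral_sub (intervalIntegrable_eval_mul _ _ _ _)
        ((intervalIntegrable_eval_mul _ _ _ _).const_mul _),
      ← integral_legendreOn_mul_eq_zero hab hc]
    congr 1; ext x; simp; ring
  change E w = _
  rw [hdec, hElin, hElow _ hc, htop, ← hdec, h3]
  ring

theorem abs_integral_mul_le (hab : a ≤ b) {f g : ℝ → ℝ} {A B : ℝ}
    (hf : ∀ x ∈ Set.Icc a b, |f x| ≤ A) (hg : ∀ x ∈ Set.Icc a b, |g x| ≤ B) :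
    |∫ x in a..b, f x * g x| ≤ A * B * (b - a) := by
  have h := intervalIntegral.norm_integral_le_of_norm_le_const (a := a) (b := b)
    (f := fun x => f x * g x) (C := A * B) (fun x hx => by
      rw [Set.uIoc_of_le hab] at hx
      have hx' := Set.Ioc_subset_Icc_self hx
      rw [Real.norm_eq_abs, abs_mul]
      exact mul_le_mul (hf x hx') (hg x hx') (abs_nonneg _) ((abs_nonneg _).trans (hf x hx')))
  rwa [Real.norm_eq_abs, abs_of_nonneg (sub_nonneg.mpr hab)] at h

theorem exists_coefKernel_bound (k : ℕ) : ∃ B : ℝ, 0 < B ∧ ∀ fl : Flux, ∀ a b : ℝ, a < b →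
    ∀ x ∈ Set.Icc a b, |(coefKernel fl k a b).eval x| ≤ B := by
  obtain ⟨B, hB1, hB⟩ := exists_legendreOn_bound k
  refine ⟨∑ m ∈ Finset.range (k + 1), (2 * m + 1 : ℝ) * B,
    Finset.sum_pos (fun m _ => by positivity) ⟨0, by simp⟩, ?_⟩
  have key : ∀ c : ℕ → ℝ, (∀ m, |c m| ≤ 2 * m + 1) → ∀ a b : ℝ, a < b → ∀ x ∈ Set.Icc a b,
      |(∑ m ∈ Finset.range (k + 1), C (c m) * legendreOn a b m).eval x| ≤
        ∑ m ∈ Finset.range (k + 1), (2 * m + 1 : ℝ) * B := fun c hc a b hab x hx => by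
    rw [eval_finsetSum]
    refine (Finset.abs_sum_le_sum_abs _ _).trans (Finset.sum_le_sum fun m hm => ?_)
    rw [eval_mul, eval_C, abs_mul]
    exact mul_le_mul (hc m) (hB m (Nat.lt_succ_iff.mp (Finset.mem_range.mp hm)) a b hab x hx)
      (abs_nonneg _) (by positivity)
  intro fl
  cases fl
  · exact key _ fun m => by rw [abs_of_nonneg (by positivity)]
  · exact key _ fun m => by
      rw [abs_mul, abs_pow, abs_neg, abs_one, one_pow, one_mul, abs_of_nonneg (by positivity)]

theorem exists_coef_bound (k : ℕ) : ∃ B : ℝ, 0 < B ∧ ∀ fl : Flux, ∀ a b : ℝ, a < b →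
    ∀ (f : ℝ → ℝ) (A : ℝ), (∀ x ∈ Set.Icc a b, |f x| ≤ A) → |coef fl k a b f| ≤ B * A := by
  obtain ⟨B, hB0, hB⟩ := exists_coefKernel_bound k
  refine ⟨1 + B, by positivity, fun fl a b hab f A hA => ?_⟩
  have hp : 0 < b - a := sub_pos.mpr hab
  have hs : |coefSign fl k| = 1 := by cases fl <;> simp [coefSign]
  rw [coef_eq]
  have h1 := abs_integral_mul_le hab.le hA (hB fl a b hab)
  have h2 := hA _ (fl.endpoint_mem hab.le)
  refine (abs_add_le _ _).trans ?_
  rw [abs_mul, hs, one_mul, abs_mul, abs_of_pos (by positivity : 0 < 1 / (b - a))]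
  have h3 : 1 / (b - a) * |∫ x in a..b, f x * (coefKernel fl k a b).eval x| ≤ A * B := by
    rw [div_mul_eq_mul_div, one_mul, div_le_iff₀ hp]; exact h1
  linarith

/-- The projections are uniformly bounded in the maximum norm. -/
theorem exists_radau_bound (k : ℕ) : ∃ B : ℝ, 0 < B ∧ ∀ fl : Flux, ∀ a b : ℝ, a < b →
    ∀ (f : ℝ → ℝ) (A : ℝ), ContinuousOn f (Set.Icc a b) → (∀ x ∈ Set.Icc a b, |f x| ≤ A) →
      ∀ x ∈ Set.Icc a b, |(radau fl k a b f).eval x| ≤ B * A := by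
  obtain ⟨B, hB1, hB⟩ := exists_legendreOn_bound k
  obtain ⟨Bc, hBc0, hBc⟩ := exists_coef_bound k
  have hB0 : 0 < B := by linarith
  refine ⟨∑ m ∈ Finset.range (k + 1), (2 * m + 1 : ℝ) * (B + Bc * (B * B)) * B,
    Finset.sum_pos (fun m _ => by positivity) ⟨0, by simp⟩, ?_⟩
  intro fl a b hab f A hf hA x hx
  have hp : 0 < b - a := sub_pos.mpr hab
  rw [eval_eq_sum_legendreOn hab (isGaussRadau_radau fl k hab hf).1 x, Finset.sum_mul]
  refine (Finset.abs_sum_le_sum_abs _ _).trans (Finset.sum_le_sum fun m hm => ?_)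
  have hm : m ≤ k := Nat.lt_succ_iff.mp (Finset.mem_range.mp hm)
  -- The Legendre coefficients of the projection are those of f up to a multiple of `coef`, and both
  -- are bounded by the maximum of f, uniformly in the cell.
  have h1 := integral_mul_sub_radau fl hab hf (w := legendreOn a b m)
    ((natDegree_legendreOn_le a b m).trans hm)
  have h2 := abs_integral_mul_le hab.le hA (hB m hm a b hab)
  have h3 := abs_integral_mul_le hab.le (hB k le_rfl a b hab) (hB m hm a b hab)
  have h4 := hBc fl a b hab f A hA
  have hA0 : 0 ≤ A := (abs_nonneg _).trans (hA x hx)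
  have h5 : |∫ y in a..b, (radau fl k a b f).eval y * (legendreOn a b m).eval y| ≤
      (B + Bc * (B * B)) * A * (b - a) := by
    have : ∫ y in a..b, (radau fl k a b f).eval y * (legendreOn a b m).eval y =
      (∫ y in a..b, f y * (legendreOn a b m).eval y) -
        coef fl k a b f * ∫ x in a..b, (legendreOn a b k).eval x * (legendreOn a b m).eval x := by
      linarith
    rw [this]
    refine (abs_sub _ _).trans ?_
    rw [abs_mul]
    have h6 := mul_le_mul h4 h3 (abs_nonneg _) (by positivity)
    linarith
  rw [abs_mul, abs_mul, abs_of_pos (by positivity : 0 < (2 * (m : ℝ) + 1) / (b - a))]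
  calc _ ≤ (2 * (m : ℝ) + 1) / (b - a) * ((B + Bc * (B * B)) * A * (b - a)) * B := by
        gcongr
        exact hB m hm a b hab x hx
    _ = _ := by field_simp

/-! ## Correction functions -/

/-- The alternating iterates of `P_h^∓ D_s^{-1}` on the Legendre polynomial of degree `k`. -/
def corr (k : ℕ) (a b : ℝ) : ℕ → Flux → ℝ[X]
  | 0, _ => legendreOn a b k
  | n + 1, fl => radau fl k a b (primitive a b (corr k a b n fl.flip))

theorem hasDerivAt_primitive (a b : ℝ) (p : ℝ[X]) (x : ℝ) :
    HasDerivAt (primitive a b p) (2 / (b - a) * p.eval x) x :=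
  (intervalIntegral.integral_hasDerivAt_right (p.continuous.intervalIntegrable _ _)
    p.continuous.stronglyMeasurable.stronglyMeasurableAtFilter p.continuous.continuousAt).const_mul _

theorem continuous_primitive (a b : ℝ) (p : ℝ[X]) : Continuous (primitive a b p) :=
  continuous_iff_continuousAt.mpr fun x => (hasDerivAt_primitive a b p x).continuousAt

theorem natDegree_corr_le (hab : a < b) (k n : ℕ) (fl : Flux) :
    (corr k a b n fl).natDegree ≤ k := by
  cases n with
  | zero => exact natDegree_legendreOn_le a b k
  | succ n => exact (isGaussRadau_radau fl k hab (continuous_primitive _ _ _).continuousOn).1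

theorem primitive_left (a b : ℝ) (p : ℝ[X]) : primitive a b p a = 0 := by simp [primitive]

theorem exists_derivative_eq (p : ℝ[X]) :
    ∃ q : ℝ[X], derivative q = p ∧ ∀ n : ℕ, p.degree < n → q.degree < (n + 1 : ℕ) := by
  refine ⟨p.sum fun i c => monomial (i + 1) (c / (i + 1)), ?_, fun n hn => ?_⟩
  · rw [Polynomial.sum, derivative_sum]
    conv_rhs => rw [p.as_sum_support]
    refine Finset.sum_congr rfl fun i _ => ?_
    rw [derivative_monomial]
    congr 1
    push_cast
    field_simp
  · refine (degree_sum_le _ _).trans_lt ?_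
    rw [Finset.sup_lt_iff (by exact WithBot.bot_lt_coe _)]
    intro i hi
    refine (degree_monomial_le _ _).trans_lt ?_
    have : (i : WithBot ℕ) < n := (le_degree_of_mem_supp i hi).trans_lt hn
    exact_mod_cast Nat.succ_lt_succ (by exact_mod_cast this)

theorem integral_primitive_mul_derivative (a b : ℝ) (p v : ℝ[X]) :
    ∫ x in a..b, primitive a b p x * v.derivative.eval x =
      primitive a b p b * v.eval b - 2 / (b - a) * ∫ x in a..b, p.eval x * v.eval x := by
  have h := intervalIntegral.integral_mul_deriv_eq_deriv_mul (a := a) (b := b)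
    (u := primitive a b p) (v := fun x => v.eval x) (u' := fun x => 2 / (b - a) * p.eval x)
    (v' := fun x => v.derivative.eval x) (fun x _ => hasDerivAt_primitive a b p x)
    (fun x _ => v.hasDerivAt x)
    ((continuous_const.mul p.continuous).intervalIntegrable _ _)
    (v.derivative.continuous.intervalIntegrable _ _)
  rw [h, primitive_left, ← intervalIntegral.integral_const_mul]
  simp only [mul_assoc, zero_mul, sub_zero]

/-- Each step costs one degree. For w of degree below k - n - 1 the Radau projection can be dropped;
writing w = q' and integrating by parts moves the primitive onto q, one degree higher. The boundary
term at b vanishes because the previous function has mean zero. -/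
theorem integral_corr_mul_eq_zero (hab : a < b) {k n : ℕ} (hn : n ≤ k) (fl : Flux) {w : ℝ[X]}
    (hw : w.degree < (k - n : ℕ)) : ∫ x in a..b, (corr k a b n fl).eval x * w.eval x = 0 := by
  induction n generalizing fl w with
  | zero => exact integral_legendreOn_mul_eq_zero hab (by simpa using hw)
  | succ n ih =>
    obtain ⟨q, hq, hqd⟩ := exists_derivative_eq w
    have h1 : q.degree < (k - n : ℕ) := by
      have := hqd _ hw
      rwa [show k - (n + 1) + 1 = k - n by omega] at this
    have hwk : w.degree < k := hw.trans_le (by exact_mod_cast Nat.sub_le _ _)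
    have hone : (1 : ℝ[X]).degree < (k - n : ℕ) := by
      rw [degree_one]; exact_mod_cast (by omega : 0 < k - n)
    have h2 : primitive a b (corr k a b n fl.flip) b = 0 := by
      have := ih (by omega) fl.flip hone
      simp only [eval_one, mul_one] at this
      rw [primitive, this, mul_zero]
    rw [corr, (isGaussRadau_radau fl k hab (continuous_primitive _ _ _).continuousOn).2.1 w hwk,
      ← hq, integral_primitive_mul_derivative, h2, ih (by omega) fl.flip h1]
    simp

theorem primitive_corr_right (hab : a < b) {k n : ℕ} (hn : n < k) (fl : Flux) :
    primitive a b (corr k a b n fl) b = 0 := by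
  have hone : (1 : ℝ[X]).degree < (k - n : ℕ) := by
    rw [degree_one]; exact_mod_cast (by omega : 0 < k - n)
  have := integral_corr_mul_eq_zero hab hn.le fl hone
  simp only [eval_one, mul_one] at this
  rw [primitive, this, mul_zero]

/-- The primitive vanishes at a by construction and at b because `corr n` has mean zero. Hence
corrections leave the interpolated nodal values intact, and the numerical fluxes do not see them. -/
theorem corr_succ_eval_endpoint (hab : a < b) {k n : ℕ} (hn : n < k) (fl : Flux) :
    (corr k a b (n + 1) fl).eval (fl.endpoint a b) = 0 := by
  rw [corr, (isGaussRadau_radau fl k hab (continuous_primitive _ _ _).continuousOn).2.2]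
  cases fl
  · exact primitive_corr_right hab hn _
  · exact primitive_left _ _ _

/-- The link between consecutive corrections: v' has degree below k, so the Radau projection is
invisible, and the remaining D_s^{-1} is undone by parts. -/
theorem integral_corr_succ_mul_derivative (hab : a < b) {k n : ℕ} (hn : n < k) (fl : Flux)
    {v : ℝ[X]} (hv : v.natDegree ≤ k) :
    ∫ x in a..b, (corr k a b (n + 1) fl).eval x * v.derivative.eval x =
      -(2 / (b - a) * ∫ x in a..b, (corr k a b n fl.flip).eval x * v.eval x) := by
  have hd : v.derivative.degree < k := by
    rcases Nat.eq_zero_or_pos v.natDegree with h0 | h0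
    · rw [derivative_of_natDegree_zero h0, degree_zero]; exact WithBot.bot_lt_coe _
    · refine degree_le_natDegree.trans_lt ?_
      exact_mod_cast (natDegree_derivative_lt h0.ne').trans_le hv
  rw [corr, (isGaussRadau_radau fl k hab (continuous_primitive _ _ _).continuousOn).2.1 _ hd,
    integral_primitive_mul_derivative, primitive_corr_right hab hn]
  ring

theorem exists_corr_bound (k n : ℕ) : ∃ B : ℝ, 0 < B ∧ ∀ fl : Flux, ∀ a b : ℝ, a < b →
    ∀ x ∈ Set.Icc a b, |(corr k a b n fl).eval x| ≤ B := by
  obtain ⟨R, hR0, hR⟩ := exists_radau_bound k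
  induction n with
  | zero =>
    obtain ⟨B, hB1, hB⟩ := exists_legendreOn_bound k
    exact ⟨B, by linarith, fun _ => hB k le_rfl⟩
  | succ n ih =>
    obtain ⟨B, hB0, hB⟩ := ih
    refine ⟨R * (2 * B), by positivity, fun fl a b hab x hx => ?_⟩
    refine hR fl a b hab _ _ (continuous_primitive _ _ _).continuousOn (fun y hy => ?_) x hx
    have hp : 0 < b - a := sub_pos.mpr hab
    have h1 := intervalIntegral.norm_integral_le_of_norm_le_const (a := a) (b := y)
      (f := fun z => (corr k a b n fl.flip).eval z) (C := B) (fun z hz => by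
        rw [Set.uIoc_of_le hy.1] at hz
        exact hB _ a b hab z ⟨hz.1.le, hz.2.trans hy.2⟩)
    rw [Real.norm_eq_abs, abs_of_nonneg (sub_nonneg.mpr hy.1)] at h1
    rw [primitive, abs_mul, abs_of_pos (by positivity : 0 < 2 / (b - a)), div_mul_eq_mul_div,
      div_le_iff₀ hp]
    nlinarith [hy.2]

/-! ## Approximation -/

/-- A Taylor polynomial built by repeated integration from the constant g_k(a). Only the oscillation
of g_k enters, so the lemma serves both for Lipschitz bounds and for bounds in L² of the next
derivative. -/
theorem exists_polynomial_approx {k : ℕ} (hab : a ≤ b) {g : ℕ → ℝ → ℝ} {B : ℝ}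
    (hg : ∀ i < k, ∀ x ∈ Set.Icc a b, HasDerivWithinAt (g i) (g (i + 1) x) (Set.Icc a b) x)
    (hB : ∀ x ∈ Set.Icc a b, |g k x - g k a| ≤ B) :
    ∃ p : ℝ[X], p.natDegree ≤ k ∧ ∀ x ∈ Set.Icc a b, |g 0 x - p.eval x| ≤ B * (b - a) ^ k := by
  induction k generalizing g with
  | zero => exact ⟨C (g 0 a), by simp, fun x hx => by simpa using hB x hx⟩
  | succ k ih =>
    obtain ⟨p, hp, hpB⟩ := ih (g := fun i => g (i + 1)) (fun i hi => hg (i + 1) (by omega)) hB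
    obtain ⟨q, hq, hqd⟩ := exists_derivative_eq p
    have hqd : q.natDegree ≤ k + 1 := by
      have h1 : q.degree < (k + 1 + 1 : ℕ) := hqd (k + 1) (degree_le_natDegree.trans_lt (by
        exact_mod_cast Nat.lt_succ_of_le hp))
      rcases eq_or_ne q 0 with rfl | h0
      · simp
      · rw [← natDegree_lt_iff_degree_lt h0] at h1
        omega
    refine ⟨q + C (g 0 a - q.eval a), ?_, fun x hx => ?_⟩
    · rw [natDegree_add_C]; exact hqd
    · have hd : ∀ y ∈ Set.Icc a b, HasDerivWithinAt (fun y => g 0 y - q.eval y)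
          (g 1 y - p.eval y) (Set.Icc a b) y := fun y hy => by
        have := (hg 0 (by omega) y hy).sub (q.hasDerivAt y).hasDerivWithinAt
        rw [hq] at this
        exact this
      have h := (convex_Icc a b).norm_image_sub_le_of_norm_hasDerivWithin_le hd hpB
        ⟨le_rfl, hab⟩ hx
      rw [Real.norm_eq_abs, Real.norm_eq_abs, abs_of_nonneg (sub_nonneg.mpr hx.1)] at h
      have hB0 : 0 ≤ B := (abs_nonneg _).trans (hB a ⟨le_rfl, hab⟩)
      have hab' := sub_nonneg.mpr hab
      calc |g 0 x - (q + C (g 0 a - q.eval a)).eval x|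
          = |g 0 x - q.eval x - (g 0 a - q.eval a)| := by simp; ring_nf
        _ ≤ B * (b - a) ^ k * (x - a) := h
        _ ≤ B * (b - a) ^ k * (b - a) := by gcongr; exact hx.2
        _ = B * (b - a) ^ (k + 1) := by ring

/-- A Bramble–Hilbert argument: `coef` is bounded in the maximum norm and annihilates polynomials of
degree at most k. -/
theorem exists_coef_approx (k : ℕ) : ∃ K : ℝ, 0 < K ∧ ∀ fl : Flux, ∀ a b : ℝ, a < b →
    ∀ (g : ℕ → ℝ → ℝ) (B : ℝ), ContinuousOn (g 0) (Set.Icc a b) →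
      (∀ i < k, ∀ x ∈ Set.Icc a b, HasDerivWithinAt (g i) (g (i + 1) x) (Set.Icc a b) x) →
      (∀ x ∈ Set.Icc a b, |g k x - g k a| ≤ B) → |coef fl k a b (g 0)| ≤ K * (B * (b - a) ^ k) := by
  obtain ⟨K, hK0, hK⟩ := exists_coef_bound k
  refine ⟨K, hK0, fun fl a b hab g B hc hg hB => ?_⟩
  obtain ⟨p, hp, hpB⟩ := exists_polynomial_approx hab.le hg hB
  have h := hK fl a b hab _ _ hpB
  rwa [coef_sub fl k hab.le hc p.continuous.continuousOn, coef_eval_eq_zero fl hab hp,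
    sub_zero] at h

end LDG
end

/-! ### Regularity: from weak derivatives to time increments of heat solutions -/

noncomputable section

namespace LDG

/-! ## Weak derivatives on an interval -/

variable {c d : ℝ}

/-- The lemma of du Bois-Reymond. -/
theorem exists_ae_eq_const_of_integral_mul_deriv_eq_zero (hcd : c < d) {g : ℝ → ℝ}
    (hg : IntegrableOn g (Set.Ioo c d))
    (h : ∀ φ : ℝ → ℝ, ContDiff ℝ ∞ φ → HasCompactSupport φ → tsupport φ ⊆ Set.Ioo c d →
      ∫ x in Set.Ioo c d, g x * deriv φ x = 0) :
    ∃ C : ℝ, ∀ᵐ x ∂volume.restrict (Set.Ioo c d), g x = C := by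
  have hr : 0 < d - c := sub_pos.mpr hcd
  let f : ContDiffBump ((c + d) / 2) := ⟨(d - c) / 8, (d - c) / 4, by linarith, by linarith⟩
  set χ : ℝ → ℝ := f.normed volume with hχ
  have hχs : tsupport χ ⊆ Set.Ioo c d := by
    rw [hχ, f.tsupport_normed_eq, Real.closedBall_eq_Icc]
    intro x hx
    have h1 : f.rOut = (d - c) / 4 := rfl
    rw [h1] at hx
    exact ⟨by linarith [hx.1], by linarith [hx.2]⟩
  have hχc : HasCompactSupport χ := f.hasCompactSupport_normed
  have hχd : ContDiff ℝ ∞ χ := f.contDiff_normed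
  have hχi : ∫ x, χ x = 1 := f.integral_normed
  have hint : ∀ ψ : ℝ → ℝ, Continuous ψ → HasCompactSupport ψ →
      IntegrableOn (fun x => g x * ψ x) (Set.Ioo c d) := fun ψ hψ hψc => by
    obtain ⟨B, hB⟩ := hψc.exists_bound_of_continuous hψ
    exact Integrable.mul_bdd hg hψ.aestronglyMeasurable (Filter.Eventually.of_forall hB)
  refine ⟨∫ x in Set.Ioo c d, g x * χ x, ?_⟩
  set C := ∫ x in Set.Ioo c d, g x * χ x with hC
  have hgl : LocallyIntegrableOn (fun x => g x - C) (Set.Ioo c d) :=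
    (hg.sub (integrableOn_const (by simp))).locallyIntegrableOn
  have key := isOpen_Ioo.ae_eq_zero_of_integral_contDiff_smul_eq_zero hgl ?_
  · rw [ae_restrict_iff' measurableSet_Ioo]
    filter_upwards [key] with x hx hxI using sub_eq_zero.mp (hx hxI)
  intro ψ hψd hψc hψs
  set I := ∫ x, ψ x with hI
  -- θ has mean zero, so its primitive from c has compact support in (c, d) and is an admissible
  -- test function. Testing with it shows that g - C annihilates ψ.
  let θ : ℝ → ℝ := fun x => ψ x - I * χ x
  have hθd : ContDiff ℝ ∞ θ := hψd.sub (contDiff_const.mul hχd)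
  obtain ⟨α, β, hα, hβ, hK⟩ : ∃ α β : ℝ, c < α ∧ β < d ∧ tsupport ψ ∪ tsupport χ ⊆ Set.Icc α β := by
    have hcomp : IsCompact (tsupport ψ ∪ tsupport χ) := hψc.isCompact.union hχc.isCompact
    have hne : (tsupport ψ ∪ tsupport χ).Nonempty := by
      refine Set.Nonempty.inr ?_
      by_contra h0
      rw [Set.not_nonempty_iff_eq_empty, tsupport_eq_empty_iff] at h0
      rw [h0] at hχi
      simp at hχi
    have hsub : tsupport ψ ∪ tsupport χ ⊆ Set.Ioo c d := Set.union_subset hψs hχs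
    obtain ⟨α, hα⟩ := hcomp.exists_isLeast hne
    obtain ⟨β, hβ⟩ := hcomp.exists_isGreatest hne
    exact ⟨α, β, (hsub hα.1).1, (hsub hβ.1).2, fun x hx => ⟨hα.2 hx, hβ.2 hx⟩⟩
  have hθ0 : ∀ x, x ∉ Set.Icc α β → θ x = 0 := fun x hx => by
    have h1 : ψ x = 0 := image_eq_zero_of_notMem_tsupport fun h => hx (hK (Or.inl h))
    have h2 : χ x = 0 := image_eq_zero_of_notMem_tsupport fun h => hx (hK (Or.inr h))
    simp [θ, h1, h2]
  have hψi : Integrable ψ := hψd.continuous.integrable_of_hasCompactSupport hψc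
  have hχint : Integrable χ := hχd.continuous.integrable_of_hasCompactSupport hχc
  have hθi : ∫ x, θ x = 0 := by
    simp only [θ]
    rw [integral_sub hψi (hχint.const_mul _), integral_const_mul, hχi, mul_one, sub_self]
  let φ : ℝ → ℝ := fun x => ∫ y in c..x, θ y
  have hφ' : ∀ x, HasDerivAt φ (θ x) x := fun x =>
    intervalIntegral.integral_hasDerivAt_right (hθd.continuous.intervalIntegrable _ _)
      hθd.continuous.stronglyMeasurable.stronglyMeasurableAtFilter hθd.continuous.continuousAt
  have hφd : deriv φ = θ := funext fun x => (hφ' x).deriv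
  have hφc : ContDiff ℝ ∞ φ := by
    rw [contDiff_infty_iff_deriv, hφd]
    exact ⟨fun x => (hφ' x).differentiableAt, hθd⟩
  have hφ0 : ∀ x, x ∉ Set.Icc α β → φ x = 0 := fun x hx => by
    rcases lt_or_ge x α with h1 | h1
    · refine (intervalIntegral.integral_congr (g := fun _ => (0 : ℝ)) fun y hy => ?_).trans (by simp)
      refine hθ0 y fun h2 => ?_
      have := (Set.mem_uIcc.mp hy)
      rcases this with h3 | h3 <;> linarith [h2.1, h3.2]
    · have h2 : β < x := by
        by_contra h3
        exact hx ⟨h1, not_lt.mp h3⟩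
      rw [← hθi]
      refine intervalIntegral.integral_eq_integral_of_support_subset fun y hy => ?_
      have h3 : y ∈ Set.Icc α β := by
        by_contra h4
        exact hy (hθ0 y h4)
      exact ⟨by linarith [h3.1], by linarith [h3.2]⟩
  have hφsub : tsupport φ ⊆ Set.Icc α β := by
    refine closure_minimal (fun x hx => ?_) isClosed_Icc
    by_contra h4
    exact hx (hφ0 x h4)
  have h1 := h φ hφc (HasCompactSupport.of_support_subset_isCompact isCompact_Icc
    ((subset_tsupport φ).trans hφsub)) (hφsub.trans fun x hx =>
      ⟨by linarith [hx.1], by linarith [hx.2]⟩)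
  rw [hφd] at h1
  have h2 : ∫ x in Set.Ioo c d, g x * θ x = (∫ x in Set.Ioo c d, g x * ψ x) - I * C := by
    rw [hC, ← integral_const_mul, ← integral_sub (hint ψ hψd.continuous hψc)
      ((hint χ hχd.continuous hχc).const_mul I)]
    congr 1; ext x; simp only [θ]; ring
  have h3 : I = ∫ x in Set.Ioo c d, ψ x := by
    rw [hI, setIntegral_eq_integral_of_forall_compl_eq_zero]
    intro x hx
    exact image_eq_zero_of_notMem_tsupport fun h => hx (hψs h)
  have h4 : ∫ x, ψ x • (g x - C) = ∫ x in Set.Ioo c d, (g x * ψ x - C * ψ x) := by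
    rw [← setIntegral_eq_integral_of_forall_compl_eq_zero (s := Set.Ioo c d)]
    · congr 1; ext x; simp only [smul_eq_mul]; ring
    · intro x hx
      rw [image_eq_zero_of_notMem_tsupport fun h => hx (hψs h), zero_smul]
  rw [h4, integral_sub (hint ψ hψd.continuous hψc) (hψi.integrableOn.const_mul C),
    integral_const_mul, ← h3]
  linarith

/-- The primitive of g₁ is absolutely continuous and has weak derivative g₁, so the difference with
g has zero weak derivative and is constant. -/
theorem exists_ae_eq_add_integral (hcd : c < d) {g g₁ : ℝ → ℝ} (hg : IntegrableOn g (Set.Ioo c d))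
    (hg₁ : IntegrableOn g₁ (Set.Ioo c d))
    (h : ∀ φ : ℝ → ℝ, ContDiff ℝ ∞ φ → HasCompactSupport φ → tsupport φ ⊆ Set.Ioo c d →
      ∫ x in Set.Ioo c d, g x * deriv φ x = -∫ x in Set.Ioo c d, g₁ x * φ x) :
    ∃ C : ℝ, ∀ᵐ x ∂volume.restrict (Set.Ioo c d), g x = C + ∫ y in c..x, g₁ y := by
  have hi : IntervalIntegrable g₁ volume c d :=
    (intervalIntegrable_iff_integrableOn_Ioo_of_le hcd.le).mpr hg₁
  set G : ℝ → ℝ := fun x => ∫ y in c..x, g₁ y with hG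
  have hGac : AbsolutelyContinuousOnInterval G c d :=
    hi.absolutelyContinuousOnInterval_intervalIntegral Set.left_mem_uIcc
  have hGc : ContinuousOn G (Set.Icc c d) := by
    have := hGac.continuousOn
    rwa [Set.uIcc_of_le hcd.le] at this
  have hGi : IntegrableOn G (Set.Ioo c d) :=
    (hGc.integrableOn_Icc).mono_set Set.Ioo_subset_Icc_self
  obtain ⟨C, hC⟩ := exists_ae_eq_const_of_integral_mul_deriv_eq_zero hcd (hg.sub hGi) (by
    intro φ hφ hφc hφs
    have hφ1 : ContDiff ℝ 1 φ := hφ.of_le (by exact_mod_cast le_top)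
    have hφ'c : HasCompactSupport (deriv φ) := hφc.deriv
    have hφ'cont : Continuous (deriv φ) := hφ1.continuous_deriv le_rfl
    have hint : ∀ f : ℝ → ℝ, IntegrableOn f (Set.Ioo c d) →
        IntegrableOn (fun x => f x * deriv φ x) (Set.Ioo c d) := fun f hf => by
      obtain ⟨B, hB⟩ := hφ'c.exists_bound_of_continuous hφ'cont
      exact Integrable.mul_bdd hf hφ'cont.aestronglyMeasurable (Filter.Eventually.of_forall hB)
    have hφac : AbsolutelyContinuousOnInterval φ c d := by
      obtain ⟨K, hK⟩ := hφ1.lipschitzWith_of_hasCompactSupport hφc one_ne_zero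
      exact (hK.lipschitzOnWith (s := Set.uIcc c d)).absolutelyContinuousOnInterval
    have hibp := hGac.integral_mul_deriv_eq_deriv_mul hφac
    have hφc0 : φ c = 0 := image_eq_zero_of_notMem_tsupport fun h => (hφs h).1.false
    have hφd0 : φ d = 0 := image_eq_zero_of_notMem_tsupport fun h => (hφs h).2.false
    rw [hφc0, hφd0] at hibp
    have hder : ∫ x in c..d, deriv G x * φ x = ∫ x in c..d, g₁ x * φ x := by
      refine intervalIntegral.integral_congr_ae ?_
      filter_upwards [hi.ae_hasDerivAt_integral] with x hx hxI
      rw [Set.uIoc_of_le hcd.le] at hxI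
      rw [(hx (by rw [Set.uIcc_of_le hcd.le]; exact Set.Ioc_subset_Icc_self hxI) c
        Set.left_mem_uIcc).deriv]
    rw [hder] at hibp
    rw [intervalIntegral.integral_of_le hcd.le, intervalIntegral.integral_of_le hcd.le,
      integral_Ioc_eq_integral_Ioo, integral_Ioc_eq_integral_Ioo] at hibp
    have h1 : ∫ x in Set.Ioo c d, (g - G) x * deriv φ x =
        (∫ x in Set.Ioo c d, g x * deriv φ x) - ∫ x in Set.Ioo c d, G x * deriv φ x := by
      rw [← integral_sub (hint g hg) (hint G hGi)]
      congr 1; ext x; simp only [Pi.sub_apply]; ring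
    rw [h1, h φ hφ hφc hφs, hibp]
    ring)
  refine ⟨C, ?_⟩
  filter_upwards [hC] with x hx
  simp only [Pi.sub_apply] at hx
  linarith

theorem eqOn_Icc_of_ae_eq_Ioo (hcd : c < d) {f g : ℝ → ℝ}
    (h : ∀ᵐ x ∂volume.restrict (Set.Ioo c d), f x = g x) (hf : ContinuousOn f (Set.Icc c d))
    (hg : ContinuousOn g (Set.Icc c d)) : Set.EqOn f g (Set.Icc c d) := by
  refine Measure.eqOn_Icc_of_ae_eq volume hcd.ne ?_ hf hg
  rwa [Filter.EventuallyEq, ← Measure.restrict_congr_set Ioo_ae_eq_Icc]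

theorem abs_le_of_ae_abs_le (hcd : c < d) {f : ℝ → ℝ} {B : ℝ}
    (h : ∀ᵐ x ∂volume.restrict (Set.Ioo c d), |f x| ≤ B) (hf : ContinuousOn f (Set.Icc c d)) :
    ∀ x ∈ Set.Icc c d, |f x| ≤ B := fun x hx => by
  -- Equality almost everywhere of continuous functions extends to the closed interval; writing the
  -- inequality as max |f| B = B makes this applicable.
  have := eqOn_Icc_of_ae_eq_Ioo hcd (f := fun x => max |f x| B) (g := fun _ => B) (by
    filter_upwards [h] with x hx using max_eq_right hx) (by fun_prop) continuousOn_const hx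
  exact max_eq_right_iff.mp this

theorem hasDerivWithinAt_integral_Icc (hcd : c ≤ d) {f : ℝ → ℝ} (hf : ContinuousOn f (Set.Icc c d))
    {x : ℝ} (hx : x ∈ Set.Icc c d) :
    HasDerivWithinAt (fun z => ∫ y in c..z, f y) (f x) (Set.Icc c d) x := by
  have hF : Continuous (Set.IccExtend hcd ((Set.Icc c d).domRestrict f)) :=
    (continuousOn_iff_continuous_domRestrict.mp hf).Icc_extend'
  have hFf : ∀ y ∈ Set.Icc c d, Set.IccExtend hcd ((Set.Icc c d).domRestrict f) y = f y :=
    fun y hy => Set.IccExtend_of_mem hcd _ hy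
  have h1 := (intervalIntegral.integral_hasDerivAt_right (hF.intervalIntegrable c x)
    hF.stronglyMeasurable.stronglyMeasurableAtFilter hF.continuousAt).hasDerivWithinAt
    (s := Set.Icc c d)
  rw [hFf x hx] at h1
  refine h1.congr (fun z hz => ?_) ?_
  all_goals
    refine intervalIntegral.integral_congr fun y hy => (hFf y ?_).symm
  · rw [Set.uIcc_of_le hz.1] at hy; exact ⟨hy.1, hy.2.trans hz.2⟩
  · rw [Set.uIcc_of_le hx.1] at hy; exact ⟨hy.1, hy.2.trans hx.2⟩

theorem continuousOn_of_lipschitz {s : Set ℝ} {f : ℝ → ℝ} {B : ℝ}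
    (h : ∀ x ∈ s, ∀ y ∈ s, |f x - f y| ≤ B * |x - y|) : ContinuousOn f s := by
  refine (LipschitzOnWith.of_dist_le_mul (K := Real.toNNReal B) fun x hx y hy => ?_).continuousOn
  refine (h x hx y hy).trans ?_
  rw [Real.dist_eq]
  exact mul_le_mul_of_nonneg_right (Real.le_coe_toNNReal B) (abs_nonneg _)

theorem exists_lipschitz_of_weak (hcd : c < d) {B : ℝ} {E₀ E₁ : ℝ → ℝ}
    (hm₀ : AEStronglyMeasurable E₀ (volume.restrict (Set.Ioo c d)))
    (hm₁ : AEStronglyMeasurable E₁ (volume.restrict (Set.Ioo c d)))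
    (hB₀ : ∀ᵐ x ∂volume.restrict (Set.Ioo c d), |E₀ x| ≤ B)
    (hB₁ : ∀ᵐ x ∂volume.restrict (Set.Ioo c d), |E₁ x| ≤ B)
    (hE : ∀ φ : ℝ → ℝ, ContDiff ℝ ∞ φ → HasCompactSupport φ → tsupport φ ⊆ Set.Ioo c d →
      ∫ x in Set.Ioo c d, E₀ x * deriv φ x = -∫ x in Set.Ioo c d, E₁ x * φ x) :
    ∃ C : ℝ, (∀ᵐ x ∂volume.restrict (Set.Ioo c d), E₀ x = C + ∫ y in c..x, E₁ y) ∧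
      (∀ x ∈ Set.Icc c d, |C + ∫ y in c..x, E₁ y| ≤ B) ∧
      ∀ x ∈ Set.Icc c d, ∀ y ∈ Set.Icc c d,
        |(C + ∫ z in c..x, E₁ z) - (C + ∫ z in c..y, E₁ z)| ≤ B * |x - y| := by
  have hi₀ : IntegrableOn E₀ (Set.Ioo c d) := Integrable.of_bound hm₀ B hB₀
  have hi₁ : IntegrableOn E₁ (Set.Ioo c d) := Integrable.of_bound hm₁ B hB₁
  obtain ⟨C, hC⟩ := exists_ae_eq_add_integral hcd hi₀ hi₁ hE
  have hii : IntervalIntegrable E₁ volume c d :=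
    (intervalIntegrable_iff_integrableOn_Ioo_of_le hcd.le).mpr hi₁
  have hsub : ∀ x ∈ Set.Icc c d, IntervalIntegrable E₁ volume c x := fun x hx =>
    hii.mono_set (by
      rw [Set.uIcc_of_le hcd.le, Set.uIcc_of_le hx.1]; exact Set.Icc_subset_Icc_right hx.2)
  rw [ae_restrict_iff' measurableSet_Ioo] at hB₁
  have hlip : ∀ x ∈ Set.Icc c d, ∀ y ∈ Set.Icc c d,
      |(C + ∫ z in c..x, E₁ z) - (C + ∫ z in c..y, E₁ z)| ≤ B * |x - y| := by
    intro x hx y hy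
    rw [add_sub_add_left_eq_sub, intervalIntegral.integral_interval_sub_left (hsub x hx) (hsub y hy)]
    change ‖∫ z in y..x, E₁ z‖ ≤ B * |x - y|
    refine intervalIntegral.norm_integral_le_of_norm_le_const_ae ?_
    have hd : ∀ᵐ z : ℝ, z ≠ d := by simp [ae_iff]
    filter_upwards [hB₁, hd] with z hz hzd hzI
    refine hz ⟨?_, lt_of_le_of_ne ?_ hzd⟩
    · exact (le_min hy.1 hx.1).trans_lt hzI.1
    · exact hzI.2.trans (max_le hy.2 hx.2)
  refine ⟨C, hC, abs_le_of_ae_abs_le hcd ?_ (continuousOn_of_lipschitz hlip), hlip⟩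
  filter_upwards [hC, hB₀] with x hx hx'
  rwa [← hx]

/-- A function with bounded weak derivatives of orders up to `r + 1` is of class `C^r` with
Lipschitz derivatives. -/
theorem exists_classical_of_weak (hcd : c < d) {B : ℝ} (r : ℕ) {E : ℕ → ℝ → ℝ}
    (hm : ∀ i ≤ r + 1, AEStronglyMeasurable (E i) (volume.restrict (Set.Ioo c d)))
    (hB : ∀ i ≤ r + 1, ∀ᵐ x ∂volume.restrict (Set.Ioo c d), |E i x| ≤ B)
    (hE : ∀ i ≤ r, ∀ φ : ℝ → ℝ, ContDiff ℝ ∞ φ → HasCompactSupport φ → tsupport φ ⊆ Set.Ioo c d →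
      ∫ x in Set.Ioo c d, E i x * deriv φ x = -∫ x in Set.Ioo c d, E (i + 1) x * φ x) :
    ∃ g : ℕ → ℝ → ℝ, (∀ᵐ x ∂volume.restrict (Set.Ioo c d), E 0 x = g 0 x) ∧
      (∀ i ≤ r, ∀ x ∈ Set.Icc c d, |g i x| ≤ B) ∧
      (∀ i ≤ r, ∀ x ∈ Set.Icc c d, ∀ y ∈ Set.Icc c d, |g i x - g i y| ≤ B * |x - y|) ∧
      ∀ i < r, ∀ x ∈ Set.Icc c d, HasDerivWithinAt (g i) (g (i + 1) x) (Set.Icc c d) x := by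
  induction r generalizing E with
  | zero =>
    obtain ⟨C, hC, hbd, hlip⟩ := exists_lipschitz_of_weak hcd (hm 0 (by omega)) (hm 1 (by omega))
      (hB 0 (by omega)) (hB 1 (by omega)) (hE 0 (by omega))
    exact ⟨fun _ x => C + ∫ y in c..x, E 1 y, hC, fun _ _ => hbd, fun _ _ => hlip,
      fun i hi => by omega⟩
  | succ r ih =>
    obtain ⟨C, hC, hbd, hlip⟩ := exists_lipschitz_of_weak hcd (hm 0 (by omega)) (hm 1 (by omega))
      (hB 0 (by omega)) (hB 1 (by omega)) (hE 0 (by omega))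
    obtain ⟨g, h1, h2, h3, h4⟩ := ih (E := fun i => E (i + 1)) (fun i hi => hm (i + 1) (by omega))
      (fun i hi => hB (i + 1) (by omega)) (fun i hi => hE (i + 1) (by omega))
    -- The sequence already found for E 1, E 2, … is preceded by the absolutely continuous
    -- representative of E 0, which becomes differentiable since E 1 agrees almost everywhere with a
    -- continuous function.
    refine ⟨fun i => i.casesOn (fun x => C + ∫ y in c..x, E 1 y) g, hC, ?_, ?_, ?_⟩
    · rintro (_ | i) hi
      · exact hbd
      · exact h2 i (by omega)
    · rintro (_ | i) hi
      · exact hlip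
      · exact h3 i (by omega)
    · rintro (_ | i) hi x hx
      · have hc0 : ContinuousOn (g 0) (Set.Icc c d) := continuousOn_of_lipschitz (h3 0 (by omega))
        have heq : ∀ z ∈ Set.Icc c d, C + ∫ y in c..z, E 1 y = C + ∫ y in c..z, g 0 y := by
          intro z hz
          congr 1
          refine intervalIntegral.integral_congr_ae ?_
          rw [ae_restrict_iff' measurableSet_Ioo] at h1
          have hd : ∀ᵐ z : ℝ, z ≠ d := by simp [ae_iff]
          filter_upwards [h1, hd] with y hy hyd hyI
          rw [Set.uIoc_of_le hz.1] at hyI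
          exact hy ⟨hyI.1, lt_of_le_of_ne (hyI.2.trans hz.2) hyd⟩
        exact ((hasDerivWithinAt_integral_Icc hcd.le hc0 hx).const_add C).congr heq (heq x hx)
      · exact h4 i (by omega) x hx

/-! ## Functions with finite Sobolev norm -/

/-- Testing with φ' shows that D (i+1) is the weak first derivative of D i, so the D i have
classical representatives. As f is continuous it coincides everywhere with the representative of D
0, and its iterated derivatives with the others. -/
theorem IsWeakDerivFamily.classical {m : ℕ} {f : ℝ → ℝ} {D : ℕ → ℝ → ℝ} {B : ℝ}
    (hf : ContinuousOn f (Set.Icc 0 (2 * Real.pi))) (hD : IsWeakDerivFamily (m + 1) f D)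
    (hB : ∀ i ≤ m + 1, ∀ᵐ x ∂volume.restrict (Set.Ioo 0 (2 * Real.pi)), |D i x| ≤ B) :
    (∀ i ≤ m, ∀ x ∈ Set.Icc 0 (2 * Real.pi),
      |iteratedDerivWithin i f (Set.Icc 0 (2 * Real.pi)) x| ≤ B) ∧
    (∀ i ≤ m, ∀ x ∈ Set.Icc 0 (2 * Real.pi), ∀ y ∈ Set.Icc 0 (2 * Real.pi),
      |iteratedDerivWithin i f (Set.Icc 0 (2 * Real.pi)) x -
        iteratedDerivWithin i f (Set.Icc 0 (2 * Real.pi)) y| ≤ B * |x - y|) ∧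
    ∀ i < m, ∀ x ∈ Set.Icc 0 (2 * Real.pi),
      HasDerivWithinAt (iteratedDerivWithin i f (Set.Icc 0 (2 * Real.pi)))
        (iteratedDerivWithin (i + 1) f (Set.Icc 0 (2 * Real.pi)) x) (Set.Icc 0 (2 * Real.pi)) x := by
  have hpi : (0 : ℝ) < 2 * Real.pi := by positivity
  have hweak : ∀ i ≤ m, ∀ φ : ℝ → ℝ, ContDiff ℝ ∞ φ → HasCompactSupport φ →
      tsupport φ ⊆ Set.Ioo 0 (2 * Real.pi) →
      ∫ x in Set.Ioo 0 (2 * Real.pi), D i x * deriv φ x =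
        -∫ x in Set.Ioo 0 (2 * Real.pi), D (i + 1) x * φ x := by
    intro i hi φ hφ hφc hφs
    have h1 := (hD i (by omega)).2 (deriv φ) (contDiff_infty_iff_deriv.mp hφ).2 hφc.deriv
      ((tsupport_deriv_subset).trans hφs)
    have h2 := (hD (i + 1) (by omega)).2 φ hφ hφc hφs
    rw [iteratedDeriv_succ'] at h2
    rw [h1, pow_succ] at h2
    have h3 : ((-1 : ℝ) ^ i) * (-1) ^ i = 1 := by rw [← mul_pow]; norm_num
    linear_combination ((-1 : ℝ) ^ i) * h2 + (-(∫ x in Set.Ioo 0 (2 * Real.pi), D i x * deriv φ x) -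
      ∫ x in Set.Ioo 0 (2 * Real.pi), D (i + 1) x * φ x) * h3
  obtain ⟨g, h1, h2, h3, h4⟩ := exists_classical_of_weak hpi m
    (fun i hi => (hD i hi).1.aestronglyMeasurable) hB hweak
  have hD0 : ∀ᵐ x ∂volume.restrict (Set.Ioo 0 (2 * Real.pi)), f x - D 0 x = 0 := by
    have hi0 : IntegrableOn (D 0) (Set.Ioo 0 (2 * Real.pi)) :=
      Integrable.of_bound (hD 0 (by omega)).1.aestronglyMeasurable B (hB 0 (by omega))
    have hfi : IntegrableOn f (Set.Ioo 0 (2 * Real.pi)) :=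
      hf.integrableOn_Icc.mono_set Set.Ioo_subset_Icc_self
    rw [ae_restrict_iff' measurableSet_Ioo]
    refine isOpen_Ioo.ae_eq_zero_of_integral_contDiff_smul_eq_zero
      (hfi.sub hi0).locallyIntegrableOn fun φ hφ hφc hφs => ?_
    have h5 := (hD 0 (by omega)).2 φ hφ hφc hφs
    simp only [iteratedDeriv_zero, pow_zero, one_mul] at h5
    rw [← setIntegral_eq_integral_of_forall_compl_eq_zero (s := Set.Ioo 0 (2 * Real.pi))]
    · have hmul : ∀ F : ℝ → ℝ, IntegrableOn F (Set.Ioo 0 (2 * Real.pi)) →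
          IntegrableOn (fun x => F x * φ x) (Set.Ioo 0 (2 * Real.pi)) := fun F hF => by
        obtain ⟨C, hC⟩ := hφc.exists_bound_of_continuous hφ.continuous
        exact Integrable.mul_bdd hF hφ.continuous.aestronglyMeasurable
          (Filter.Eventually.of_forall hC)
      rw [← sub_eq_zero, ← integral_sub (hmul f hfi) (hmul _ hi0)] at h5
      refine Eq.trans ?_ h5
      congr 1; ext x; rw [smul_eq_mul, mul_comm, ← sub_mul]
    · intro x hx
      rw [image_eq_zero_of_notMem_tsupport fun h => hx (hφs h), zero_smul]
  have hg0 : Set.EqOn f (g 0) (Set.Icc 0 (2 * Real.pi)) := eqOn_Icc_of_ae_eq_Ioo hpi (by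
    filter_upwards [h1, hD0] with x hx hx'
    rw [← hx]; linarith) hf (continuousOn_of_lipschitz (h3 0 (by omega)))
  have hgi : ∀ i ≤ m, Set.EqOn (iteratedDerivWithin i f (Set.Icc 0 (2 * Real.pi))) (g i)
      (Set.Icc 0 (2 * Real.pi)) := by
    intro i
    induction i with
    | zero => intro _ x hx; simpa using hg0 hx
    | succ i ih =>
      intro hi x hx
      rw [iteratedDerivWithin_succ]
      have h5 := (h4 i (by omega) x hx).congr (ih (by omega)) (ih (by omega) hx)
      exact h5.derivWithin (uniqueDiffOn_Icc hpi x hx)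
  refine ⟨fun i hi x hx => ?_, fun i hi x hx y hy => ?_, fun i hi x hx => ?_⟩
  · rw [hgi i hi hx]; exact h2 i hi x hx
  · rw [hgi i hi hx, hgi i hi hy]; exact h3 i hi x hx y hy
  · rw [hgi (i + 1) hi hx]
    exact (h4 i hi x hx).congr (hgi i hi.le) (hgi i hi.le hx)

theorem classical_of_sobolevNorm {m : ℕ} {f : ℝ → ℝ} {U : ℝ} (hU : 0 ≤ U)
    (hf : ContinuousOn f (Set.Icc 0 (2 * Real.pi)))
    (h : sobolevNorm (m + 1) f ≤ ENNReal.ofReal U) :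
    (∀ i ≤ m, ∀ x ∈ Set.Icc 0 (2 * Real.pi),
      |iteratedDerivWithin i f (Set.Icc 0 (2 * Real.pi)) x| ≤ U) ∧
    (∀ i ≤ m, ∀ x ∈ Set.Icc 0 (2 * Real.pi), ∀ y ∈ Set.Icc 0 (2 * Real.pi),
      |iteratedDerivWithin i f (Set.Icc 0 (2 * Real.pi)) x -
        iteratedDerivWithin i f (Set.Icc 0 (2 * Real.pi)) y| ≤ U * |x - y|) ∧
    ∀ i < m, ∀ x ∈ Set.Icc 0 (2 * Real.pi),
      HasDerivWithinAt (iteratedDerivWithin i f (Set.Icc 0 (2 * Real.pi)))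
        (iteratedDerivWithin (i + 1) f (Set.Icc 0 (2 * Real.pi)) x) (Set.Icc 0 (2 * Real.pi)) x := by
  -- The infimum defining `sobolevNorm` need not be attained: families bounded by an arbitrary V > U
  -- are used, and V is let tend to U in each bound.
  have key : ∀ V : ℝ, U < V → ∃ D, IsWeakDerivFamily (m + 1) f D ∧
      ∀ i ≤ m + 1, ∀ᵐ x ∂volume.restrict (Set.Ioo 0 (2 * Real.pi)), |D i x| ≤ V := by
    intro V hV
    have hlt : sobolevNorm (m + 1) f < ENNReal.ofReal V :=
      h.trans_lt ((ENNReal.ofReal_lt_ofReal_iff (hU.trans_lt hV)).mpr hV)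
    rw [sobolevNorm] at hlt
    simp only [iInf_lt_iff] at hlt
    obtain ⟨D, hD, hlt⟩ := hlt
    refine ⟨D, hD, fun i hi => ?_⟩
    have h1 : eLpNorm (D i) ⊤ (volume.restrict (Set.Ioo 0 (2 * Real.pi))) ≤ ENNReal.ofReal V :=
      (le_iSup₂ (f := fun i (_ : i ∈ Finset.range (m + 1 + 1)) =>
        eLpNorm (D i) ⊤ (volume.restrict (Set.Ioo 0 (2 * Real.pi)))) i
        (Finset.mem_range.mpr (Nat.lt_succ_of_le hi))).trans hlt.le
    rw [eLpNorm_exponent_top] at h1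
    filter_upwards [enorm_ae_le_eLpNormEssSup (D i) (volume.restrict (Set.Ioo 0 (2 * Real.pi)))]
      with x hx
    have h2 := hx.trans h1
    rw [← ofReal_norm, ENNReal.ofReal_le_ofReal_iff (hU.trans hV.le)] at h2
    exact h2
  refine ⟨fun i hi x hx => ?_, fun i hi x hx y hy => ?_, ?_⟩
  · refine le_of_forall_gt_imp_ge_of_dense fun V hV => ?_
    obtain ⟨D, hD, hB⟩ := key V hV
    exact (hD.classical hf hB).1 i hi x hx
  · rcases eq_or_ne x y with rfl | hxy
    · simp
    have hpos : 0 < |x - y| := abs_pos.mpr (sub_ne_zero.mpr hxy)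
    rw [← div_le_iff₀ hpos]
    refine le_of_forall_gt_imp_ge_of_dense fun V hV => ?_
    obtain ⟨D, hD, hB⟩ := key V hV
    rw [div_le_iff₀ hpos]
    exact (hD.classical hf hB).2.1 i hi x hx y hy
  · obtain ⟨D, hD, hB⟩ := key (U + 1) (by linarith)
    exact (hD.classical hf hB).2.2

end LDG
end

noncomputable section

namespace LDG

/-! ## Calculus on rectangles -/

variable {c d s₀ s₁ : ℝ}

theorem abs_sub_sub_mul_le {f f' : ℝ → ℝ} {U : ℝ} (hU : 0 ≤ U)
    (hf : ∀ x ∈ Set.Icc c d, HasDerivWithinAt f (f' x) (Set.Icc c d) x)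
    (hL : ∀ x ∈ Set.Icc c d, ∀ y ∈ Set.Icc c d, |f' x - f' y| ≤ U * |x - y|)
    {x y : ℝ} (hx : x ∈ Set.Icc c d) (hy : y ∈ Set.Icc c d) :
    |f y - f x - (y - x) * f' x| ≤ U * |y - x| ^ 2 := by
  have hsub : Set.uIcc x y ⊆ Set.Icc c d := fun z hz => by
    rcases Set.mem_uIcc.mp hz with h | h
    · exact ⟨hx.1.trans h.1, h.2.trans hy.2⟩
    · exact ⟨hy.1.trans h.1, h.2.trans hx.2⟩
  have h := (convex_uIcc x y).norm_image_sub_le_of_norm_hasDerivWithin_le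
    (f := fun z => f z - z * f' x) (f' := fun z => f' z - f' x) (C := U * |y - x|)
    (fun z hz => by
      have h1 := ((hf z (hsub hz)).mono hsub).sub
        (((hasDerivAt_id z).mul_const (f' x)).hasDerivWithinAt (s := Set.uIcc x y))
      rw [one_mul] at h1
      exact h1)
    (fun z hz => by
      refine (hL z (hsub hz) x hx).trans (mul_le_mul_of_nonneg_left ?_ hU)
      exact Set.abs_sub_left_of_mem_uIcc hz)
    Set.left_mem_uIcc Set.right_mem_uIcc
  rw [Real.norm_eq_abs, Real.norm_eq_abs] at h
  calc |f y - f x - (y - x) * f' x| = |f y - y * f' x - (f x - x * f' x)| := by ring_nf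
    _ ≤ U * |y - x| * |y - x| := h
    _ = _ := by ring

theorem hasDerivWithinAt_of_abs_le_sq {f : ℝ → ℝ} {s : Set ℝ} {x f' U : ℝ}
    (h : ∀ y ∈ s, |f y - f x - (y - x) * f'| ≤ U * |y - x| ^ 2) : HasDerivWithinAt f f' s x := by
  rw [hasDerivWithinAt_iff_isLittleO]
  have h1 : (fun y => f y - f x - (y - x) • f') =O[nhdsWithin x s] fun y => (y - x) ^ 2 := by
    refine Asymptotics.IsBigO.of_bound U ?_
    filter_upwards [self_mem_nhdsWithin] with y hy
    simpa using h y hy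
  refine h1.trans_isLittleO ?_
  have h2 : (fun y : ℝ => (y - x) ^ 2) =o[nhds x] fun y => y - x := by
    have := (Asymptotics.isLittleO_pow_id (𝕜 := ℝ) (n := 2) (by norm_num)).comp_tendsto
      (show Filter.Tendsto (fun y : ℝ => y - x) (nhds x) (nhds 0) by
        have : Filter.Tendsto (fun y : ℝ => y - x) (nhds x) (nhds (x - x)) :=
          (continuous_id.sub continuous_const).tendsto x
        rwa [sub_self] at this)
    exact this
  exact h2.mono nhdsWithin_le_nhds

/-- Differentiation under an integral over time. -/
theorem hasDerivWithinAt_integral_param {s t : ℝ} (hst : s ≤ t) {f g : ℝ → ℝ → ℝ} {U : ℝ}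
    (hfc : ∀ x ∈ Set.Icc c d, ContinuousOn (f x) (Set.Icc s t))
    (hgc : ∀ x ∈ Set.Icc c d, ContinuousOn (g x) (Set.Icc s t))
    (h : ∀ r ∈ Set.Icc s t, ∀ x ∈ Set.Icc c d, ∀ y ∈ Set.Icc c d,
      |f y r - f x r - (y - x) * g x r| ≤ U * |y - x| ^ 2)
    {x : ℝ} (hx : x ∈ Set.Icc c d) :
    HasDerivWithinAt (fun x => ∫ r in s..t, f x r) (∫ r in s..t, g x r) (Set.Icc c d) x := by
  have hint : ∀ F : ℝ → ℝ, ContinuousOn F (Set.Icc s t) → IntervalIntegrable F volume s t :=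
    fun F hF => ContinuousOn.intervalIntegrable (by rwa [Set.uIcc_of_le hst])
  refine hasDerivWithinAt_of_abs_le_sq (U := U * (t - s)) fun y hy => ?_
  rw [← intervalIntegral.integral_const_mul, ← intervalIntegral.integral_sub
    (hint _ (hfc y hy)) (hint _ (hfc x hx)), ← intervalIntegral.integral_sub
    ((hint _ (hfc y hy)).sub (hint _ (hfc x hx))) ((hint _ (hgc x hx)).const_mul _)]
  have h1 := intervalIntegral.norm_integral_le_of_norm_le_const (a := s) (b := t)
    (f := fun r => f y r - f x r - (y - x) * g x r) (C := U * |y - x| ^ 2) (fun r hr => by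
      rw [Set.uIoc_of_le hst] at hr
      exact h r (Set.Ioc_subset_Icc_self hr) x hx y hy)
  rw [Real.norm_eq_abs, abs_of_nonneg (sub_nonneg.mpr hst)] at h1
  exact h1.trans (by rw [mul_right_comm])

theorem continuousOn_prod_of_lipschitz {f : ℝ → ℝ → ℝ} {I J : Set ℝ} {U : ℝ}
    (hL : ∀ s ∈ J, ∀ x ∈ I, ∀ y ∈ I, |f x s - f y s| ≤ U * |x - y|)
    (hc : ∀ x ∈ I, ContinuousOn (f x) J) : ContinuousOn (fun p : ℝ × ℝ => f p.1 p.2) (I ×ˢ J) := by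
  rintro ⟨x, s⟩ ⟨hx, hs⟩
  simp only at hx hs
  have h1 : Filter.Tendsto (fun p : ℝ × ℝ => U * |p.1 - x| + |f x p.2 - f x s|)
      (nhdsWithin (x, s) (I ×ˢ J)) (nhds 0) := by
    have e1 : Filter.Tendsto (fun p : ℝ × ℝ => U * |p.1 - x|) (nhdsWithin (x, s) (I ×ˢ J))
        (nhds (U * |x - x|)) :=
      ((by fun_prop : Continuous fun p : ℝ × ℝ => U * |p.1 - x|).tendsto (x, s)).mono_left
        nhdsWithin_le_nhds
    have e2 : Filter.Tendsto (fun p : ℝ × ℝ => f x p.2) (nhdsWithin (x, s) (I ×ˢ J))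
        (nhds (f x s)) :=
      (hc x hx s hs).tendsto.comp (tendsto_nhdsWithin_iff.mpr
        ⟨(continuous_snd.tendsto (x, s)).mono_left nhdsWithin_le_nhds, by
          filter_upwards [self_mem_nhdsWithin] with p hp using hp.2⟩)
    have e3 := e1.add ((e2.sub_const (f x s)).abs)
    simpa using e3
  rw [ContinuousWithinAt, tendsto_iff_dist_tendsto_zero]
  refine squeeze_zero' (Filter.Eventually.of_forall fun _ => dist_nonneg) ?_ h1
  filter_upwards [self_mem_nhdsWithin] with p hp
  rw [Real.dist_eq]
  calc |f p.1 p.2 - f x s| ≤ |f p.1 p.2 - f x p.2| + |f x p.2 - f x s| := abs_sub_le _ _ _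
    _ ≤ _ := by gcongr; exact hL p.2 hp.2 p.1 hp.1 x hx

/-- A continuous function on a rectangle is the restriction of a continuous function. -/
theorem exists_continuous_extension (hcd : c ≤ d) (hs : s₀ ≤ s₁) {f : ℝ → ℝ → ℝ}
    (hf : ContinuousOn (fun p : ℝ × ℝ => f p.1 p.2) (Set.Icc c d ×ˢ Set.Icc s₀ s₁)) :
    ∃ F : ℝ → ℝ → ℝ, Continuous (fun p : ℝ × ℝ => F p.1 p.2) ∧
      ∀ x ∈ Set.Icc c d, ∀ s ∈ Set.Icc s₀ s₁, F x s = f x s := by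
  refine ⟨fun x s => f (Set.projIcc c d hcd x) (Set.projIcc s₀ s₁ hs s), ?_, fun x hx s hs' => ?_⟩
  · refine hf.comp_continuous (f := fun p : ℝ × ℝ =>
      ((Set.projIcc c d hcd p.1 : ℝ), (Set.projIcc s₀ s₁ hs p.2 : ℝ))) ?_ fun p => ?_
    · exact (continuous_subtype_val.comp (continuous_projIcc.comp continuous_fst)).prodMk
        (continuous_subtype_val.comp (continuous_projIcc.comp continuous_snd))
    · exact ⟨(Set.projIcc c d hcd p.1).2, (Set.projIcc s₀ s₁ hs p.2).2⟩
  · beta_reduce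
    rw [Set.projIcc_of_mem hcd hx, Set.projIcc_of_mem hs hs']

theorem intervalIntegral_swap_of_continuous {F : ℝ → ℝ → ℝ}
    (hF : Continuous fun p : ℝ × ℝ => F p.1 p.2) (a b s t : ℝ) :
    ∫ x in a..b, ∫ r in s..t, F x r = ∫ r in s..t, ∫ x in a..b, F x r :=
  intervalIntegral_intervalIntegral_swap
    ((hF.continuousOn.integrableOn_compact (isCompact_uIcc.prod isCompact_uIcc)).mono_set
      (Set.prod_mono Set.uIoc_subset_uIcc Set.uIoc_subset_uIcc))

theorem integral_eq_sub_of_hasDerivWithinAt_Icc {f g : ℝ → ℝ} {s t : ℝ} (hst : s ≤ t)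
    (hg : ContinuousOn g (Set.Icc s t))
    (h : ∀ r ∈ Set.Icc s t, HasDerivWithinAt f (g r) (Set.Icc s t) r) :
    ∫ r in s..t, g r = f t - f s :=
  intervalIntegral.integral_eq_sub_of_hasDerivAt_of_le hst
    (fun r hr => (h r hr).continuousWithinAt)
    (fun r hr => (h r (Set.Ioo_subset_Icc_self hr)).hasDerivAt (Icc_mem_nhds hr.1 hr.2))
    (ContinuousOn.intervalIntegrable (by rwa [Set.uIcc_of_le hst]))

/-- Differentiation with respect to time of an integral over space. -/
theorem hasDerivWithinAt_integral_space (hcd : c ≤ d) {f g : ℝ → ℝ → ℝ}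
    (hf : ∀ s ∈ Set.Icc s₀ s₁, ContinuousOn (fun x => f x s) (Set.Icc c d))
    (hg : ContinuousOn (fun p : ℝ × ℝ => g p.1 p.2) (Set.Icc c d ×ˢ Set.Icc s₀ s₁))
    (h : ∀ x ∈ Set.Icc c d, ∀ s ∈ Set.Icc s₀ s₁,
      HasDerivWithinAt (f x) (g x s) (Set.Icc s₀ s₁) s)
    {s : ℝ} (hs : s ∈ Set.Icc s₀ s₁) :
    HasDerivWithinAt (fun s => ∫ x in c..d, f x s) (∫ x in c..d, g x s) (Set.Icc s₀ s₁) s := by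
  have h01 : s₀ ≤ s₁ := hs.1.trans hs.2
  obtain ⟨G, hG, hGg⟩ := exists_continuous_extension hcd h01 hg
  have hGx : ∀ x, Continuous (G x) := fun x =>
    hG.comp (continuous_const.prodMk continuous_id)
  have hGt : Continuous fun r => ∫ x in c..d, G x r :=
    intervalIntegral.continuous_parametric_intervalIntegral_of_continuous' (μ := volume)
      (f := fun r x => G x r) (hG.comp continuous_swap) c d
  -- Fubini turns the integral over space into a time integral of a continuous function, for which
  -- the fundamental theorem of calculus applies.
  have hmain : ∀ τ ∈ Set.Icc s₀ s₁, ∫ x in c..d, f x τ =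
      (∫ x in c..d, f x s₀) + ∫ r in s₀..τ, ∫ x in c..d, G x r := by
    intro τ hτ
    rw [← intervalIntegral_swap_of_continuous hG, ← sub_eq_iff_eq_add',
      ← intervalIntegral.integral_sub (ContinuousOn.intervalIntegrable (by
        rw [Set.uIcc_of_le hcd]; exact hf τ hτ)) (ContinuousOn.intervalIntegrable (by
        rw [Set.uIcc_of_le hcd]; exact hf s₀ ⟨le_rfl, h01⟩))]
    refine intervalIntegral.integral_congr fun x hx => ?_
    rw [Set.uIcc_of_le hcd] at hx
    have hsub : Set.Icc s₀ τ ⊆ Set.Icc s₀ s₁ := Set.Icc_subset_Icc_right hτ.2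
    exact (integral_eq_sub_of_hasDerivWithinAt_Icc hτ.1 (hGx x).continuousOn fun r hr => by
      rw [hGg x hx r (hsub hr)]
      exact (h x hx r (hsub hr)).mono hsub).symm
  have h1 := ((intervalIntegral.integral_hasDerivAt_right (hGt.intervalIntegrable s₀ s)
    hGt.stronglyMeasurable.stronglyMeasurableAtFilter hGt.continuousAt).const_add
    (∫ x in c..d, f x s₀)).hasDerivWithinAt (s := Set.Icc s₀ s₁)
  have h2 : ∫ x in c..d, G x s = ∫ x in c..d, g x s :=
    intervalIntegral.integral_congr fun x hx => by
      rw [Set.uIcc_of_le hcd] at hx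
      exact hGg x hx s hs
  rw [h2] at h1
  exact h1.congr hmain (hmain s hs)

/-! ## Regularity of solutions of the heat equation -/

/-- The spatial domain. -/
abbrev Dom : Set ℝ := Set.Icc 0 (2 * Real.pi)

theorem two_pi_pos' : (0 : ℝ) < 2 * Real.pi := by positivity

/-- `v i` is the `i`-th space derivative, `i ≤ p`, of a solution `v 0` of the heat equation on
`[0, 2π] × [s₀, s₁]`, bounded and Lipschitz in space with constant `U`. -/
structure HeatRegular (p : ℕ) (s₀ s₁ U : ℝ) (v : ℕ → ℝ → ℝ → ℝ) : Prop where
  bound : ∀ i ≤ p, ∀ s ∈ Set.Icc s₀ s₁, ∀ x ∈ Dom, |v i x s| ≤ U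
  lipschitz : ∀ i ≤ p, ∀ s ∈ Set.Icc s₀ s₁, ∀ x ∈ Dom, ∀ y ∈ Dom,
    |v i x s - v i y s| ≤ U * |x - y|
  deriv_space : ∀ i < p, ∀ s ∈ Set.Icc s₀ s₁, ∀ x ∈ Dom,
    HasDerivWithinAt (fun x => v i x s) (v (i + 1) x s) Dom x
  continuous_time : ∀ i ≤ p, ∀ x ∈ Dom, ContinuousOn (v i x) (Set.Icc s₀ s₁)
  deriv_time : ∀ i, i + 2 ≤ p → ∀ x ∈ Dom, ∀ s ∈ Set.Icc s₀ s₁,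
    HasDerivWithinAt (v i x) (v (i + 2) x s) (Set.Icc s₀ s₁) s

theorem HeatRegular.continuousOn {p : ℕ} {U : ℝ} {v : ℕ → ℝ → ℝ → ℝ}
    (h : HeatRegular p s₀ s₁ U v) {i : ℕ} (hi : i ≤ p) :
    ContinuousOn (fun q : ℝ × ℝ => v i q.1 q.2) (Dom ×ˢ Set.Icc s₀ s₁) :=
  continuousOn_prod_of_lipschitz (h.lipschitz i hi) (h.continuous_time i hi)

theorem HeatRegular.continuous_space {p : ℕ} {U : ℝ} {v : ℕ → ℝ → ℝ → ℝ}
    (h : HeatRegular p s₀ s₁ U v) {i : ℕ} (hi : i ≤ p) {s : ℝ} (hs : s ∈ Set.Icc s₀ s₁) :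
    ContinuousOn (fun x => v i x s) Dom :=
  continuousOn_of_lipschitz (h.lipschitz i hi s hs)

theorem HeatRegular.mono {p : ℕ} {U : ℝ} {v : ℕ → ℝ → ℝ → ℝ}
    (h : HeatRegular p s₀ s₁ U v) {t₀ t₁ : ℝ} (h₀ : s₀ ≤ t₀) (h₁ : t₁ ≤ s₁) :
    HeatRegular p t₀ t₁ U v where
  bound i hi s hs := h.bound i hi s ⟨h₀.trans hs.1, hs.2.trans h₁⟩
  lipschitz i hi s hs := h.lipschitz i hi s ⟨h₀.trans hs.1, hs.2.trans h₁⟩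
  deriv_space i hi s hs := h.deriv_space i hi s ⟨h₀.trans hs.1, hs.2.trans h₁⟩
  continuous_time i hi x hx := (h.continuous_time i hi x hx).mono (Set.Icc_subset_Icc h₀ h₁)
  deriv_time i hi x hx s hs := (h.deriv_time i hi x hx s
    ⟨h₀.trans hs.1, hs.2.trans h₁⟩).mono (Set.Icc_subset_Icc h₀ h₁)

/-- Difference quotients with step δ have to be taken inside the domain, to the left or to the right
of x; this is possible as long as δ is at most half its length. -/
theorem exists_mem_Dom_abs_sub {x δ : ℝ} (hx : x ∈ Dom) (hδ : 0 ≤ δ) (hδ' : δ ≤ Real.pi) :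
    ∃ y ∈ Dom, |y - x| = δ := by
  rcases le_total x Real.pi with h | h
  · exact ⟨x + δ, ⟨by linarith [hx.1], by linarith⟩, by simp [abs_of_nonneg hδ]⟩
  · exact ⟨x - δ, ⟨by linarith, by linarith [hx.2]⟩, by simp [abs_of_nonneg hδ]⟩

/-- If a function depends continuously on time, so does its derivative when it is uniformly
Lipschitz. -/
theorem continuousOn_time_of_lipschitz {f g : ℝ → ℝ → ℝ} {J : Set ℝ} {U : ℝ} (hU : 0 ≤ U)
    (hf : ∀ x ∈ Dom, ContinuousOn (f x) J)
    (hd : ∀ s ∈ J, ∀ x ∈ Dom, HasDerivWithinAt (fun x => f x s) (g x s) Dom x)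
    (hL : ∀ s ∈ J, ∀ x ∈ Dom, ∀ y ∈ Dom, |g x s - g y s| ≤ U * |x - y|) {x : ℝ} (hx : x ∈ Dom) :
    ContinuousOn (g x) J := by
  refine continuousOn_of_uniform_approx_of_continuousOn fun u hu => ?_
  obtain ⟨ε, hε, hεu⟩ := Metric.mem_uniformity_dist.mp hu
  set δ := min Real.pi (ε / (2 * (U + 1))) with hδ
  have hδ0 : 0 < δ := lt_min Real.pi_pos (by positivity)
  -- The difference quotient with this fixed step is continuous in time and differs from the
  -- derivative by at most Uδ < ε, uniformly in s.
  obtain ⟨y, hy, hyx⟩ := exists_mem_Dom_abs_sub hx hδ0.le (min_le_left _ _)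
  have hne : y - x ≠ 0 := fun h0 => by rw [h0, abs_zero] at hyx; exact hδ0.ne hyx
  refine ⟨fun s => (f y s - f x s) / (y - x), ((hf y hy).sub (hf x hx)).div_const _,
    fun s hs => hεu ?_⟩
  have h1 := abs_sub_sub_mul_le hU (hd s hs) (hL s hs) hx hy
  rw [Real.dist_eq]
  have h2 : g x s - (f y s - f x s) / (y - x) =
      -((f y s - f x s - (y - x) * g x s) / (y - x)) := by field_simp; ring
  rw [h2, abs_neg, abs_div, div_lt_iff₀ (abs_pos.mpr hne)]
  refine h1.trans_lt ?_
  rw [hyx, sq, ← mul_assoc]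
  refine mul_lt_mul_of_pos_right ?_ hδ0
  have h3 : δ ≤ ε / (2 * (U + 1)) := min_le_right _ _
  rw [le_div_iff₀ (by positivity)] at h3
  nlinarith

/-- The point is that the i-th space derivative v_i has time derivative v_{i+2}. It is proved in
integrated form, v_i(τ) - v_i(s) = ∫ v_{i+2}, by induction on i through differentiation in x. The
integrated form includes s = 0, where the heat equation itself is not assumed. -/
theorem IsHeatSolution.heatRegular {fl : Flux} {bc : Boundary} {p : ℕ} {T : ℝ} {u : ℝ → ℝ → ℝ}
    (hp : 2 ≤ p) (hu : IsHeatSolution fl bc (p + 1) T u) {t : ℝ} (ht : t ∈ Set.Icc 0 T) :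
    HeatRegular p 0 t (supSobolevNorm (p + 1) u t).toReal
      (fun i x s => iteratedDerivWithin i (fun y => u y s) Dom x) := by
  set v : ℕ → ℝ → ℝ → ℝ := fun i x s => iteratedDerivWithin i (fun y => u y s) Dom x with hv
  have hmono : supSobolevNorm (p + 1) u t ≤ supSobolevNorm (p + 1) u T :=
    biSup_mono fun s hs => ⟨hs.1, hs.2.trans ht.2⟩
  have hfin : ∀ τ ∈ Set.Icc 0 T, supSobolevNorm (p + 1) u τ ≠ ⊤ := fun τ hτ =>
    ne_top_of_le_ne_top hu.regular (biSup_mono fun s hs => ⟨hs.1, hs.2.trans hτ.2⟩)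
  -- τ = T serves the qualitative arguments on the whole time interval; τ = t gives the constants in
  -- the conclusion.
  have hcl : ∀ τ ∈ Set.Icc 0 T, ∀ s ∈ Set.Icc 0 τ, _ := fun τ hτ s hs =>
    classical_of_sobolevNorm (m := p) (U := (supSobolevNorm (p + 1) u τ).toReal)
      ENNReal.toReal_nonneg (hu.continuous_space s ⟨hs.1, hs.2.trans hτ.2⟩) (by
        rw [ENNReal.ofReal_toReal (hfin τ hτ)]
        exact le_iSup₂ (f := fun s (_ : s ∈ Set.Icc 0 τ) =>
          sobolevNorm (p + 1) (fun x => u x s)) s hs)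
  have hT0 : 0 ≤ T := ht.1.trans ht.2
  have hTT : T ∈ Set.Icc 0 T := ⟨hT0, le_rfl⟩
  set U := (supSobolevNorm (p + 1) u T).toReal with hUdef
  have hU : 0 ≤ U := ENNReal.toReal_nonneg
  have hlip : ∀ i ≤ p, ∀ s ∈ Set.Icc 0 T, ∀ x ∈ Dom, ∀ y ∈ Dom,
      |v i x s - v i y s| ≤ U * |x - y| := fun i hi s hs => (hcl T hTT s hs).2.1 i hi
  have hder : ∀ i < p, ∀ s ∈ Set.Icc 0 T, ∀ x ∈ Dom,
      HasDerivWithinAt (fun x => v i x s) (v (i + 1) x s) Dom x :=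
    fun i hi s hs => (hcl T hTT s hs).2.2 i hi
  have hct : ∀ i ≤ p, ∀ x ∈ Dom, ContinuousOn (v i x) (Set.Icc 0 T) := by
    intro i
    induction i with
    | zero =>
      intro _ x hx
      simpa [hv] using hu.continuous_time x hx
    | succ i ih =>
      intro hi x hx
      exact continuousOn_time_of_lipschitz hU (ih (by omega)) (hder i hi) (hlip (i + 1) hi) hx
  have hsubT : ∀ {s τ : ℝ}, 0 ≤ s → τ ≤ T → Set.Icc s τ ⊆ Set.Icc 0 T := fun h1 h2 =>
    Set.Icc_subset_Icc h1 h2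
  have hint : ∀ i, i + 2 ≤ p → ∀ s τ : ℝ, 0 ≤ s → s ≤ τ → τ ≤ T → ∀ x ∈ Dom,
      v i x τ - v i x s = ∫ r in s..τ, v (i + 2) x r := by
    intro i
    induction i with
    | zero =>
      intro hi s τ hs hsτ hτ x hx
      refine (intervalIntegral.integral_eq_sub_of_hasDerivAt_of_le hsτ
        ((hct 0 (by omega) x hx).mono (hsubT hs hτ)) (fun r hr => ?_)
        (ContinuousOn.intervalIntegrable (by
          rw [Set.uIcc_of_le hsτ]; exact (hct 2 hi x hx).mono (hsubT hs hτ)))).symm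
      have h1 := (hu.heat r ⟨hs.trans_lt hr.1, hr.2.le.trans hτ⟩ x hx).hasDerivAt
        (Icc_mem_nhds (hs.trans_lt hr.1) (hr.2.trans_le hτ))
      simpa [hv] using h1
    | succ i ih =>
      intro hi s τ hs hsτ hτ x hx
      have hsI : s ∈ Set.Icc 0 T := ⟨hs, hsτ.trans hτ⟩
      have hτI : τ ∈ Set.Icc 0 T := ⟨hs.trans hsτ, hτ⟩
      -- Both sides of the identity for i are differentiated in x. Under the integral this is
      -- allowed because the Taylor remainders are bounded uniformly in r.
      have h1 : HasDerivWithinAt (fun x => ∫ r in s..τ, v (i + 2) x r)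
          (∫ r in s..τ, v (i + 1 + 2) x r) Dom x :=
        hasDerivWithinAt_integral_param hsτ (U := U)
          (fun y hy => (hct (i + 2) (by omega) y hy).mono (hsubT hs hτ))
          (fun y hy => (hct (i + 3) (by omega) y hy).mono (hsubT hs hτ))
          (fun r hr y hy z hz => abs_sub_sub_mul_le hU (hder (i + 2) (by omega) r (hsubT hs hτ hr))
            (hlip (i + 3) (by omega) r (hsubT hs hτ hr)) hy hz) hx
      have h2 := (hder i (by omega) τ hτI x hx).sub (hder i (by omega) s hsI x hx)
      have h3 := h2.congr (f₁ := fun x => ∫ r in s..τ, v (i + 2) x r)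
        (fun y hy => (ih (by omega) s τ hs hsτ hτ y hy).symm)
        (ih (by omega) s τ hs hsτ hτ x hx).symm
      exact (uniqueDiffOn_Icc two_pi_pos' x hx).eq_deriv _ h3 h1
  refine ⟨fun i hi s hs => (hcl t ht s hs).1 i hi, fun i hi s hs => (hcl t ht s hs).2.1 i hi,
    fun i hi s hs => (hcl t ht s hs).2.2 i hi,
    fun i hi x hx => (hct i hi x hx).mono (hsubT le_rfl ht.2), fun i hi x hx s hs => ?_⟩
  have h1 := ((hasDerivWithinAt_integral_Icc ht.1 ((hct (i + 2) hi x hx).mono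
    (hsubT le_rfl ht.2)) hs).const_add (v i x 0))
  have h2 : ∀ τ ∈ Set.Icc 0 t, v i x τ = v i x 0 + ∫ r in (0 : ℝ)..τ, v (i + 2) x r :=
    fun τ hτ => by rw [← hint i hi 0 τ le_rfl hτ.1 (hτ.2.trans ht.2) x hx]; ring
  exact h1.congr h2 (h2 s hs)

end LDG
end

noncomputable section

namespace LDG

/-! ## Backward time averages of solutions of the heat equation -/

variable {s₀ s₁ U : ℝ}

/-- Backward difference quotient in time. -/
def timeDiff (ε : ℝ) (f : ℝ → ℝ → ℝ) (x s : ℝ) : ℝ := (f x s - f x (s - ε)) / ε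

/-- Backward average in time. -/
def timeAvg (ε : ℝ) (f : ℝ → ℝ → ℝ) (x s : ℝ) : ℝ := (∫ r in (s - ε)..s, f x r) / ε

/-- The space derivatives of orders `0, …, 4` of the backward time average of `v 0`. -/
def steklov (ε : ℝ) (v : ℕ → ℝ → ℝ → ℝ) : ℕ → ℝ → ℝ → ℝ
  | 0 => timeAvg ε (v 0)
  | 1 => timeAvg ε (v 1)
  | i + 2 => timeDiff ε (v i)

theorem HeatRegular.shift {p : ℕ} {v : ℕ → ℝ → ℝ → ℝ} (k : ℕ)
    (h : HeatRegular (p + k) s₀ s₁ U v) : HeatRegular p s₀ s₁ U (fun i => v (i + k)) where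
  bound i hi := h.bound (i + k) (by omega)
  lipschitz i hi := h.lipschitz (i + k) (by omega)
  deriv_space i hi s hs x hx := by
    have := h.deriv_space (i + k) (by omega) s hs x hx
    rwa [add_right_comm] at this
  continuous_time i hi := h.continuous_time (i + k) (by omega)
  deriv_time i hi x hx s hs := by
    have := h.deriv_time (i + k) (by omega) x hx s hs
    rwa [add_right_comm] at this

theorem hasDerivWithinAt_comp_sub {f : ℝ → ℝ} {f' ε s : ℝ} (hε : 0 ≤ ε)
    (h : HasDerivWithinAt f f' (Set.Icc s₀ s₁) (s - ε)) :
    HasDerivWithinAt (fun s => f (s - ε)) f' (Set.Icc (s₀ + ε) s₁) s := by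
  have h1 : HasDerivWithinAt (fun s : ℝ => s - ε) 1 (Set.Icc (s₀ + ε) s₁) s :=
    ((hasDerivAt_id s).sub_const ε).hasDerivWithinAt
  have h2 := HasDerivWithinAt.comp s (h₂ := f) (h := fun s => s - ε) h h1 fun r hr =>
    ⟨by linarith [hr.1], by linarith [hr.2]⟩
  rw [mul_one] at h2
  exact h2

/-- A time average gains two space derivatives, since by the heat equation the average of v 2 is the
difference quotient of v 0. The constant 2U/ε blows up, but it is needed only to justify
manipulations and enters no final estimate. -/
theorem HeatRegular.steklov {v : ℕ → ℝ → ℝ → ℝ} (h : HeatRegular 2 s₀ s₁ U v) (hU : 0 ≤ U)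
    {ε : ℝ} (hε : 0 < ε) (hε1 : ε ≤ 1) :
    HeatRegular 4 (s₀ + ε) s₁ (2 * U / ε) (steklov ε v) := by
  have hmem : ∀ s ∈ Set.Icc (s₀ + ε) s₁, s ∈ Set.Icc s₀ s₁ ∧ s - ε ∈ Set.Icc s₀ s₁ := fun s hs =>
    ⟨⟨by linarith [hs.1], hs.2⟩, ⟨by linarith [hs.1], by linarith [hs.2]⟩⟩
  have hsub : ∀ s ∈ Set.Icc (s₀ + ε) s₁, Set.Icc (s - ε) s ⊆ Set.Icc s₀ s₁ := fun s hs =>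
    Set.Icc_subset_Icc (hmem s hs).2.1 (hmem s hs).1.2
  have hUε : U ≤ 2 * U / ε := by rw [le_div_iff₀ hε]; nlinarith
  have hint : ∀ i ≤ 2, ∀ x ∈ Dom, ∀ s ∈ Set.Icc (s₀ + ε) s₁,
      IntervalIntegrable (v i x) volume (s - ε) s := fun i hi x hx s hs =>
    ContinuousOn.intervalIntegrable (by
      rw [Set.uIcc_of_le (by linarith)]
      exact (h.continuous_time i hi x hx).mono (hsub s hs))
  have avg_le : ∀ (f : ℝ → ℝ) (s B : ℝ), (∀ r ∈ Set.Icc (s - ε) s, |f r| ≤ B) →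
      |(∫ r in (s - ε)..s, f r) / ε| ≤ B := fun f s B hB => by
    have h1 := intervalIntegral.norm_integral_le_of_norm_le_const (a := s - ε) (b := s) (f := f)
      (C := B) (fun r hr => by
        rw [Set.uIoc_of_le (by linarith)] at hr
        exact hB r (Set.Ioc_subset_Icc_self hr))
    rw [Real.norm_eq_abs, sub_sub_cancel, abs_of_pos hε] at h1
    rw [abs_div, abs_of_pos hε, div_le_iff₀ hε]
    exact h1
  have havg_bound : ∀ i ≤ 2, ∀ s ∈ Set.Icc (s₀ + ε) s₁, ∀ x ∈ Dom, |timeAvg ε (v i) x s| ≤ U :=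
    fun i hi s hs x hx => avg_le _ _ _ fun r hr => h.bound i hi r (hsub s hs hr) x hx
  have havg_lip : ∀ i ≤ 2, ∀ s ∈ Set.Icc (s₀ + ε) s₁, ∀ x ∈ Dom, ∀ y ∈ Dom,
      |timeAvg ε (v i) x s - timeAvg ε (v i) y s| ≤ U * |x - y| := fun i hi s hs x hx y hy => by
    rw [timeAvg, timeAvg, ← sub_div, ← intervalIntegral.integral_sub (hint i hi x hx s hs)
      (hint i hi y hy s hs)]
    exact avg_le _ _ _ fun r hr => h.lipschitz i hi r (hsub s hs hr) x hx y hy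
  have hdiff_bound : ∀ i ≤ 2, ∀ s ∈ Set.Icc (s₀ + ε) s₁, ∀ x ∈ Dom,
      |timeDiff ε (v i) x s| ≤ 2 * U / ε := fun i hi s hs x hx => by
    rw [timeDiff, abs_div, abs_of_pos hε]
    have h1 := h.bound i hi s (hmem s hs).1 x hx
    have h2 := h.bound i hi _ (hmem s hs).2 x hx
    have h3 := abs_sub (v i x s) (v i x (s - ε))
    gcongr
    linarith
  have hdiff_lip : ∀ i ≤ 2, ∀ s ∈ Set.Icc (s₀ + ε) s₁, ∀ x ∈ Dom, ∀ y ∈ Dom,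
      |timeDiff ε (v i) x s - timeDiff ε (v i) y s| ≤ 2 * U / ε * |x - y| :=
    fun i hi s hs x hx y hy => by
      have h1 := h.lipschitz i hi s (hmem s hs).1 x hx y hy
      have h2 := h.lipschitz i hi _ (hmem s hs).2 x hx y hy
      have h3 := abs_sub (v i x s - v i y s) (v i x (s - ε) - v i y (s - ε))
      have h4 : timeDiff ε (v i) x s - timeDiff ε (v i) y s =
          (v i x s - v i y s - (v i x (s - ε) - v i y (s - ε))) / ε := by
        simp only [timeDiff]; ring
      rw [h4, abs_div, abs_of_pos hε, div_mul_eq_mul_div]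
      gcongr
      linarith
  have hdiff_space : ∀ i < 2, ∀ s ∈ Set.Icc (s₀ + ε) s₁, ∀ x ∈ Dom,
      HasDerivWithinAt (fun x => timeDiff ε (v i) x s) (timeDiff ε (v (i + 1)) x s) Dom x :=
    fun i hi s hs x hx => ((h.deriv_space i hi s (hmem s hs).1 x hx).sub
      (h.deriv_space i hi _ (hmem s hs).2 x hx)).div_const ε
  have havg_space : ∀ i < 2, ∀ s ∈ Set.Icc (s₀ + ε) s₁, ∀ x ∈ Dom,
      HasDerivWithinAt (fun x => timeAvg ε (v i) x s) (timeAvg ε (v (i + 1)) x s) Dom x :=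
    fun i hi s hs x hx => (hasDerivWithinAt_integral_param (by linarith) (U := U)
      (fun y hy => (h.continuous_time i hi.le y hy).mono (hsub s hs))
      (fun y hy => (h.continuous_time (i + 1) hi y hy).mono (hsub s hs))
      (fun r hr y hy z hz => abs_sub_sub_mul_le hU (h.deriv_space i hi r (hsub s hs hr))
        (h.lipschitz (i + 1) hi r (hsub s hs hr)) hy hz) hx).div_const ε
  have havg_time : ∀ i ≤ 2, ∀ x ∈ Dom, ∀ s ∈ Set.Icc (s₀ + ε) s₁,
      HasDerivWithinAt (timeAvg ε (v i) x) (timeDiff ε (v i) x s) (Set.Icc (s₀ + ε) s₁) s :=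
    fun i hi x hx s hs => by
      have h01 : s₀ ≤ s₁ := (hmem s hs).1.1.trans (hmem s hs).1.2
      have h1 := (hasDerivWithinAt_integral_Icc h01 (h.continuous_time i hi x hx)
        (hmem s hs).1).mono (Set.Icc_subset_Icc_left (by linarith : s₀ ≤ s₀ + ε))
      have h2 := hasDerivWithinAt_comp_sub hε.le (hasDerivWithinAt_integral_Icc h01
        (h.continuous_time i hi x hx) (hmem s hs).2)
      have hI : ∀ r ∈ Set.Icc s₀ s₁, IntervalIntegrable (v i x) volume s₀ r := fun r hr =>
        ContinuousOn.intervalIntegrable (by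
          rw [Set.uIcc_of_le hr.1]
          exact (h.continuous_time i hi x hx).mono (Set.Icc_subset_Icc_right hr.2))
      have hE : ∀ r ∈ Set.Icc (s₀ + ε) s₁, timeAvg ε (v i) x r =
          ((∫ y in s₀..r, v i x y) - ∫ y in s₀..(r - ε), v i x y) / ε := fun r hr => by
        rw [timeAvg, intervalIntegral.integral_interval_sub_left (hI r (hmem r hr).1)
          (hI _ (hmem r hr).2)]
      exact ((h1.sub h2).div_const ε).congr hE (hE s hs)
  have hdiff_time : ∀ x ∈ Dom, ∀ s ∈ Set.Icc (s₀ + ε) s₁,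
      HasDerivWithinAt (timeDiff ε (v 0) x) (timeDiff ε (v 2) x s) (Set.Icc (s₀ + ε) s₁) s :=
    fun x hx s hs =>
      (((h.deriv_time 0 le_rfl x hx s (hmem s hs).1).mono
        (Set.Icc_subset_Icc_left (by linarith : s₀ ≤ s₀ + ε))).sub
        (hasDerivWithinAt_comp_sub hε.le (h.deriv_time 0 le_rfl x hx _ (hmem s hs).2))).div_const ε
  have hdiff_cont : ∀ i ≤ 2, ∀ x ∈ Dom,
      ContinuousOn (timeDiff ε (v i) x) (Set.Icc (s₀ + ε) s₁) := fun i hi x hx =>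
    (((h.continuous_time i hi x hx).mono (fun s hs => (hmem s hs).1)).sub
      ((h.continuous_time i hi x hx).comp (by fun_prop) fun s hs => (hmem s hs).2)).div_const ε
  have h2avg : ∀ x ∈ Dom, ∀ s ∈ Set.Icc (s₀ + ε) s₁, timeAvg ε (v 2) x s = timeDiff ε (v 0) x s :=
    fun x hx s hs => by
      rw [timeAvg, timeDiff, integral_eq_sub_of_hasDerivWithinAt_Icc (by linarith)
        ((h.continuous_time 2 le_rfl x hx).mono (hsub s hs))
        fun r hr => (h.deriv_time 0 le_rfl x hx r (hsub s hs hr)).mono (hsub s hs)]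
  refine ⟨?_, ?_, ?_, ?_, ?_⟩
  · rintro (_ | _ | i) hi s hs x hx
    · exact (havg_bound 0 (by omega) s hs x hx).trans hUε
    · exact (havg_bound 1 (by omega) s hs x hx).trans hUε
    · exact hdiff_bound i (by omega) s hs x hx
  · rintro (_ | _ | i) hi s hs x hx y hy
    · exact (havg_lip 0 (by omega) s hs x hx y hy).trans (by gcongr)
    · exact (havg_lip 1 (by omega) s hs x hx y hy).trans (by gcongr)
    · exact hdiff_lip i (by omega) s hs x hx y hy
  · rintro (_ | _ | i) hi s hs x hx
    · exact havg_space 0 (by omega) s hs x hx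
    · have := havg_space 1 (by omega) s hs x hx
      rw [show 1 + 1 = 2 from rfl, h2avg x hx s hs] at this
      exact this
    · exact hdiff_space i (by omega) s hs x hx
  · rintro (_ | _ | i) hi x hx
    · exact fun s hs => (havg_time 0 (by omega) x hx s hs).continuousWithinAt
    · exact fun s hs => (havg_time 1 (by omega) x hx s hs).continuousWithinAt
    · exact hdiff_cont i (by omega) x hx
  · rintro (_ | _ | _ | i) hi x hx s hs
    · exact havg_time 0 (by omega) x hx s hs
    · exact havg_time 1 (by omega) x hx s hs
    · exact hdiff_time x hx s hs
    · omega

/-! ## Elementary continuity in time -/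

theorem abs_le_of_hasDerivWithinAt_of_lipschitz {f : ℝ → ℝ} {f' L x : ℝ} (hx : x ∈ Dom)
    (hf : HasDerivWithinAt f f' Dom x) (hL : ∀ y ∈ Dom, |f y - f x| ≤ L * |y - x|) : |f'| ≤ L := by
  have h1 := (hasDerivWithinAt_iff_tendsto_slope.mp hf).norm
  have hne : (nhdsWithin x (Dom \ {x})).NeBot := by
    have := uniqueDiffWithinAt_iff_accPt.mp (uniqueDiffOn_Icc two_pi_pos' x hx)
    rwa [accPt_principal_iff_nhdsWithin] at this
  refine le_of_tendsto h1 ?_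
  filter_upwards [self_mem_nhdsWithin] with y hy
  have hpos : 0 < |y - x| := abs_pos.mpr (sub_ne_zero.mpr hy.2)
  rw [slope_def_field, norm_div, Real.norm_eq_abs, Real.norm_eq_abs, div_le_iff₀ hpos]
  exact hL y hy.1

/-- The difference v 0 y - v 0 x has time derivative v 2 y - v 2 x, which is at most U|y - x|.
Letting y tend to x controls time increments of v 1 although v 1 has no time derivative here. -/
theorem HeatRegular.abs_time_diff_lipschitz {v : ℕ → ℝ → ℝ → ℝ} (h : HeatRegular 2 s₀ s₁ U v)
    {s t : ℝ} (hs : s₀ ≤ s) (hst : s ≤ t) (ht : t ≤ s₁) {x y : ℝ} (hx : x ∈ Dom) (hy : y ∈ Dom) :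
    |(v 0 y t - v 0 y s) - (v 0 x t - v 0 x s)| ≤ U * (t - s) * |y - x| := by
  have hsub : Set.Icc s t ⊆ Set.Icc s₀ s₁ := Set.Icc_subset_Icc hs ht
  have h1 := (convex_Icc s t).norm_image_sub_le_of_norm_hasDerivWithin_le
    (f := fun r => v 0 y r - v 0 x r) (f' := fun r => v 2 y r - v 2 x r) (C := U * |y - x|)
    (fun r hr => ((h.deriv_time 0 le_rfl y hy r (hsub hr)).mono hsub).sub
      ((h.deriv_time 0 le_rfl x hx r (hsub hr)).mono hsub))
    (fun r hr => h.lipschitz 2 le_rfl r (hsub hr) y hy x hx)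
    (Set.left_mem_Icc.mpr hst) (Set.right_mem_Icc.mpr hst)
  rw [Real.norm_eq_abs, Real.norm_eq_abs, abs_of_nonneg (sub_nonneg.mpr hst)] at h1
  calc _ = |v 0 y t - v 0 x t - (v 0 y s - v 0 x s)| := by ring_nf
    _ ≤ _ := h1
    _ = _ := by ring

theorem HeatRegular.abs_time_diff_one_le {v : ℕ → ℝ → ℝ → ℝ} (h : HeatRegular 2 s₀ s₁ U v)
    {s t : ℝ} (hs : s₀ ≤ s) (hst : s ≤ t) (ht : t ≤ s₁) {x : ℝ} (hx : x ∈ Dom) :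
    |v 1 x t - v 1 x s| ≤ U * (t - s) :=
  abs_le_of_hasDerivWithinAt_of_lipschitz hx
    ((h.deriv_space 0 (by omega) t ⟨hs.trans hst, ht⟩ x hx).sub
      (h.deriv_space 0 (by omega) s ⟨hs, hst.trans ht⟩ x hx))
    fun _ hy => h.abs_time_diff_lipschitz hs hst ht hx hy

/-- Interpolation at the parabolic scale δ = √(t-s): the increment of v 2 is the difference quotient
with step δ of the increment of v 1, at most 2Uδ²/δ, up to the Lipschitz error 2Uδ. -/
theorem HeatRegular.abs_time_diff_two_le {v : ℕ → ℝ → ℝ → ℝ} (h : HeatRegular 2 s₀ s₁ U v)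
    {s t : ℝ} (hs : s₀ ≤ s) (hst : s ≤ t) (ht : t ≤ s₁) {x : ℝ} (hx : x ∈ Dom) :
    |v 2 x t - v 2 x s| ≤ 4 * U * Real.sqrt (t - s) := by
  have htm : t ∈ Set.Icc s₀ s₁ := ⟨hs.trans hst, ht⟩
  have hsm : s ∈ Set.Icc s₀ s₁ := ⟨hs, hst.trans ht⟩
  have hU : 0 ≤ U := (abs_nonneg _).trans (h.bound 0 (by omega) t htm x hx)
  set δ := Real.sqrt (t - s) with hδ
  have hδ0 : 0 ≤ δ := Real.sqrt_nonneg _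
  have hδ2 : δ ^ 2 = t - s := Real.sq_sqrt (sub_nonneg.mpr hst)
  rcases le_total δ Real.pi with hle | hge
  · rcases hδ0.eq_or_lt with h0 | hpos
    · have : s = t := by rw [← h0] at hδ2; linarith
      rw [this, sub_self, abs_zero]; positivity
    obtain ⟨y, hy, hyx⟩ := exists_mem_Dom_abs_sub hx hδ0 hle
    have h1 := abs_sub_sub_mul_le (U := 2 * U) (f := fun x => v 1 x t - v 1 x s)
      (f' := fun x => v 2 x t - v 2 x s) (by positivity)
      (fun z hz => (h.deriv_space 1 (by omega) t htm z hz).sub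
        (h.deriv_space 1 (by omega) s hsm z hz))
      (fun z hz z' hz' => by
        have e1 := h.lipschitz 2 le_rfl t htm z hz z' hz'
        have e2 := h.lipschitz 2 le_rfl s hsm z hz z' hz'
        have e3 := abs_sub (v 2 z t - v 2 z' t) (v 2 z s - v 2 z' s)
        have e4 : v 2 z t - v 2 z s - (v 2 z' t - v 2 z' s) =
          v 2 z t - v 2 z' t - (v 2 z s - v 2 z' s) := by ring
        rw [e4]; linarith) hx hy
    have h2 := h.abs_time_diff_one_le hs hst ht hy
    have h3 := h.abs_time_diff_one_le hs hst ht hx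
    rw [hyx, hδ2] at h1
    have h4 : δ * |v 2 x t - v 2 x s| ≤ 4 * U * δ * δ := by
      rw [← hyx, ← abs_mul, hyx]
      have e1 : (y - x) * (v 2 x t - v 2 x s) = (v 1 y t - v 1 y s) - (v 1 x t - v 1 x s) -
        (v 1 y t - v 1 y s - (v 1 x t - v 1 x s) - (y - x) * (v 2 x t - v 2 x s)) := by ring
      rw [e1]
      have e2 := abs_sub ((v 1 y t - v 1 y s) - (v 1 x t - v 1 x s))
        (v 1 y t - v 1 y s - (v 1 x t - v 1 x s) - (y - x) * (v 2 x t - v 2 x s))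
      have e3 := abs_sub (v 1 y t - v 1 y s) (v 1 x t - v 1 x s)
      have e4 : 4 * U * δ * δ = 4 * U * (t - s) := by rw [← hδ2]; ring
      rw [e4]
      linarith
    nlinarith
  -- When δ exceeds π no such step fits into the domain, but the trivial bound 2U is then smaller.
  · have h1 := h.bound 2 le_rfl t htm x hx
    have h2 := h.bound 2 le_rfl s hsm x hx
    have h3 := abs_sub (v 2 x t) (v 2 x s)
    have : (1 : ℝ) ≤ δ := by linarith [Real.pi_gt_three]
    nlinarith

end LDG
end

noncomputable section

namespace LDG

/-! ## Interior smoothing for the heat equation -/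

variable {s₀ s₁ U V : ℝ}

/-- A weight that vanishes at the end points of the domain. -/
def weight (x : ℝ) : ℝ := x * (2 * Real.pi - x)

theorem hasDerivAt_weight (x : ℝ) : HasDerivAt weight (2 * Real.pi - 2 * x) x := by
  have h := (hasDerivAt_id' x).mul ((hasDerivAt_id' x).const_sub (2 * Real.pi))
  have e : 1 * (2 * Real.pi - x) + x * (-1) = 2 * Real.pi - 2 * x := by ring
  rw [e] at h
  exact h

theorem continuous_weight : Continuous weight := by unfold weight; fun_prop

theorem weight_nonneg {x : ℝ} (hx : x ∈ Dom) : 0 ≤ weight x :=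
  mul_nonneg hx.1 (sub_nonneg.mpr hx.2)

theorem weight_sq_le {x : ℝ} (hx : x ∈ Dom) : weight x ^ 2 ≤ Real.pi ^ 4 := by
  have h1 : weight x ≤ Real.pi ^ 2 := by unfold weight; nlinarith [sq_nonneg (x - Real.pi)]
  calc weight x ^ 2 ≤ (Real.pi ^ 2) ^ 2 := pow_le_pow_left₀ (weight_nonneg hx) h1 2
    _ = _ := by ring

theorem deriv_weight_sq_le {x : ℝ} (hx : x ∈ Dom) :
    (2 * Real.pi - 2 * x) ^ 2 ≤ 4 * Real.pi ^ 2 := by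
  nlinarith [hx.1, hx.2, mul_nonneg hx.1 (sub_nonneg.mpr hx.2)]

theorem intervalIntegrable_Dom {f : ℝ → ℝ} (hf : ContinuousOn f Dom) :
    IntervalIntegrable f volume 0 (2 * Real.pi) :=
  ContinuousOn.intervalIntegrable (by rwa [Set.uIcc_of_le two_pi_pos'.le])

theorem integral_Dom_mono {f g : ℝ → ℝ} (hf : ContinuousOn f Dom) (hg : ContinuousOn g Dom)
    (h : ∀ x ∈ Dom, f x ≤ g x) :
    ∫ x in (0 : ℝ)..2 * Real.pi, f x ≤ ∫ x in (0 : ℝ)..2 * Real.pi, g x :=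
  intervalIntegral.integral_mono_on two_pi_pos'.le (intervalIntegrable_Dom hf)
    (intervalIntegrable_Dom hg) h

theorem integral_Dom_le_const {f : ℝ → ℝ} {B : ℝ} (hf : ContinuousOn f Dom)
    (h : ∀ x ∈ Dom, f x ≤ B) : ∫ x in (0 : ℝ)..2 * Real.pi, f x ≤ 2 * Real.pi * B := by
  refine (integral_Dom_mono hf continuousOn_const h).trans ?_
  simp

/-- P is the total derivative produced by `integral_weight_mul_parts`. The factor 2 matches that of
the derivative of a square, so the hypothesis becomes a pointwise completion of squares. -/
theorem integral_Dom_le_of_null {F P R : ℝ → ℝ} (hF : ContinuousOn F Dom) (hP : ContinuousOn P Dom)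
    (hR : ContinuousOn R Dom) (h0 : ∫ x in (0 : ℝ)..2 * Real.pi, P x = 0)
    (h : ∀ x ∈ Dom, F x - 2 * P x ≤ R x) :
    ∫ x in (0 : ℝ)..2 * Real.pi, F x ≤ ∫ x in (0 : ℝ)..2 * Real.pi, R x := by
  have h1 := integral_Dom_mono (by fun_prop) hR h
  rwa [intervalIntegral.integral_sub (intervalIntegrable_Dom hF)
    ((intervalIntegrable_Dom hP).const_mul 2), intervalIntegral.integral_const_mul, h0, mul_zero,
    sub_zero] at h1

/-- Integration by parts against a power of the weight. -/
theorem integral_weight_mul_parts (n : ℕ) {f g f' g' : ℝ → ℝ} (hf' : ContinuousOn f' Dom)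
    (hg' : ContinuousOn g' Dom) (hf : ∀ x ∈ Dom, HasDerivWithinAt f (f' x) Dom x)
    (hg : ∀ x ∈ Dom, HasDerivWithinAt g (g' x) Dom x) :
    ∫ x in (0 : ℝ)..2 * Real.pi, (weight x ^ (n + 1) * (f' x * g x + f x * g' x) +
      (n + 1) * weight x ^ n * (2 * Real.pi - 2 * x) * (f x * g x)) = 0 := by
  have hfc : ContinuousOn f Dom := fun x hx => (hf x hx).continuousWithinAt
  have hgc : ContinuousOn g Dom := fun x hx => (hg x hx).continuousWithinAt
  have hwc := continuous_weight
  rw [integral_eq_sub_of_hasDerivWithinAt_Icc (f := fun x => weight x ^ (n + 1) * (f x * g x))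
    two_pi_pos'.le (by fun_prop) fun x hx => ?_]
  · simp [weight]
  · have h1 := (((hasDerivAt_weight x).pow (n + 1)).hasDerivWithinAt (s := Dom)).mul
      ((hf x hx).mul (hg x hx))
    refine h1.congr_deriv ?_
    simp only [Nat.add_sub_cancel, Nat.cast_add, Nat.cast_one]
    simp
    ring

section Energy

variable {f : ℕ → ℝ → ℝ → ℝ}

/-- With w the weight, J₁ = ∫ w² f₁², J₂ = ∫ w⁴ f₂² and G = ∫ w² f₂², the dissipation G of J₁
dominates both J₂ and the growth of J₂. Hence (s - s₀) J₂ + B J₁ grows at most linearly. The powers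
of w drop with the order of the derivative so that terms with w' can be absorbed. Only the bound U
of f 1 appears; V, which degenerates under averaging, does not. -/
theorem HeatRegular.weighted_energy (h : HeatRegular 4 s₀ s₁ V f)
    (hU : ∀ s ∈ Set.Icc s₀ s₁, ∀ x ∈ Dom, |f 1 x s| ≤ U) (hlen : s₁ ≤ s₀ + 1)
    {s : ℝ} (hs : s ∈ Set.Icc s₀ s₁) :
    (s - s₀) * ∫ x in (0 : ℝ)..2 * Real.pi, weight x ^ 4 * f 2 x s ^ 2 ≤
      (Real.pi ^ 4 + 32 * Real.pi ^ 2) * (2 * Real.pi ^ 5 + 32 * Real.pi ^ 3) * U ^ 2 := by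
  have hwc := continuous_weight
  have hpi := Real.pi_pos
  have hc : ∀ i ≤ 4, ∀ s ∈ Set.Icc s₀ s₁, ContinuousOn (fun x => f i x s) Dom :=
    fun i hi s hs => h.continuous_space hi hs
  have hcc : ∀ i ≤ 4, ContinuousOn (fun q : ℝ × ℝ => f i q.1 q.2) (Dom ×ˢ Set.Icc s₀ s₁) :=
    fun i hi => h.continuousOn hi
  have hU2 : ∀ s ∈ Set.Icc s₀ s₁, ∀ x ∈ Dom, f 1 x s ^ 2 ≤ U ^ 2 := fun s hs x hx =>
    sq_le_sq' (abs_le.mp (hU s hs x hx)).1 (abs_le.mp (hU s hs x hx)).2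
  have hwcc : Continuous fun q : ℝ × ℝ => weight q.1 := hwc.comp continuous_fst
  set J₂ : ℝ → ℝ := fun s => ∫ x in (0 : ℝ)..2 * Real.pi, weight x ^ 4 * f 2 x s ^ 2 with hJ₂
  set J₁ : ℝ → ℝ := fun s => ∫ x in (0 : ℝ)..2 * Real.pi, weight x ^ 2 * f 1 x s ^ 2 with hJ₁
  set G : ℝ → ℝ := fun s => ∫ x in (0 : ℝ)..2 * Real.pi, weight x ^ 2 * f 2 x s ^ 2 with hG
  have hd₂ : ∀ s ∈ Set.Icc s₀ s₁, HasDerivWithinAt J₂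
      (∫ x in (0 : ℝ)..2 * Real.pi, weight x ^ 4 * (2 * f 2 x s * f 4 x s)) (Set.Icc s₀ s₁) s :=
    fun s hs => hasDerivWithinAt_integral_space (f := fun x s => weight x ^ 4 * f 2 x s ^ 2)
      (g := fun x s => weight x ^ 4 * (2 * f 2 x s * f 4 x s)) two_pi_pos'.le
      (fun s hs => by have := hc 2 (by omega) s hs; fun_prop)
      (by have := hcc 2 (by omega); have := hcc 4 (by omega); fun_prop)
      (fun x hx s hs => by
        have := ((h.deriv_time 2 (by omega) x hx s hs).pow 2).const_mul (weight x ^ 4)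
        refine this.congr_deriv ?_
        norm_num) hs
  have hd₁ : ∀ s ∈ Set.Icc s₀ s₁, HasDerivWithinAt J₁
      (∫ x in (0 : ℝ)..2 * Real.pi, weight x ^ 2 * (2 * f 1 x s * f 3 x s)) (Set.Icc s₀ s₁) s :=
    fun s hs => hasDerivWithinAt_integral_space (f := fun x s => weight x ^ 2 * f 1 x s ^ 2)
      (g := fun x s => weight x ^ 2 * (2 * f 1 x s * f 3 x s)) two_pi_pos'.le
      (fun s hs => by have := hc 1 (by omega) s hs; fun_prop)
      (by have := hcc 1 (by omega); have := hcc 3 (by omega); fun_prop)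
      (fun x hx s hs => by
        have := ((h.deriv_time 1 (by omega) x hx s hs).pow 2).const_mul (weight x ^ 2)
        refine this.congr_deriv ?_
        norm_num) hs
  -- By parts, 2∫ w⁴ f₂ f₄ = -2∫ w⁴ f₃² - 8∫ w³ w' f₂ f₃. Completing the square in f₃ leaves 8∫ w²
  -- w'² f₂², and w'² ≤ 4π².
  have hb₂ : ∀ s ∈ Set.Icc s₀ s₁,
      ∫ x in (0 : ℝ)..2 * Real.pi, weight x ^ 4 * (2 * f 2 x s * f 4 x s) ≤
        32 * Real.pi ^ 2 * G s := fun s hs => by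
    have c2 := hc 2 (by omega) s hs
    have c3 := hc 3 (by omega) s hs
    have c4 := hc 4 (by omega) s hs
    have hp := integral_weight_mul_parts 3 c3 c4 (h.deriv_space 2 (by omega) s hs)
      (h.deriv_space 3 (by omega) s hs)
    simp only [hG]
    rw [← intervalIntegral.integral_const_mul]
    refine integral_Dom_le_of_null (by fun_prop) (by fun_prop) (by fun_prop) hp fun x hx => ?_
    have e1 := mul_le_mul_of_nonneg_right (deriv_weight_sq_le hx)
      (sq_nonneg (weight x * f 2 x s))
    have e2 := sq_nonneg (weight x ^ 2 * f 3 x s +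
      2 * (weight x * (2 * Real.pi - 2 * x) * f 2 x s))
    push_cast
    nlinarith [e1, e2]
  -- Half of the dissipation 2G absorbs the cross term 4∫ w w' f₁ f₂; the price is 4∫ w'² f₁².
  have hb₁ : ∀ s ∈ Set.Icc s₀ s₁,
      ∫ x in (0 : ℝ)..2 * Real.pi, weight x ^ 2 * (2 * f 1 x s * f 3 x s) ≤
        -G s + 32 * Real.pi ^ 3 * U ^ 2 := fun s hs => by
    have c1 := hc 1 (by omega) s hs
    have c2 := hc 2 (by omega) s hs
    have c3 := hc 3 (by omega) s hs
    have hp := integral_weight_mul_parts 1 c2 c3 (h.deriv_space 1 (by omega) s hs)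
      (h.deriv_space 2 (by omega) s hs)
    have e0 : ∫ x in (0 : ℝ)..2 * Real.pi, (-(weight x ^ 2 * f 2 x s ^ 2) +
        16 * Real.pi ^ 2 * U ^ 2) = -G s + 32 * Real.pi ^ 3 * U ^ 2 := by
      rw [intervalIntegral.integral_add (intervalIntegrable_Dom (by fun_prop))
        (intervalIntegrable_Dom (by fun_prop)), intervalIntegral.integral_neg,
        intervalIntegral.integral_const, smul_eq_mul]
      simp only [hG]
      ring
    rw [← e0]
    refine integral_Dom_le_of_null (by fun_prop) (by fun_prop) (by fun_prop) hp fun x hx => ?_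
    have e1 := mul_le_mul (deriv_weight_sq_le hx) (hU2 s hs x hx) (sq_nonneg _) (by positivity)
    have e2 := sq_nonneg (weight x * f 2 x s + 2 * ((2 * Real.pi - 2 * x) * f 1 x s))
    push_cast
    nlinarith [e1, e2]
  have hJG : ∀ s ∈ Set.Icc s₀ s₁, J₂ s ≤ Real.pi ^ 4 * G s := fun s hs => by
    have c2 := hc 2 (by omega) s hs
    rw [hG, hJ₂]
    simp only
    rw [← intervalIntegral.integral_const_mul]
    refine integral_Dom_mono (by fun_prop) (by fun_prop) fun x hx => ?_
    have e1 := mul_le_mul_of_nonneg_right (weight_sq_le hx) (sq_nonneg (weight x * f 2 x s))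
    nlinarith [e1]
  have hG0 : ∀ s ∈ Set.Icc s₀ s₁, 0 ≤ G s := fun s hs =>
    intervalIntegral.integral_nonneg two_pi_pos'.le fun x _ => by positivity
  have hJ10 : 0 ≤ J₁ s := intervalIntegral.integral_nonneg two_pi_pos'.le fun x _ => by positivity
  have h01 : s₀ ≤ s₁ := hs.1.trans hs.2
  have hs0 : s₀ ∈ Set.Icc s₀ s₁ := ⟨le_rfl, h01⟩
  have hJ1s : J₁ s₀ ≤ 2 * Real.pi ^ 5 * U ^ 2 := by
    have c1 := hc 1 (by omega) s₀ hs0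
    have e0 : 2 * Real.pi ^ 5 * U ^ 2 = 2 * Real.pi * (Real.pi ^ 4 * U ^ 2) := by ring
    rw [e0]
    refine integral_Dom_le_const (by fun_prop) fun x hx => ?_
    exact mul_le_mul (weight_sq_le hx) (hU2 s₀ hs0 x hx) (sq_nonneg _) (by positivity)
  -- π⁴ pays for J₂ ≤ π⁴ G and 32π² for (s - s₀) J₂', where s - s₀ ≤ 1.
  set B := Real.pi ^ 4 + 32 * Real.pi ^ 2 with hB
  have hB0 : 0 < B := by positivity
  set Ψ : ℝ → ℝ := fun s => (s - s₀) * J₂ s + B * J₁ s - B * (32 * Real.pi ^ 3 * U ^ 2) * s with hΨ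
  have hΨd : ∀ s ∈ Set.Icc s₀ s₁, HasDerivWithinAt Ψ
      (1 * J₂ s + (s - s₀) * (∫ x in (0 : ℝ)..2 * Real.pi, weight x ^ 4 * (2 * f 2 x s * f 4 x s)) +
        B * (∫ x in (0 : ℝ)..2 * Real.pi, weight x ^ 2 * (2 * f 1 x s * f 3 x s)) -
        B * (32 * Real.pi ^ 3 * U ^ 2) * 1) (Set.Icc s₀ s₁) s := fun s hs =>
    (((((hasDerivAt_id s).sub_const s₀).hasDerivWithinAt).mul (hd₂ s hs)).add
      ((hd₁ s hs).const_mul B)).sub (((hasDerivAt_id s).hasDerivWithinAt).const_mul _)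
  have hanti : AntitoneOn Ψ (Set.Icc s₀ s₁) := by
    refine antitoneOn_of_hasDerivWithinAt_nonpos (convex_Icc _ _)
      (fun s hs => (hΨd s hs).continuousWithinAt)
      (fun s hs => (hΨd s (interior_subset hs)).mono interior_subset) fun s hs => ?_
    have hs' : s ∈ Set.Icc s₀ s₁ := interior_subset hs
    have e1 := hb₁ s hs'
    have e2 := hb₂ s hs'
    have e3 := hJG s hs'
    have e4 := hG0 s hs'
    have e5 : (s - s₀) * (∫ x in (0 : ℝ)..2 * Real.pi, weight x ^ 4 * (2 * f 2 x s * f 4 x s)) ≤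
        1 * (32 * Real.pi ^ 2 * G s) :=
      (mul_le_mul_of_nonneg_left e2 (by linarith [hs'.1])).trans
        (mul_le_mul_of_nonneg_right (by linarith [hs'.2]) (by positivity))
    have e6 := mul_le_mul_of_nonneg_left e1 hB0.le
    rw [hB] at e6 ⊢
    nlinarith
  have h1 := hanti hs0 hs hs.1
  simp only [hΨ, sub_self, zero_mul, zero_add] at h1
  have h2 : B * (32 * Real.pi ^ 3 * U ^ 2) * (s - s₀) ≤ B * (32 * Real.pi ^ 3 * U ^ 2) * 1 :=
    mul_le_mul_of_nonneg_left (by linarith [hs.2]) (by positivity)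
  have h3 := mul_le_mul_of_nonneg_left hJ1s hB0.le
  have h4 : 0 ≤ B * J₁ s := mul_nonneg hB0.le hJ10
  nlinarith

end Energy

end LDG
end

/-! ### Time increments in the weighted norm and removal of the weight -/

noncomputable section

namespace LDG

variable {s₀ s₁ U V : ℝ}

theorem le_add_mul_of_hasDerivWithinAt_le {f f' : ℝ → ℝ} {B s t : ℝ} (hst : s ≤ t)
    (hf : ∀ r ∈ Set.Icc s t, HasDerivWithinAt f (f' r) (Set.Icc s t) r)
    (hB : ∀ r ∈ Set.Icc s t, f' r ≤ B) : f t ≤ f s + B * (t - s) := by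
  have hd : ∀ r ∈ Set.Icc s t, HasDerivWithinAt (fun r => f r - B * r) (f' r - B * 1)
      (Set.Icc s t) r := fun r hr =>
    (hf r hr).sub (((hasDerivAt_id r).hasDerivWithinAt).const_mul B)
  have h := antitoneOn_of_hasDerivWithinAt_nonpos (convex_Icc _ _)
    (fun s hs => (hd s hs).continuousWithinAt)
    (fun s hs => (hd s (interior_subset hs)).mono interior_subset) (fun s hs => by
      linarith [hB s (interior_subset hs)]) (Set.left_mem_Icc.mpr hst) (Set.right_mem_Icc.mpr hst)
    hst
  simp only at h
  linarith

/-- Time increments of a smooth solution, in a weighted norm. -/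
theorem exists_weighted_increment_bound : ∃ C : ℝ, 0 < C ∧ ∀ (s₀ s₁ U V : ℝ) (f : ℕ → ℝ → ℝ → ℝ),
    HeatRegular 4 s₀ s₁ V f → (∀ s ∈ Set.Icc s₀ s₁, ∀ x ∈ Dom, |f 1 x s| ≤ U) → s₁ ≤ s₀ + 1 →
    ∀ s t, s₀ < s → s ≤ t → t ≤ s₁ →
      ∫ x in (0 : ℝ)..2 * Real.pi, weight x ^ 4 * (f 0 x t - f 0 x s) ^ 2 ≤
        C * U ^ 2 * (t - s) ^ 2 / (s - s₀) ∧
      ∫ x in (0 : ℝ)..2 * Real.pi, weight x ^ 4 * (f 1 x t - f 1 x s) ^ 2 ≤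
        C * U ^ 2 * (t - s) / (s - s₀) := by
  have hpi := Real.pi_pos
  set C₀ := (Real.pi ^ 4 + 32 * Real.pi ^ 2) * (2 * Real.pi ^ 5 + 32 * Real.pi ^ 3) with hC₀
  have hC₀0 : 0 < C₀ := by positivity
  refine ⟨3 * C₀ + 512 * Real.pi ^ 7, by positivity, ?_⟩
  intro s₀ s₁ U V f h hU hlen s t hs0 hst hts
  have hwc := continuous_weight
  have hwcc : Continuous fun q : ℝ × ℝ => weight q.1 := hwc.comp continuous_fst
  have hθ : 0 < s - s₀ := sub_pos.mpr hs0
  have hsub : Set.Icc s t ⊆ Set.Icc s₀ s₁ := Set.Icc_subset_Icc hs0.le hts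
  have hsm : s ∈ Set.Icc s t := ⟨le_rfl, hst⟩
  have htm : t ∈ Set.Icc s t := ⟨hst, le_rfl⟩
  have h' := h.mono hs0.le hts
  have hc : ∀ i ≤ 4, ∀ r ∈ Set.Icc s t, ContinuousOn (fun x => f i x r) Dom :=
    fun i hi r hr => h'.continuous_space hi hr
  have hcc : ∀ i ≤ 4, ContinuousOn (fun q : ℝ × ℝ => f i q.1 q.2) (Dom ×ˢ Set.Icc s t) :=
    fun i hi => h'.continuousOn hi
  have hcs : ∀ i ≤ 4, ContinuousOn (fun q : ℝ × ℝ => f i q.1 s) (Dom ×ˢ Set.Icc s t) :=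
    fun i hi => (hc i hi s hsm).comp continuousOn_fst fun q hq => hq.1
  have hJ : ∀ r ∈ Set.Icc s t, ∫ x in (0 : ℝ)..2 * Real.pi, weight x ^ 4 * f 2 x r ^ 2 ≤
      C₀ * U ^ 2 / (s - s₀) := fun r hr => by
    rw [le_div_iff₀ hθ, mul_comm]
    refine le_trans ?_ (h.weighted_energy hU hlen (hsub hr))
    refine mul_le_mul_of_nonneg_right (by linarith [hr.1]) ?_
    exact intervalIntegral.integral_nonneg two_pi_pos'.le fun x _ => by positivity
  have hdK : ∀ i ≤ 1, ∀ r ∈ Set.Icc s t, HasDerivWithinAt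
      (fun r => ∫ x in (0 : ℝ)..2 * Real.pi, weight x ^ 4 * (f i x r - f i x s) ^ 2)
      (∫ x in (0 : ℝ)..2 * Real.pi, weight x ^ 4 * (2 * (f i x r - f i x s) * f (i + 2) x r))
      (Set.Icc s t) r := fun i hi r hr =>
    hasDerivWithinAt_integral_space (f := fun x r => weight x ^ 4 * (f i x r - f i x s) ^ 2)
      (g := fun x r => weight x ^ 4 * (2 * (f i x r - f i x s) * f (i + 2) x r)) two_pi_pos'.le
      (fun r hr => by
        have := hc i (by omega) r hr
        have := hc i (by omega) s hsm
        fun_prop)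
      (((hwcc.pow 4).continuousOn).mul (((continuousOn_const (c := (2 : ℝ))).mul
          ((hcc i (by omega)).sub (hcs i (by omega)))).mul (hcc (i + 2) (by omega))))
      (fun x hx r hr => by
        have := (((h'.deriv_time i (by omega) x hx r hr).sub_const (f i x s)).pow 2).const_mul
          (weight x ^ 4)
        refine this.congr_deriv ?_
        norm_num) hr
  have hU2 : ∀ r ∈ Set.Icc s t, ∀ x ∈ Dom, (f 1 x r - f 1 x s) ^ 2 ≤ 4 * U ^ 2 :=
    fun r hr x hx => by
      have e1 := abs_le.mp (hU r (hsub hr) x hx)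
      have e2 := abs_le.mp (hU s (hsub hsm) x hx)
      have : (f 1 x r - f 1 x s) ^ 2 ≤ (2 * U) ^ 2 := sq_le_sq' (by linarith) (by linarith)
      linarith
  constructor
  · rcases hst.eq_or_lt with rfl | hlt
    · simp
    set D := C₀ * U ^ 2 / (s - s₀) with hD
    have hD0 : 0 ≤ D := by positivity
    set τ := t - s with hτ
    have hτ0 : 0 < τ := sub_pos.mpr hlt
    set M : ℝ → ℝ := fun r => ∫ x in (0 : ℝ)..2 * Real.pi, weight x ^ 4 * (f 0 x r - f 0 x s) ^ 2
      with hM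
    -- 2ab ≤ a²/τ + τb² with a the increment of f 0 and b = f 2. The term M/τ is removed below by
    -- the factor exp(-(r-s)/τ), which costs e < 3 over an interval of length τ.
    have hM' : ∀ r ∈ Set.Icc s t,
        ∫ x in (0 : ℝ)..2 * Real.pi, weight x ^ 4 * (2 * (f 0 x r - f 0 x s) * f (0 + 2) x r) ≤
          M r / τ + τ * D := fun r hr => by
      have c0 := hc 0 (by omega) r hr
      have c0s := hc 0 (by omega) s hsm
      have c2 := hc 2 (by omega) r hr
      have e1 : M r / τ + τ * ∫ x in (0 : ℝ)..2 * Real.pi, weight x ^ 4 * f 2 x r ^ 2 =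
          ∫ x in (0 : ℝ)..2 * Real.pi, (weight x ^ 4 * (f 0 x r - f 0 x s) ^ 2 / τ +
            τ * (weight x ^ 4 * f 2 x r ^ 2)) := by
        rw [intervalIntegral.integral_add (intervalIntegrable_Dom (by fun_prop))
          (intervalIntegrable_Dom (by fun_prop)), intervalIntegral.integral_div,
          intervalIntegral.integral_const_mul]
      refine le_trans ?_ (add_le_add_right (mul_le_mul_of_nonneg_left (hJ r hr) hτ0.le) _)
      rw [e1]
      refine integral_Dom_mono (by fun_prop) (by fun_prop) fun x hx => ?_
      have e2 : 0 ≤ weight x ^ 4 * ((f 0 x r - f 0 x s) - τ * f 2 x r) ^ 2 / τ := by positivity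
      have e3 : weight x ^ 4 * ((f 0 x r - f 0 x s) - τ * f 2 x r) ^ 2 / τ =
        weight x ^ 4 * (f 0 x r - f 0 x s) ^ 2 / τ + τ * (weight x ^ 4 * f 2 x r ^ 2) -
          weight x ^ 4 * (2 * (f 0 x r - f 0 x s) * f (0 + 2) x r) := by
        field_simp; ring
      linarith
    have hexp : ∀ r, HasDerivAt (fun r => Real.exp (-((r - s) / τ)))
        (Real.exp (-((r - s) / τ)) * -(1 / τ)) r := fun r =>
      ((((hasDerivAt_id r).sub_const s).div_const τ).neg).exp
    have hN := le_add_mul_of_hasDerivWithinAt_le (f := fun r => Real.exp (-((r - s) / τ)) * M r)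
      (B := τ * D) hst
      (fun r hr => ((hexp r).hasDerivWithinAt).mul (hdK 0 (by omega) r hr)) (fun r hr => by
        have e1 : 0 < Real.exp (-((r - s) / τ)) := Real.exp_pos _
        have e2 : Real.exp (-((r - s) / τ)) ≤ 1 := Real.exp_le_one_iff.mpr (by
          have : 0 ≤ (r - s) / τ := div_nonneg (by linarith [hr.1]) hτ0.le
          linarith)
        have e3 := mul_le_mul_of_nonneg_left (hM' r hr) e1.le
        have e4 : Real.exp (-((r - s) / τ)) * (τ * D) ≤ 1 * (τ * D) :=
          mul_le_mul_of_nonneg_right e2 (by positivity)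
        have e5 : Real.exp (-((r - s) / τ)) * (M r / τ + τ * D) =
          Real.exp (-((r - s) / τ)) * (1 / τ) * M r + Real.exp (-((r - s) / τ)) * (τ * D) := by
          ring
        simp only [hM] at e3 e5 ⊢
        linarith)
    have e1 : M s = 0 := by simp [hM]
    have e2 : (t - s) / τ = 1 := by rw [hτ]; exact div_self (sub_pos.mpr hlt).ne'
    simp only [e1, e2, mul_zero, zero_add] at hN
    rw [Real.exp_neg, ← hτ, inv_mul_le_iff₀ (Real.exp_pos 1)] at hN
    have e3 : Real.exp 1 * (τ * D * τ) ≤ 3 * (τ * D * τ) :=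
      mul_le_mul_of_nonneg_right Real.exp_one_lt_three.le (by positivity)
    refine (hN.trans e3).trans ?_
    have e4 : 3 * (τ * D * τ) = 3 * C₀ * U ^ 2 * τ ^ 2 / (s - s₀) := by rw [hD]; ring
    rw [e4]
    have : 0 ≤ 512 * Real.pi ^ 7 := by positivity
    gcongr
    linarith
  · have hK := le_add_mul_of_hasDerivWithinAt_le
      (B := C₀ * U ^ 2 / (s - s₀) + 512 * Real.pi ^ 7 * U ^ 2) hst (hdK 1 le_rfl) (fun r hr => by
        have c1 := hc 1 (by omega) r hr
        have c1s := hc 1 (by omega) s hsm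
        have c2 := hc 2 (by omega) r hr
        have c2s := hc 2 (by omega) s hsm
        have c3 := hc 3 (by omega) r hr
        -- After integration by parts, -2(f₂(r) - f₂(s)) f₂(r) = f₂(s)² - f₂(r)² - (f₂(r) - f₂(s))².
        -- The first term is controlled by `hJ`, the second absorbs the terms with w'.
        have hp := integral_weight_mul_parts 3 (c2.sub c2s) c3
          (fun x hx => (h'.deriv_space 1 (by omega) r hr x hx).sub
            (h'.deriv_space 1 (by omega) s hsm x hx)) (h'.deriv_space 2 (by omega) r hr)
        simp only [Pi.sub_apply] at hp
        have e0 : ∫ x in (0 : ℝ)..2 * Real.pi, (weight x ^ 4 * f 2 x s ^ 2 +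
            256 * Real.pi ^ 6 * U ^ 2) =
            (∫ x in (0 : ℝ)..2 * Real.pi, weight x ^ 4 * f 2 x s ^ 2) +
              512 * Real.pi ^ 7 * U ^ 2 := by
          rw [intervalIntegral.integral_add (intervalIntegrable_Dom (by fun_prop))
            (intervalIntegrable_Dom (by fun_prop)), intervalIntegral.integral_const, smul_eq_mul]
          ring
        refine le_trans ?_ (add_le_add_left (hJ s hsm) _)
        rw [← e0]
        refine integral_Dom_le_of_null (by fun_prop) (by fun_prop) (by fun_prop) hp
          fun x hx => ?_
        have e1 := mul_le_mul (deriv_weight_sq_le hx) (hU2 r hr x hx) (sq_nonneg _)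
          (by positivity)
        have e2 := mul_le_mul (weight_sq_le hx) e1 (by positivity) (by positivity)
        have e3 := sq_nonneg (weight x ^ 2 * f 2 x r + 4 * (weight x * (2 * Real.pi - 2 * x) *
          (f 1 x r - f 1 x s)))
        have e4 : 0 ≤ weight x ^ 4 * (f 2 x r - f 2 x s) ^ 2 := by positivity
        push_cast
        nlinarith [e2, e3, e4])
    simp only [sub_self, ne_eq, OfNat.ofNat_ne_zero, not_false_eq_true, zero_pow, mul_zero,
      intervalIntegral.integral_zero, zero_add] at hK
    refine hK.trans ?_
    rw [div_add' _ _ _ hθ.ne', div_mul_eq_mul_div]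
    have e1 : 512 * Real.pi ^ 7 * U ^ 2 * (s - s₀) ≤ 512 * Real.pi ^ 7 * U ^ 2 * 1 :=
      mul_le_mul_of_nonneg_left (by linarith [hst.trans hts]) (by positivity)
    have e2 : C₀ * U ^ 2 + 512 * Real.pi ^ 7 * U ^ 2 * (s - s₀) ≤
        (3 * C₀ + 512 * Real.pi ^ 7) * U ^ 2 := by
      have : 0 ≤ C₀ * U ^ 2 := by positivity
      nlinarith
    have e3 := sub_nonneg.mpr hst
    gcongr

/-- Two boundary strips of width δ contribute at most F²δ each. On the rest the weight is at least
δ(2π - δ) ≥ δ, so dropping its fourth power costs δ^{-4}. -/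
theorem integral_sq_le_of_weighted {g : ℝ → ℝ} {F Q δ : ℝ} (hg : ContinuousOn g Dom)
    (hF : ∀ x ∈ Dom, |g x| ≤ F)
    (hQ : ∫ x in (0 : ℝ)..2 * Real.pi, weight x ^ 4 * g x ^ 2 ≤ Q) (hδ : 0 < δ) (hδ1 : δ ≤ 1) :
    ∫ x in (0 : ℝ)..2 * Real.pi, g x ^ 2 ≤ 2 * F ^ 2 * δ + Q / δ ^ 4 := by
  have hpi := Real.pi_gt_three
  have hwc := continuous_weight
  have hsub : ∀ a b, 0 ≤ a → a ≤ b → b ≤ 2 * Real.pi → Set.Icc a b ⊆ Dom := fun a b h1 _ h3 =>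
    Set.Icc_subset_Icc h1 h3
  have hF2 : ∀ x ∈ Dom, g x ^ 2 ≤ F ^ 2 := fun x hx =>
    sq_le_sq' (abs_le.mp (hF x hx)).1 (abs_le.mp (hF x hx)).2
  have hint : ∀ f : ℝ → ℝ, ContinuousOn f Dom → ∀ a b, 0 ≤ a → a ≤ b → b ≤ 2 * Real.pi →
      IntervalIntegrable f volume a b := fun f hf a b h1 h2 h3 =>
    ContinuousOn.intervalIntegrable (by rw [Set.uIcc_of_le h2]; exact hf.mono (hsub a b h1 h2 h3))
  have hg2 : ContinuousOn (fun x => g x ^ 2) Dom := hg.pow 2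
  have hwg : ContinuousOn (fun x => weight x ^ 4 * g x ^ 2) Dom := by fun_prop
  have h1 : ∀ a b, 0 ≤ a → a ≤ b → b ≤ 2 * Real.pi → ∫ x in a..b, g x ^ 2 ≤ F ^ 2 * (b - a) :=
    fun a b ha hab hb => by
      have := intervalIntegral.integral_mono_on hab (hint _ hg2 a b ha hab hb)
        (intervalIntegrable_const (c := F ^ 2)) fun x hx => hF2 x (hsub a b ha hab hb hx)
      rwa [intervalIntegral.integral_const, smul_eq_mul, mul_comm] at this
  have h2 : ∫ x in δ..(2 * Real.pi - δ), g x ^ 2 ≤ Q / δ ^ 4 := by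
    rw [le_div_iff₀ (by positivity), mul_comm, ← intervalIntegral.integral_const_mul]
    refine le_trans ?_ hQ
    have e1 : ∫ x in δ..(2 * Real.pi - δ), δ ^ 4 * g x ^ 2 ≤
        ∫ x in δ..(2 * Real.pi - δ), weight x ^ 4 * g x ^ 2 := by
      refine intervalIntegral.integral_mono_on (by linarith)
        ((hint _ hg2 _ _ hδ.le (by linarith) (by linarith)).const_mul _)
        (hint _ hwg _ _ hδ.le (by linarith) (by linarith)) fun x hx => ?_
      have : δ ≤ weight x := by
        unfold weight
        nlinarith [hx.1, hx.2, mul_nonneg (sub_nonneg.mpr hx.1) (sub_nonneg.mpr hx.2)]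
      gcongr
    refine e1.trans ?_
    refine intervalIntegral.integral_mono_interval hδ.le (by linarith) (by linarith) ?_
      (intervalIntegrable_Dom hwg)
    exact Filter.Eventually.of_forall fun x => by simp only [Pi.zero_apply]; positivity
  have h3 := intervalIntegral.integral_add_adjacent_intervals
    (hint _ hg2 0 δ le_rfl hδ.le (by linarith))
    (hint _ hg2 δ (2 * Real.pi - δ) hδ.le (by linarith) (by linarith))
  have h4 := intervalIntegral.integral_add_adjacent_intervals
    (hint _ hg2 0 (2 * Real.pi - δ) le_rfl (by linarith) (by linarith))
    (hint _ hg2 (2 * Real.pi - δ) (2 * Real.pi) (by linarith) (by linarith) le_rfl)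
  have h5 := h1 0 δ le_rfl hδ.le (by linarith)
  have h6 := h1 (2 * Real.pi - δ) (2 * Real.pi) (by linarith) (by linarith) le_rfl
  nlinarith

/-- Approximation of the second space derivative by smooth solutions. -/
theorem HeatRegular.exists_smooth_approx {v : ℕ → ℝ → ℝ → ℝ} (h : HeatRegular 2 s₀ s₁ U v)
    (hU : 0 ≤ U) {ε : ℝ} (hε : 0 < ε) (hε1 : ε ≤ 1) :
    ∃ (V : ℝ) (f : ℕ → ℝ → ℝ → ℝ), HeatRegular 4 (s₀ + 2 * ε) s₁ V f ∧
      (∀ s ∈ Set.Icc (s₀ + 2 * ε) s₁, ∀ x ∈ Dom, |f 1 x s| ≤ U) ∧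
      ∀ s ∈ Set.Icc (s₀ + 2 * ε) s₁, ∀ x ∈ Dom,
        |f 0 x s - v 2 x s| ≤ 4 * U * Real.sqrt (2 * ε) := by
  have h1 := h.steklov hU hε hε1
  -- Orders 2, 3, 4 of the first average form a regularized copy of v 2, v 3, v 4 with only two
  -- derivatives; averaging once more restores four. Each average looks back by ε, hence the shift
  -- 2ε.
  have h2 := (HeatRegular.shift (p := 2) 2 h1).steklov (by positivity) hε hε1
  rw [add_assoc, ← two_mul] at h2
  have avg_le : ∀ (f : ℝ → ℝ) (s B : ℝ), (∀ r ∈ Set.Icc (s - ε) s, |f r| ≤ B) →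
      |(∫ r in (s - ε)..s, f r) / ε| ≤ B := fun f s B hB => by
    have h1 := intervalIntegral.norm_integral_le_of_norm_le_const (a := s - ε) (b := s) (f := f)
      (C := B) (fun r hr => by
        rw [Set.uIoc_of_le (by linarith)] at hr
        exact hB r (Set.Ioc_subset_Icc_self hr))
    rw [Real.norm_eq_abs, sub_sub_cancel, abs_of_pos hε] at h1
    rw [abs_div, abs_of_pos hε, div_le_iff₀ hε]
    exact h1
  refine ⟨_, _, h2, fun s hs x hx => avg_le _ _ _ fun r hr => ?_, fun s hs x hx => ?_⟩
  -- f 1 is the time average of the backward difference quotients of v 1, which are bounded by U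
  -- independently of ε.
  · have e1 := h.abs_time_diff_one_le (s := r - ε) (t := r) (by linarith [hs.1, hr.1])
      (by linarith) (hr.2.trans hs.2) hx
    rw [sub_sub_cancel] at e1
    change |(v 1 x r - v 1 x (r - ε)) / ε| ≤ U
    rwa [abs_div, abs_of_pos hε, div_le_iff₀ hε]
  · have hint : IntervalIntegrable (timeDiff ε (v 0) x) volume (s - ε) s :=
      ContinuousOn.intervalIntegrable (by
        rw [Set.uIcc_of_le (by linarith)]
        exact (h1.continuous_time 2 (by omega) x hx).mono
          (Set.Icc_subset_Icc (by linarith [hs.1]) hs.2))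
    have e1 : LDG.steklov ε (fun i => LDG.steklov ε v (i + 2)) 0 x s - v 2 x s =
        (∫ r in (s - ε)..s, (timeDiff ε (v 0) x r - v 2 x s)) / ε := by
      change (∫ r in (s - ε)..s, timeDiff ε (v 0) x r) / ε - v 2 x s = _
      rw [intervalIntegral.integral_sub hint intervalIntegrable_const,
        intervalIntegral.integral_const, sub_sub_cancel, smul_eq_mul]
      field_simp
    rw [e1]
    refine avg_le _ _ _ fun r hr => ?_
    have hsub : Set.Icc (r - ε) r ⊆ Set.Icc s₀ s₁ :=
      Set.Icc_subset_Icc (by linarith [hs.1, hr.1]) (hr.2.trans hs.2)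
    have e2 := (convex_Icc (r - ε) r).norm_image_sub_le_of_norm_hasDerivWithin_le
      (f := fun ρ => v 0 x ρ - v 2 x s * ρ) (f' := fun ρ => v 2 x ρ - v 2 x s * 1)
      (C := 4 * U * Real.sqrt (2 * ε))
      (fun ρ hρ => ((h.deriv_time 0 le_rfl x hx ρ (hsub hρ)).mono hsub).sub
        (((hasDerivAt_id ρ).hasDerivWithinAt).const_mul _))
      (fun ρ hρ => by
        rw [mul_one, Real.norm_eq_abs, abs_sub_comm]
        refine (h.abs_time_diff_two_le (hsub hρ).1 (hρ.2.trans hr.2) hs.2 hx).trans ?_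
        gcongr
        linarith [hρ.1, hr.1])
      (Set.left_mem_Icc.mpr (by linarith)) (Set.right_mem_Icc.mpr (by linarith))
    rw [Real.norm_eq_abs, Real.norm_eq_abs, sub_sub_cancel, abs_of_pos hε] at e2
    rw [timeDiff, div_sub' hε.ne', abs_div, abs_of_pos hε, div_le_iff₀ hε]
    refine le_trans (le_of_eq ?_) e2
    congr 1; ring

end LDG
end

noncomputable section

namespace LDG

/-! ## Sums over the cells of a mesh -/

theorem sum_succ_sub_castSucc {N : ℕ} (F : Fin (N + 1) → ℝ) :
    ∑ j : Fin N, (F j.succ - F j.castSucc) = F (Fin.last N) - F 0 := by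
  induction N with
  | zero => simp
  | succ n ih =>
    rw [Fin.sum_univ_castSucc]
    have := ih fun i => F i.castSucc
    simp only [Fin.succ_castSucc, Fin.succ_last, Fin.castSucc_zero] at this ⊢
    rw [this]; ring

section Mesh

variable {N : ℕ} (M : Mesh N)

theorem Mesh.left_lt_right (j : Fin N) : M.left j < M.right j :=
  M.strictMono Fin.castSucc_lt_succ

theorem Mesh.cellSize_pos (j : Fin N) : 0 < M.cellSize j := sub_pos.mpr (M.left_lt_right j)

theorem Mesh.node_mem_Dom (i : Fin (N + 1)) : M.node i ∈ Dom :=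
  ⟨M.node_zero ▸ M.strictMono.monotone (Fin.zero_le i),
    M.node_last ▸ M.strictMono.monotone (Fin.le_last i)⟩

theorem Mesh.left_mem_Dom (j : Fin N) : M.left j ∈ Dom := M.node_mem_Dom _

theorem Mesh.right_mem_Dom (j : Fin N) : M.right j ∈ Dom := M.node_mem_Dom _

theorem Mesh.cell_subset_Dom (j : Fin N) : Set.Icc (M.left j) (M.right j) ⊆ Dom :=
  Set.Icc_subset_Icc (M.left_mem_Dom j).1 (M.right_mem_Dom j).2

theorem Mesh.sum_cellSize : ∑ j, M.cellSize j = 2 * Real.pi := by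
  have := sum_succ_sub_castSucc M.node
  rwa [M.node_last, M.node_zero, sub_zero] at this

theorem Mesh.sum_integral {f : ℝ → ℝ} (hf : ContinuousOn f Dom) :
    ∑ j, ∫ x in M.left j..M.right j, f x = ∫ x in (0 : ℝ)..2 * Real.pi, f x := by
  have hi : ∀ i, IntervalIntegrable f volume 0 (M.node i) := fun i =>
    ContinuousOn.intervalIntegrable (by
      rw [Set.uIcc_of_le (M.node_mem_Dom i).1]
      exact hf.mono (Set.Icc_subset_Icc_right (M.node_mem_Dom i).2))
  have := sum_succ_sub_castSucc fun i => ∫ x in (0 : ℝ)..M.node i, f x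
  rw [M.node_last, M.node_zero, intervalIntegral.integral_same, sub_zero] at this
  rw [← this]
  exact Finset.sum_congr rfl fun j _ =>
    (intervalIntegral.integral_interval_sub_left (hi _) (hi _)).symm

theorem Mesh.cellSize_le_size (j : Fin N) : M.cellSize j ≤ M.size :=
  le_ciSup (Set.finite_range M.cellSize).bddAbove j

/-- Cauchy–Schwarz, by expanding the integral of ((b-a) f - ∫ f)². -/
theorem sq_intervalIntegral_le {f : ℝ → ℝ} {a b : ℝ} (hab : a ≤ b)
    (hf : ContinuousOn f (Set.Icc a b)) :
    (∫ x in a..b, f x) ^ 2 ≤ (b - a) * ∫ x in a..b, f x ^ 2 := by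
  have hf1 : IntervalIntegrable f volume a b :=
    ContinuousOn.intervalIntegrable (by rwa [Set.uIcc_of_le hab])
  have hf2 : IntervalIntegrable (fun x => f x ^ 2) volume a b :=
    ContinuousOn.intervalIntegrable (by rw [Set.uIcc_of_le hab]; exact hf.pow 2)
  rcases hab.eq_or_lt with rfl | hlt
  · simp
  set A := ∫ x in a..b, f x with hA
  have h0 : 0 ≤ ∫ x in a..b, ((b - a) * f x - A) ^ 2 :=
    intervalIntegral.integral_nonneg hab fun x _ => sq_nonneg _
  have e : ∫ x in a..b, ((b - a) * f x - A) ^ 2 =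
      (b - a) ^ 2 * (∫ x in a..b, f x ^ 2) - 2 * (b - a) * A * A + A ^ 2 * (b - a) := by
    have : (fun x => ((b - a) * f x - A) ^ 2) =
        fun x => (b - a) ^ 2 * f x ^ 2 - 2 * (b - a) * A * f x + A ^ 2 := by ext x; ring
    rw [this, intervalIntegral.integral_add ((hf2.const_mul _).sub (hf1.const_mul _))
      intervalIntegrable_const, intervalIntegral.integral_sub (hf2.const_mul _) (hf1.const_mul _),
      intervalIntegral.integral_const_mul, intervalIntegral.integral_const_mul,
      intervalIntegral.integral_const, smul_eq_mul, ← hA]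
    ring
  rw [e] at h0
  have hpos : 0 < b - a := sub_pos.mpr hlt
  have : 0 ≤ (b - a) * ((b - a) * (∫ x in a..b, f x ^ 2) - A ^ 2) := by nlinarith
  linarith [nonneg_of_mul_nonneg_right this hpos]

theorem sq_sub_le_integral_of_deriv {f f' : ℝ → ℝ} {a b x : ℝ} (hx : x ∈ Set.Icc a b)
    (hf' : ContinuousOn f' (Set.Icc a b))
    (h : ∀ y ∈ Set.Icc a b, HasDerivWithinAt f (f' y) (Set.Icc a b) y) :
    (f x - f a) ^ 2 ≤ (b - a) * ∫ y in a..b, f' y ^ 2 := by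
  have hsub : Set.Icc a x ⊆ Set.Icc a b := Set.Icc_subset_Icc_right hx.2
  have h2 : IntervalIntegrable (fun x => f' x ^ 2) volume a b :=
    ContinuousOn.intervalIntegrable (by rw [Set.uIcc_of_le (hx.1.trans hx.2)]; exact hf'.pow 2)
  rw [← integral_eq_sub_of_hasDerivWithinAt_Icc hx.1 (hf'.mono hsub) fun r hr =>
    (h r (hsub hr)).mono hsub]
  refine (sq_intervalIntegral_le hx.1 (hf'.mono hsub)).trans ?_
  have h3 : ∫ y in a..x, f' y ^ 2 ≤ ∫ y in a..b, f' y ^ 2 :=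
    intervalIntegral.integral_mono_interval le_rfl hx.1 hx.2
      (Filter.Eventually.of_forall fun x => by simp only [Pi.zero_apply]; positivity) h2
  exact mul_le_mul (by linarith [hx.2]) h3
    (intervalIntegral.integral_nonneg hx.1 fun _ _ => sq_nonneg _) (by linarith [hx.1, hx.2])

end Mesh

/-! ## Time increments of the second space derivative -/

/-- The gain ρ over the bounds available without smoothing. For smooth approximations f of v 2, the
weighted increments are small by the factor (t-s)/(s-s₀) ≤ ρ⁸, and strips of width ρ leave ρ⁸/ρ⁴ +
ρ. In the second estimate v 2 has no derivative, so its oscillation on a cell is compared with that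
of f, whose derivative f 1 is controlled in L². Division by the cell size turns Cauchy–Schwarz on
each cell into an integral over the domain. -/
theorem exists_increment_bound : ∃ C : ℝ, 0 < C ∧ ∀ (s₀ s₁ U : ℝ) (v : ℕ → ℝ → ℝ → ℝ), 0 ≤ U →
    HeatRegular 2 s₀ s₁ U v → s₁ ≤ s₀ + 1 → ∀ s t ρ, s₀ < s → s ≤ t → t ≤ s₁ → 0 < ρ → ρ ≤ 1 →
    t - s ≤ ρ ^ 8 * (s - s₀) →
    ∫ x in (0 : ℝ)..2 * Real.pi, (v 2 x t - v 2 x s) ^ 2 ≤ C * U ^ 2 * (t - s) * ρ ∧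
    ∀ (N : ℕ) (M : Mesh N) (x : Fin N → ℝ), (∀ j, x j ∈ Set.Icc (M.left j) (M.right j)) →
      ∑ j, ((v 2 (x j) t - v 2 (x j) s) - (v 2 (M.left j) t - v 2 (M.left j) s)) ^ 2 /
        M.cellSize j ≤ C * U ^ 2 * ρ := by
  obtain ⟨C, hC, hinc⟩ := exists_weighted_increment_bound
  have hpi := Real.pi_pos
  refine ⟨32 + 4 * C + 128 * Real.pi ^ 9 + (18 + 4 * C), by positivity, ?_⟩
  intro s₀ s₁ U v hU h hlen s t ρ hs0 hst hts hρ hρ1 hq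
  rcases hst.eq_or_lt with rfl | hlt
  · simp only [sub_self, ne_eq, OfNat.ofNat_ne_zero, not_false_eq_true, zero_pow, mul_zero,
      intervalIntegral.integral_zero, zero_mul, le_refl, zero_div, Finset.sum_const_zero, true_and]
    intros; positivity
  set τ := t - s with hτ
  have hτ0 : 0 < τ := sub_pos.mpr hlt
  have hρ8 : ρ ^ 8 ≤ 1 := pow_le_one₀ hρ.le hρ1
  have hρ4 : ρ ^ 4 ≤ ρ := by
    have := pow_le_pow_of_le_one hρ.le hρ1 (show 1 ≤ 4 by norm_num)
    rwa [pow_one] at this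
  have hθ : 0 < s - s₀ := sub_pos.mpr hs0
  have hτθ : τ ≤ s - s₀ := hq.trans (by nlinarith)
  have hτ1 : τ ≤ 1 := by linarith
  have hsm : s ∈ Set.Icc s₀ s₁ := ⟨hs0.le, hst.trans hts⟩
  have htm : t ∈ Set.Icc s₀ s₁ := ⟨hs0.le.trans hst, hts⟩
  have hYc : ContinuousOn (fun x => v 2 x t - v 2 x s) Dom :=
    (h.continuous_space le_rfl htm).sub (h.continuous_space le_rfl hsm)
  have key : ∀ ε, 0 < ε → ε ≤ τ * ρ ^ 8 / 4 → ∃ f : ℕ → ℝ → ℝ → ℝ,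
      (∀ r ∈ Set.Icc s t, ∀ i ≤ 1, ContinuousOn (fun x => f i x r) Dom) ∧
      (∀ r ∈ Set.Icc s t, ∀ x ∈ Dom, HasDerivWithinAt (fun x => f 0 x r) (f 1 x r) Dom x) ∧
      (∀ r ∈ Set.Icc s t, ∀ x ∈ Dom, |f 1 x r| ≤ U) ∧
      (∀ r ∈ Set.Icc s t, ∀ x ∈ Dom, |f 0 x r - v 2 x r| ≤ 4 * U * Real.sqrt (2 * ε)) ∧
      ∫ x in (0 : ℝ)..2 * Real.pi, weight x ^ 4 * (f 0 x t - f 0 x s) ^ 2 ≤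
        2 * C * U ^ 2 * τ * ρ ^ 8 ∧
      ∫ x in (0 : ℝ)..2 * Real.pi, weight x ^ 4 * (f 1 x t - f 1 x s) ^ 2 ≤
        2 * C * U ^ 2 * ρ ^ 8 := by
    intro ε hε hε'
    have e1 : ε ≤ (s - s₀) / 4 := by nlinarith
    obtain ⟨V, f, hf, hf1, hf2⟩ := h.exists_smooth_approx hU hε (by linarith)
    obtain ⟨i0, i1⟩ := hinc (s₀ + 2 * ε) s₁ U V f hf hf1 (by linarith) s t (by linarith) hst hts
    have hsub : Set.Icc s t ⊆ Set.Icc (s₀ + 2 * ε) s₁ := Set.Icc_subset_Icc (by linarith) hts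
    have e2 : τ / (s - (s₀ + 2 * ε)) ≤ 2 * ρ ^ 8 := by
      rw [div_le_iff₀ (by linarith)]
      have : 0 < ρ ^ 8 := by positivity
      nlinarith
    refine ⟨f, fun r hr i hi => hf.continuous_space (by omega) (hsub hr),
      fun r hr => hf.deriv_space 0 (by omega) r (hsub hr), fun r hr => hf1 r (hsub hr),
      fun r hr => hf2 r (hsub hr), i0.trans ?_, i1.trans ?_⟩
    · calc C * U ^ 2 * τ ^ 2 / (s - (s₀ + 2 * ε)) =
          C * U ^ 2 * τ * (τ / (s - (s₀ + 2 * ε))) := by ring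
        _ ≤ C * U ^ 2 * τ * (2 * ρ ^ 8) := by gcongr
        _ = _ := by ring
    · calc C * U ^ 2 * τ / (s - (s₀ + 2 * ε)) =
          C * U ^ 2 * (τ / (s - (s₀ + 2 * ε))) := by ring
        _ ≤ C * U ^ 2 * (2 * ρ ^ 8) := by gcongr
        _ = _ := by ring
  have htt : t ∈ Set.Icc s t := ⟨hst, le_rfl⟩
  have hss : s ∈ Set.Icc s t := ⟨le_rfl, hst⟩
  have happrox : ∀ (f : ℕ → ℝ → ℝ → ℝ) (ε : ℝ), 0 < ε → (∀ r ∈ Set.Icc s t, ∀ x ∈ Dom,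
      |f 0 x r - v 2 x r| ≤ 4 * U * Real.sqrt (2 * ε)) → ∀ x ∈ Dom,
      |(v 2 x t - v 2 x s) - (f 0 x t - f 0 x s)| ≤ 8 * U * Real.sqrt (2 * ε) := by
    intro f ε hε hf x hx
    have e1 := abs_le.mp (hf t htt x hx)
    have e2 := abs_le.mp (hf s hss x hx)
    exact abs_le.mpr ⟨by linarith, by linarith⟩
  have hsq : ∀ ε : ℝ, 0 < ε → (8 * U * Real.sqrt (2 * ε)) ^ 2 = 128 * U ^ 2 * ε := fun ε hε => by
    rw [mul_pow, Real.sq_sqrt (by positivity)]; ring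
  have hrw : ∀ A, A * ρ ^ 8 / ρ ^ 4 = A * ρ ^ 4 := fun A => by field_simp
  have hfin1 : 0 ≤ C * U ^ 2 * ρ := by positivity
  have hfin2 : 0 ≤ U ^ 2 * ρ := by positivity
  have hfin3 : 0 ≤ Real.pi ^ 9 * U ^ 2 * ρ := by positivity
  constructor
  · have hε : 0 < τ * ρ ^ 8 / 4 := by positivity
    obtain ⟨f, hfc, -, -, hf2, hi, -⟩ := key _ hε le_rfl
    have hYf := happrox f _ hε hf2
    have hf0 : ContinuousOn (fun x => f 0 x t - f 0 x s) Dom :=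
      (hfc t htt 0 (by omega)).sub (hfc s hss 0 (by omega))
    have hwc := continuous_weight
    have hQ : ∫ x in (0 : ℝ)..2 * Real.pi, weight x ^ 4 * (v 2 x t - v 2 x s) ^ 2 ≤
        (4 * C + 128 * Real.pi ^ 9) * U ^ 2 * τ * ρ ^ 8 := by
      have hle : ∫ x in (0 : ℝ)..2 * Real.pi, weight x ^ 4 * (v 2 x t - v 2 x s) ^ 2 ≤
          ∫ x in (0 : ℝ)..2 * Real.pi, (2 * (weight x ^ 4 * (f 0 x t - f 0 x s) ^ 2) +
            64 * Real.pi ^ 8 * U ^ 2 * (τ * ρ ^ 8)) := by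
        refine integral_Dom_mono ((hwc.pow 4).continuousOn.mul (hYc.pow 2))
          ((((hwc.pow 4).continuousOn.mul (hf0.pow 2)).const_mul 2).add continuousOn_const)
          fun x hx => ?_
        have e1 := sq_le_sq' (abs_le.mp (hYf x hx)).1 (abs_le.mp (hYf x hx)).2
        rw [hsq _ hε] at e1
        have e2 : weight x ^ 4 ≤ Real.pi ^ 8 := by
          have := pow_le_pow_left₀ (sq_nonneg _) (weight_sq_le hx) 2
          rwa [← pow_mul, ← pow_mul] at this
        have e3 : (v 2 x t - v 2 x s) ^ 2 ≤ 2 * (f 0 x t - f 0 x s) ^ 2 +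
            2 * (128 * U ^ 2 * (τ * ρ ^ 8 / 4)) := by
          nlinarith [sq_nonneg ((v 2 x t - v 2 x s) - 2 * (f 0 x t - f 0 x s))]
        have e4 : 0 ≤ weight x ^ 4 := by positivity
        have e5 : weight x ^ 4 * (2 * (128 * U ^ 2 * (τ * ρ ^ 8 / 4))) ≤
            Real.pi ^ 8 * (2 * (128 * U ^ 2 * (τ * ρ ^ 8 / 4))) :=
          mul_le_mul_of_nonneg_right e2 (by positivity)
        have e6 := mul_le_mul_of_nonneg_left e3 e4
        linarith
      refine hle.trans ?_
      have hi0 : IntervalIntegrable (fun x => 2 * (weight x ^ 4 * (f 0 x t - f 0 x s) ^ 2)) volume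
          0 (2 * Real.pi) :=
        intervalIntegrable_Dom (((hwc.pow 4).continuousOn.mul (hf0.pow 2)).const_mul 2)
      rw [intervalIntegral.integral_add hi0 intervalIntegrable_const,
        intervalIntegral.integral_const_mul, intervalIntegral.integral_const, smul_eq_mul]
      linarith
    -- On the strips the Hölder bound of exponent 1/2 is used, so that the factor t - s is present
    -- there too.
    have h1 := integral_sq_le_of_weighted hYc (F := 4 * U * Real.sqrt τ)
      (fun x hx => h.abs_time_diff_two_le hs0.le hst hts hx) hQ hρ hρ1
    rw [hrw, mul_pow, Real.sq_sqrt hτ0.le] at h1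
    refine h1.trans ?_
    have e1 : (4 * C + 128 * Real.pi ^ 9) * U ^ 2 * τ * ρ ^ 4 ≤
        (4 * C + 128 * Real.pi ^ 9) * U ^ 2 * τ * ρ := by gcongr
    have e2 := mul_nonneg hfin1 hτ0.le
    have e3 := mul_nonneg hfin2 hτ0.le
    have e4 := mul_nonneg hfin3 hτ0.le
    nlinarith
  · intro N M x hx
    set R := ∑ j, 1 / M.cellSize j with hR
    -- The approximation error is divided by the cell sizes. Since ε does not occur in the
    -- conclusion, it may be chosen depending on the mesh, so that εR is negligible.
    have hR0 : 0 ≤ R := Finset.sum_nonneg fun j _ => by have := M.cellSize_pos j; positivity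
    set ε := min (τ * ρ ^ 8 / 4) (ρ / (1024 * (R + 1))) with hεdef
    have hε : 0 < ε := lt_min (by positivity) (by positivity)
    obtain ⟨f, hfc, hfd, hf1, hf2, -, hi⟩ := key ε hε (min_le_left _ _)
    have hεR : ε * R ≤ ρ / 1024 := by
      have : ε ≤ ρ / (1024 * (R + 1)) := min_le_right _ _
      rw [le_div_iff₀ (by positivity)] at this
      nlinarith
    have hYf := happrox f _ hε hf2
    have hGc : ContinuousOn (fun x => f 1 x t - f 1 x s) Dom :=
      (hfc t htt 1 le_rfl).sub (hfc s hss 1 le_rfl)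
    have hG := integral_sq_le_of_weighted hGc (F := 2 * U) (fun x hx => by
      have e1 := abs_le.mp (hf1 t htt x hx)
      have e2 := abs_le.mp (hf1 s hss x hx)
      exact abs_le.mpr ⟨by linarith, by linarith⟩) hi hρ hρ1
    rw [hrw] at hG
    have hterm : ∀ j, ((v 2 (x j) t - v 2 (x j) s) - (v 2 (M.left j) t - v 2 (M.left j) s)) ^ 2 /
        M.cellSize j ≤ 2 * (∫ y in M.left j..M.right j, (f 1 y t - f 1 y s) ^ 2) +
          1024 * U ^ 2 * ε * (1 / M.cellSize j) := fun j => by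
      have hc := M.cellSize_pos j
      have e1 := hYf _ (M.cell_subset_Dom j (hx j))
      have e2 := hYf _ (M.left_mem_Dom j)
      have e3 := sq_sub_le_integral_of_deriv (f := fun x => f 0 x t - f 0 x s) (hx j)
        (hGc.mono (M.cell_subset_Dom j)) fun y hy =>
          (((hfd t htt y (M.cell_subset_Dom j hy)).sub (hfd s hss y (M.cell_subset_Dom j hy))).mono
            (M.cell_subset_Dom j))
      change _ ≤ M.cellSize j * _ at e3
      have hs' := hsq ε hε
      set B := 8 * U * Real.sqrt (2 * ε)
      set I := ∫ y in M.left j..M.right j, (f 1 y t - f 1 y s) ^ 2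
      set X := (v 2 (x j) t - v 2 (x j) s) - (v 2 (M.left j) t - v 2 (M.left j) s)
      set Z := (f 0 (x j) t - f 0 (x j) s) - (f 0 (M.left j) t - f 0 (M.left j) s)
      have e4 : |X - Z| ≤ 2 * B := by
        have e1' := abs_le.mp e1
        have e2' := abs_le.mp e2
        exact abs_le.mpr ⟨by simp only [X, Z]; linarith, by simp only [X, Z]; linarith⟩
      have e5 := sq_le_sq' (abs_le.mp e4).1 (abs_le.mp e4).2
      clear_value X Z B I
      have e6 : X ^ 2 ≤ 2 * Z ^ 2 + 8 * B ^ 2 := by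
        have : 2 * Z ^ 2 + 2 * (X - Z) ^ 2 - X ^ 2 = (X - 2 * Z) ^ 2 := by ring
        linarith [sq_nonneg (X - 2 * Z), mul_pow 2 B 2]
      rw [div_le_iff₀ hc, add_mul, mul_assoc _ (1 / _), one_div_mul_cancel hc.ne']
      linarith
    refine (Finset.sum_le_sum fun j _ => hterm j).trans ?_
    rw [Finset.sum_add_distrib, ← Finset.mul_sum, ← Finset.mul_sum, ← hR,
      M.sum_integral (f := fun x => (f 1 x t - f 1 x s) ^ 2) (hGc.pow 2)]
    have e1 : 2 * C * U ^ 2 * ρ ^ 4 ≤ 2 * C * U ^ 2 * ρ := by gcongr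
    have e2 : 1024 * U ^ 2 * (ε * R) ≤ 1024 * U ^ 2 * (ρ / 1024) := by gcongr
    nlinarith

/-- Time increments of the second space derivative, for increments of any length. -/
theorem exists_global_increment_bound : ∃ C : ℝ, 0 < C ∧ ∀ (t U : ℝ) (v : ℕ → ℝ → ℝ → ℝ),
    0 ≤ U → 0 < t → HeatRegular 2 0 t U v → ∀ s ∈ Set.Icc 0 t,
    ∫ x in (0 : ℝ)..2 * Real.pi, (v 2 x t - v 2 x s) ^ 2 ≤
      C * U ^ 2 * (t - s) * (2 * (t - s) / min t 1) ^ (1 / 8 : ℝ) ∧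
    ∀ (N : ℕ) (M : Mesh N) (x : Fin N → ℝ), (∀ j, x j ∈ Set.Icc (M.left j) (M.right j)) →
      ∑ j, ((v 2 (x j) t - v 2 (x j) s) - (v 2 (M.left j) t - v 2 (M.left j) s)) ^ 2 /
        M.cellSize j ≤ C * U ^ 2 * (2 * (t - s) / min t 1) ^ (1 / 8 : ℝ) := by
  obtain ⟨C, hC, hinc⟩ := exists_increment_bound
  have hpi := Real.pi_pos
  refine ⟨C + 32 * Real.pi, by positivity, ?_⟩
  intro t U v hU ht h s hs
  set m := min t 1 with hm
  have hm0 : 0 < m := lt_min ht one_pos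
  have hmt : m ≤ t := min_le_left _ _
  have hm1 : m ≤ 1 := min_le_right _ _
  -- Chosen so that ρ⁸ times m/2 equals t - s, where m/2 is the least elapsed time in the
  -- short-increment case below.
  set ρ := (2 * (t - s) / m) ^ (1 / 8 : ℝ) with hρ
  have hq0 : 0 ≤ 2 * (t - s) / m := div_nonneg (by linarith [hs.2]) hm0.le
  have hρ0 : 0 ≤ ρ := Real.rpow_nonneg hq0 _
  have hρ8 : ρ ^ 8 = 2 * (t - s) / m := by
    rw [hρ, ← Real.rpow_natCast, ← Real.rpow_mul hq0]; norm_num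
  have hsm : s ∈ Set.Icc 0 t := hs
  have htm : t ∈ Set.Icc 0 t := ⟨ht.le, le_rfl⟩
  rcases hs.2.eq_or_lt with rfl | hlt
  · simp only [sub_self, ne_eq, OfNat.ofNat_ne_zero, not_false_eq_true, zero_pow, mul_zero,
      intervalIntegral.integral_zero, zero_mul, le_refl, zero_div, Finset.sum_const_zero, true_and]
    intros; positivity
  have hτ0 : 0 < t - s := sub_pos.mpr hlt
  have hτC : 0 ≤ C * U ^ 2 * ρ := by positivity
  have hτU : 0 ≤ U ^ 2 * ρ := by positivity
  rcases le_or_gt (t - s) (m / 2) with hle | hgt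
  · have hρ1 : ρ ≤ 1 := Real.rpow_le_one hq0 ((div_le_one hm0).mpr (by linarith)) (by norm_num)
    have hρpos : 0 < ρ := Real.rpow_pos_of_pos (by positivity) _
    -- Starting at t - m gives a window of length at most 1 in which at least m/2 has elapsed before
    -- s.
    obtain ⟨h1, h2⟩ := hinc (t - m) t U v hU (h.mono (by linarith) le_rfl) (by linarith) s t ρ
      (by linarith) hs.2 le_rfl hρpos hρ1 (by
        rw [hρ8, div_mul_eq_mul_div, le_div_iff₀ hm0]
        nlinarith)
    refine ⟨h1.trans ?_, fun N M x hx => (h2 N M x hx).trans ?_⟩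
    · have := mul_nonneg hτU hτ0.le
      nlinarith
    · nlinarith
  -- For long increments ρ ≥ 1, and the bounds without smoothing suffice.
  · have hρ1 : 1 ≤ ρ := Real.one_le_rpow ((one_le_div hm0).mpr (by linarith)) (by norm_num)
    have hUρ : U ^ 2 ≤ U ^ 2 * ρ := le_mul_of_one_le_right (sq_nonneg _) hρ1
    constructor
    · have h1 := integral_Dom_le_const (B := 16 * U ^ 2 * (t - s))
        (((h.continuous_space le_rfl htm).sub (h.continuous_space le_rfl hsm)).pow 2)
        fun x hx => by
          have e1 := abs_le.mp (h.abs_time_diff_two_le hs.1 hs.2 le_rfl hx)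
          refine (sq_le_sq' e1.1 e1.2).trans (le_of_eq ?_)
          rw [mul_pow, Real.sq_sqrt hτ0.le]; ring
      refine h1.trans ?_
      have e1 := mul_nonneg hτC hτ0.le
      have e2 : 32 * Real.pi * (t - s) * U ^ 2 ≤ 32 * Real.pi * (t - s) * (U ^ 2 * ρ) := by gcongr
      nlinarith
    · intro N M x hx
      have hterm : ∀ j, ((v 2 (x j) t - v 2 (x j) s) -
          (v 2 (M.left j) t - v 2 (M.left j) s)) ^ 2 / M.cellSize j ≤
          4 * U ^ 2 * M.cellSize j := fun j => by
        have hc := M.cellSize_pos j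
        have l1 := h.lipschitz 2 le_rfl t htm _ (M.cell_subset_Dom j (hx j)) _ (M.left_mem_Dom j)
        have l2 := h.lipschitz 2 le_rfl s hsm _ (M.cell_subset_Dom j (hx j)) _ (M.left_mem_Dom j)
        have hxl : |x j - M.left j| ≤ M.cellSize j := by
          rw [abs_of_nonneg (sub_nonneg.mpr (hx j).1)]
          exact sub_le_sub_right (hx j).2 _
        have l3 := mul_le_mul_of_nonneg_left hxl hU
        have e1 := abs_le.mp (l1.trans l3)
        have e2 := abs_le.mp (l2.trans l3)
        rw [div_le_iff₀ hc]
        have : ((v 2 (x j) t - v 2 (x j) s) - (v 2 (M.left j) t - v 2 (M.left j) s)) ^ 2 ≤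
          (2 * (U * M.cellSize j)) ^ 2 := sq_le_sq' (by linarith) (by linarith)
        refine this.trans (le_of_eq ?_)
        ring
      refine (Finset.sum_le_sum fun j _ => hterm j).trans ?_
      rw [← Finset.mul_sum, M.sum_cellSize]
      nlinarith

end LDG
end

noncomputable section

namespace LDG

/-! ## Semigroups of nonnegative operators -/

section Semigroup

variable {V : Type*} [NormedAddCommGroup V] [InnerProductSpace ℝ V]

local notation "⟪" x ", " y "⟫" => inner ℝ x y

/-- The bound on the derivative may blow up at t, but it is integrable: F + (B/β)(t-s)^β is
nonincreasing, and continuity covers the end points. -/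
theorem le_of_hasDerivAt_le_rpow {F F' : ℝ → ℝ} {t B β : ℝ} (ht : 0 ≤ t) (hβ : 0 < β)
    (hc : ContinuousOn F (Set.Icc 0 t)) (hd : ∀ s ∈ Set.Ioo 0 t, HasDerivAt F (F' s) s)
    (hF : ∀ s ∈ Set.Ioo 0 t, F' s ≤ B * (t - s) ^ (β - 1)) : F t ≤ F 0 + B / β * t ^ β := by
  have hcr : Continuous fun s : ℝ => (t - s) ^ β :=
    (Real.continuous_rpow_const hβ.le).comp (continuous_const.sub continuous_id)
  have hd' : ∀ s ∈ Set.Ioo 0 t, HasDerivAt (fun s => F s + B / β * (t - s) ^ β)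
      (F' s + B / β * (-1 * β * (t - s) ^ (β - 1))) s := fun s hs =>
    (hd s hs).add ((((hasDerivAt_id' s).const_sub t).rpow_const
      (Or.inl (sub_pos.mpr hs.2).ne')).const_mul _)
  have h := antitoneOn_of_hasDerivWithinAt_nonpos (convex_Icc 0 t)
    (hc.add ((hcr.const_smul (B / β)).continuousOn))
    (f' := fun s => F' s + B / β * (-1 * β * (t - s) ^ (β - 1)))
    (fun s hs => (hd' s (by rwa [interior_Icc] at hs)).hasDerivWithinAt) (fun s hs => by
      have h1 := hF s (by rwa [interior_Icc] at hs)
      have : B / β * (-1 * β * (t - s) ^ (β - 1)) = -(B * (t - s) ^ (β - 1)) := by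
        field_simp
      rw [this]; linarith) (Set.left_mem_Icc.mpr ht) (Set.right_mem_Icc.mpr ht) ht
  simpa [Real.zero_rpow hβ.ne'] using h

/-- Smoothing bounds for the semigroup generated by a symmetric nonnegative operator. -/
theorem semigroup_energy_le {A : V →L[ℝ] V} (hsymm : ∀ x y, ⟪A x, y⟫ = ⟪x, A y⟫)
    {p : ℝ → V} (hp : ∀ τ, HasDerivAt p (-(A (p τ))) τ) {τ : ℝ} (hτ : 0 ≤ τ) :
    ‖p τ‖ ^ 2 + 2 * τ * ⟪A (p τ), p τ⟫ + 2 * τ ^ 2 * ‖A (p τ)‖ ^ 2 +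
      4 / 3 * τ ^ 3 * ⟪A (A (p τ)), A (p τ)⟫ ≤ ‖p 0‖ ^ 2 := by
  have h1 : ∀ τ, HasDerivAt (fun τ => A (p τ)) (-(A (A (p τ)))) τ := fun τ => by
    have := A.hasFDerivAt.comp_hasDerivAt τ (hp τ)
    rwa [map_neg] at this
  have h2 : ∀ τ, HasDerivAt (fun τ => A (A (p τ))) (-(A (A (A (p τ))))) τ := fun τ => by
    have := A.hasFDerivAt.comp_hasDerivAt τ (h1 τ)
    rwa [map_neg] at this
  set Λ : ℝ → ℝ := fun τ => ⟪p τ, p τ⟫ + 2 * τ * ⟪A (p τ), p τ⟫ + 2 * τ ^ 2 * ⟪A (p τ), A (p τ)⟫ +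
      4 / 3 * τ ^ 3 * ⟪A (A (p τ)), A (p τ)⟫ with hΛ
  -- The coefficients 1, 2, 2, 4/3 make each term produced by differentiating a power of τ cancel
  -- the dissipation of the preceding quantity; only the last dissipation remains.
  have hd : ∀ τ, HasDerivAt Λ (-(8 / 3 * τ ^ 3 * ⟪A (A (p τ)), A (A (p τ))⟫)) τ := fun τ => by
    have d0 := (hp τ).inner ℝ (hp τ)
    have d1 := ((hasDerivAt_id' τ).const_mul 2).mul ((h1 τ).inner ℝ (hp τ))
    have d2 := (((hasDerivAt_id' τ).pow 2).const_mul 2).mul ((h1 τ).inner ℝ (h1 τ))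
    have d3 := (((hasDerivAt_id' τ).pow 3).const_mul (4 / 3)).mul ((h2 τ).inner ℝ (h1 τ))
    refine (((d0.add d1).add d2).add d3).congr_deriv ?_
    simp only [inner_neg_left, inner_neg_right, real_inner_comm (A (p τ)) (p τ),
      real_inner_comm (A (A (p τ))) (A (p τ)), hsymm (A (A (p τ))) (A (p τ)),
      hsymm (A (p τ)) (p τ)]
    simp only [Pi.pow_apply]
    push_cast
    ring
  have hanti := antitoneOn_of_hasDerivWithinAt_nonpos (convex_Icc 0 τ) (f := Λ)
    (fun s _ => (hd s).continuousAt.continuousWithinAt)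
    (fun s _ => (hd s).hasDerivWithinAt) (fun s hs => by
      rw [interior_Icc] at hs
      have := real_inner_self_nonneg (x := A (A (p s)))
      have h3 : 0 ≤ s ^ 3 := pow_nonneg hs.1.le 3
      nlinarith [mul_nonneg h3 this]) (Set.left_mem_Icc.mpr hτ) (Set.right_mem_Icc.mpr hτ) hτ
  simpa [hΛ, real_inner_self_eq_norm_sq] using hanti

variable [CompleteSpace V]

theorem exists_hasDerivAt_neg_apply (A : V →L[ℝ] V) (φ : V) :
    ∃ p : ℝ → V, p 0 = φ ∧ ∀ τ, HasDerivAt p (-(A (p τ))) τ := by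
  refine ⟨fun τ => NormedSpace.exp (τ • (-A)) φ, by simp, fun τ => ?_⟩
  have h := (hasDerivAt_exp_smul_const' (𝕂 := ℝ) (-A) τ).clm_apply (hasDerivAt_const τ φ)
  simpa using h

variable {D : V →L[ℝ] V} {e σ r : ℝ → V} {t R S : ℝ}

open ContinuousLinearMap (adjoint)

theorem le_of_mul_sq_le {a x f : ℝ} (hf : 0 ≤ f) (ha : 0 < a)
    (h : x ^ 2 * a ^ 2 ≤ f ^ 2) : x ≤ f * a⁻¹ := by
  rw [← div_eq_mul_inv, le_div_iff₀ ha]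
  rw [← mul_pow] at h
  exact (abs_le.mp (abs_le_of_sq_le_sq h hf)).2

theorem rpow_half_pos_and_sq {τ : ℝ} (hτ : 0 < τ) :
    0 < τ ^ (1 / 2 : ℝ) ∧ (τ ^ (1 / 2 : ℝ)) ^ 2 = τ :=
  ⟨Real.rpow_pos_of_pos hτ _, by rw [← Real.rpow_natCast, ← Real.rpow_mul hτ.le]; norm_num⟩

/-- The semigroup generated by `-B* B` and its smoothing properties. -/
theorem exists_smoothing_semigroup (B : V →L[ℝ] V) (φ : V) : ∃ p : ℝ → V, p 0 = φ ∧
    (∀ τ, HasDerivAt p (-(adjoint B (B (p τ)))) τ) ∧ (∀ τ, 0 ≤ τ → ‖p τ‖ ≤ ‖φ‖) ∧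
    (∀ τ, 0 < τ → ‖B (p τ)‖ ≤ ‖φ‖ * (τ ^ (1 / 2 : ℝ))⁻¹) ∧
    (∀ τ, 0 < τ → ‖adjoint B (B (p τ))‖ ≤ ‖φ‖ * τ⁻¹) ∧
    ∀ τ, 0 < τ → ‖B (adjoint B (B (p τ)))‖ ≤ ‖φ‖ * (τ * τ ^ (1 / 2 : ℝ))⁻¹ := by
  obtain ⟨p, hp0, hp⟩ := exists_hasDerivAt_neg_apply (adjoint B ∘L B) φ
  have hen := fun τ (hτ : 0 ≤ τ) => semigroup_energy_le (A := adjoint B ∘L B) (fun x y => by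
    simp [ContinuousLinearMap.adjoint_inner_left, ContinuousLinearMap.adjoint_inner_right]) hp hτ
  simp only [ContinuousLinearMap.comp_apply, ContinuousLinearMap.adjoint_inner_left, hp0,
    real_inner_self_eq_norm_sq] at hen hp
  have hrp := @rpow_half_pos_and_sq
  have hb0 : ∀ τ, 0 ≤ τ → ‖p τ‖ ≤ ‖φ‖ := fun τ hτ => by
    refine (sq_le_sq₀ (norm_nonneg _) (norm_nonneg _)).mp ?_
    refine le_trans ?_ (hen τ hτ)
    have : 0 ≤ 4 / 3 * τ ^ 3 * ‖B (adjoint B (B (p τ)))‖ ^ 2 := by positivity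
    have : 0 ≤ 2 * τ * ‖B (p τ)‖ ^ 2 := by positivity
    have : 0 ≤ 2 * τ ^ 2 * ‖adjoint B (B (p τ))‖ ^ 2 := by positivity
    linarith
  have hb1 : ∀ τ, 0 < τ → ‖B (p τ)‖ ≤ ‖φ‖ * (τ ^ (1 / 2 : ℝ))⁻¹ := fun τ hτ => by
    refine le_of_mul_sq_le (norm_nonneg _) (hrp hτ).1 (le_trans ?_ (hen τ hτ.le))
    rw [(hrp hτ).2]
    have : 0 ≤ 4 / 3 * τ ^ 3 * ‖B (adjoint B (B (p τ)))‖ ^ 2 := by positivity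
    have : 0 ≤ τ * ‖B (p τ)‖ ^ 2 := by positivity
    have : 0 ≤ 2 * τ ^ 2 * ‖adjoint B (B (p τ))‖ ^ 2 := by positivity
    nlinarith [sq_nonneg ‖p τ‖]
  have hb2 : ∀ τ, 0 < τ → ‖adjoint B (B (p τ))‖ ≤ ‖φ‖ * τ⁻¹ := fun τ hτ => by
    refine le_of_mul_sq_le (norm_nonneg _) hτ (le_trans ?_ (hen τ hτ.le))
    have : 0 ≤ 4 / 3 * τ ^ 3 * ‖B (adjoint B (B (p τ)))‖ ^ 2 := by positivity
    have : 0 ≤ 2 * τ * ‖B (p τ)‖ ^ 2 := by positivity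
    have : 0 ≤ τ ^ 2 * ‖adjoint B (B (p τ))‖ ^ 2 := by positivity
    nlinarith [sq_nonneg ‖p τ‖]
  have hb3 : ∀ τ, 0 < τ → ‖B (adjoint B (B (p τ)))‖ ≤ ‖φ‖ * (τ * τ ^ (1 / 2 : ℝ))⁻¹ :=
    fun τ hτ => by
      refine le_of_mul_sq_le (norm_nonneg _) (mul_pos hτ (hrp hτ).1)
        (le_trans ?_ (hen τ hτ.le))
      rw [mul_pow, (hrp hτ).2]
      have : 0 ≤ τ ^ 3 * ‖B (adjoint B (B (p τ)))‖ ^ 2 := by positivity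
      have : 0 ≤ 2 * τ * ‖B (p τ)‖ ^ 2 := by positivity
      have : 0 ≤ 2 * τ ^ 2 * ‖adjoint B (B (p τ))‖ ^ 2 := by positivity
      nlinarith [sq_nonneg ‖p τ‖]
  exact ⟨p, hp0, hp, hb0, hb1, hb2, hb3⟩

/-- Error bound for the discrete heat equation `(e - σ)' = -D* (D e + r)`. -/
theorem norm_le_of_duhamel (ht : 0 < t) (he0 : e 0 = 0)
    (hc : ContinuousOn (fun s => e s - σ s) (Set.Icc 0 t))
    (hd : ∀ s ∈ Set.Ioo 0 t,
      HasDerivAt (fun s => e s - σ s) (-(adjoint D (D (e s) + r s))) s)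
    (hr : ∀ s ∈ Set.Icc 0 t, ‖r s‖ ≤ R)
    (hσ : ∀ s ∈ Set.Icc 0 t, ‖σ s - σ t‖ ≤ S * (t - s) ^ (1 / 2 : ℝ)) :
    ‖e t‖ ≤ (3 * S + 2 * R) * t ^ (1 / 2 : ℝ) := by
  set φ := e t with hφ
  obtain ⟨p, hp0, hp, hb0, hb1, hb2, -⟩ := exists_smoothing_semigroup D φ
  have ht0 : (0 : ℝ) ∈ Set.Icc 0 t := ⟨le_rfl, ht.le⟩
  have htt : t ∈ Set.Icc (0 : ℝ) t := ⟨ht.le, le_rfl⟩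
  have hrp := fun τ : ℝ => @rpow_half_pos_and_sq τ
  have hS : 0 ≤ S := by
    have := (norm_nonneg _).trans (hσ 0 ht0)
    rw [sub_zero] at this
    exact nonneg_of_mul_nonneg_left this (hrp t ht).1
  have hR : 0 ≤ R := (norm_nonneg _).trans (hr 0 ht0)
  have hpc : Continuous p := continuous_iff_continuousAt.mpr fun τ => (hp τ).continuousAt
  have hpd : ∀ s, HasDerivAt (fun s => p (t - s)) (adjoint D (D (p (t - s)))) s := fun s => by
    have := (hp (t - s)).scomp s ((hasDerivAt_id' s).const_sub t)
    simpa [Function.comp_def] using this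
  -- Pairing with the backward semigroup cancels D e. Adding the constant σ t makes only increments
  -- of σ meet the kernel (t-s)^{-1}, and at s = t the pairing is ‖e t‖². Integrating the remaining
  -- (t-s)^{-1/2} gives 2(R+S)√t, and the initial value S√t.
  have hmain := le_of_hasDerivAt_le_rpow (F := fun s => ⟪(e s - σ s) + σ t, p (t - s)⟫)
    (F' := fun s => -⟪r s, D (p (t - s))⟫ - ⟪σ s - σ t, adjoint D (D (p (t - s)))⟫)
    (B := (R + S) * ‖φ‖) (β := 1 / 2) ht.le (by norm_num)
    ((hc.add continuousOn_const).inner (hpc.comp (continuous_const.sub continuous_id)).continuousOn)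
    (fun s hs => by
      refine (((hd s hs).add_const (σ t)).inner ℝ (hpd s)).congr_deriv ?_
      simp only [inner_neg_left, inner_add_left, inner_sub_left, map_add, map_sub,
        ContinuousLinearMap.adjoint_inner_left, ContinuousLinearMap.adjoint_inner_right]
      ring)
    (fun s hs => by
      have hτ : 0 < t - s := sub_pos.mpr hs.2
      have hsm : s ∈ Set.Icc 0 t := ⟨hs.1.le, hs.2.le⟩
      have e1 := (neg_le_abs _).trans ((abs_real_inner_le_norm (r s) (D (p (t - s)))).trans
        (mul_le_mul (hr s hsm) (hb1 _ hτ) (norm_nonneg _) hR))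
      have e2 := (neg_le_abs _).trans ((abs_real_inner_le_norm (σ s - σ t)
        (adjoint D (D (p (t - s))))).trans
        (mul_le_mul (hσ s hsm) (hb2 _ hτ) (norm_nonneg _) (by have := (hrp _ hτ).1; positivity)))
      have e3 : (t - s) ^ (1 / 2 - 1 : ℝ) = ((t - s) ^ (1 / 2 : ℝ))⁻¹ := by
        rw [← Real.rpow_neg hτ.le]; norm_num
      have e4 : (t - s) ^ (1 / 2 : ℝ) * (t - s)⁻¹ = ((t - s) ^ (1 / 2 : ℝ))⁻¹ := by
        nth_rewrite 2 [← (hrp _ hτ).2]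
        have := (hrp _ hτ).1
        field_simp
      rw [e3]
      have e5 : S * (t - s) ^ (1 / 2 : ℝ) * (‖φ‖ * (t - s)⁻¹) =
        S * ‖φ‖ * ((t - s) ^ (1 / 2 : ℝ))⁻¹ := by rw [← e4]; ring
      rw [e5] at e2
      linarith)
  have h0 : ⟪(e 0 - σ 0) + σ t, p t⟫ ≤ S * t ^ (1 / 2 : ℝ) * ‖φ‖ := by
    have e1 : e 0 - σ 0 + σ t = -(σ 0 - σ t) := by rw [he0]; abel
    have e2 := hσ 0 ht0
    rw [sub_zero] at e2
    rw [e1, inner_neg_left]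
    exact (neg_le_abs _).trans ((abs_real_inner_le_norm _ _).trans
      (mul_le_mul e2 (hb0 t ht.le) (norm_nonneg _) (by have := (hrp _ ht).1; positivity)))
  simp only [sub_add_cancel, sub_self, sub_zero, hp0] at hmain
  rw [← hφ, real_inner_self_eq_norm_sq] at hmain
  have h3 : ‖φ‖ ^ 2 ≤ (3 * S + 2 * R) * t ^ (1 / 2 : ℝ) * ‖φ‖ := by
    refine (hmain.trans (add_le_add_left h0 _)).trans (le_of_eq ?_)
    ring
  rcases (norm_nonneg φ).eq_or_lt with h4 | h4
  · rw [← h4]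
    have := (hrp _ ht).1
    positivity
  · rw [sq] at h3
    exact le_of_mul_le_mul_right h3 h4

/-- Bound for `D e + r` for a solution of the discrete heat equation `(e - σ)' = -D* (D e + r)`. -/
theorem norm_add_le_of_duhamel {β c : ℝ} (ht : 0 < t) (hβ : 0 < β) (hc0 : 0 ≤ c) (he0 : e 0 = 0)
    (hc : ContinuousOn (fun s => e s - σ s) (Set.Icc 0 t))
    (hd : ∀ s ∈ Set.Ioo 0 t,
      HasDerivAt (fun s => e s - σ s) (-(adjoint D (D (e s) + r s))) s)
    (hr : ∀ s ∈ Set.Icc 0 t, ‖r s‖ ≤ R)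
    (hσ : ∀ s ∈ Set.Icc 0 t, ‖σ s - σ t‖ ≤ S * (t - s) ^ (1 / 2 : ℝ))
    (hr' : ∀ s ∈ Set.Icc 0 t, ‖r s - r t‖ ≤ R * (c * (t - s) ^ β))
    (hσ' : ∀ s ∈ Set.Icc 0 t, ‖σ s - σ t‖ ≤ S * (t - s) ^ (1 / 2 : ℝ) * (c * (t - s) ^ β)) :
    ‖D (e t) + r t‖ ≤ (R + S) * (1 + c / β * t ^ β) := by
  set φ := D (e t) + r t with hφ
  obtain ⟨p, hp0, hp, hb0, hb1, hb2, hb3⟩ := exists_smoothing_semigroup (adjoint D) φ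
  rw [ContinuousLinearMap.adjoint_adjoint] at hp hb2 hb3
  have ht0 : (0 : ℝ) ∈ Set.Icc 0 t := ⟨le_rfl, ht.le⟩
  have htt : t ∈ Set.Icc (0 : ℝ) t := ⟨ht.le, le_rfl⟩
  have hrp := fun τ : ℝ => @rpow_half_pos_and_sq τ
  have hS : 0 ≤ S := by
    have := (norm_nonneg _).trans (hσ 0 ht0)
    rw [sub_zero] at this
    exact nonneg_of_mul_nonneg_left this (hrp t ht).1
  have hR : 0 ≤ R := (norm_nonneg _).trans (hr 0 ht0)
  have hpc : Continuous p := continuous_iff_continuousAt.mpr fun τ => (hp τ).continuousAt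
  have hpd : ∀ s, HasDerivAt (fun s => p (t - s)) (D (adjoint D (p (t - s)))) s := fun s => by
    have := (hp (t - s)).scomp s ((hasDerivAt_id' s).const_sub t)
    simpa [Function.comp_def] using this
  have hpd' : ∀ s, HasDerivAt (fun s => adjoint D (p (t - s)))
      (adjoint D (D (adjoint D (p (t - s))))) s := fun s =>
    (adjoint D).hasFDerivAt.comp_hasDerivAt s (hpd s)
  have hpc' : Continuous fun s => p (t - s) := hpc.comp (continuous_const.sub continuous_id)
  -- Here p solves the equation of D D*, and testing with D* p brings in one more half power of the
  -- singularity. The added pairing of r t with p(t-s) has derivative ⟪r t, D D* p⟫, which replaces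
  -- r s by its increment. At s = t the sum of the pairings is ‖D e + r‖².
  have hmain := le_of_hasDerivAt_le_rpow
    (F := fun s => ⟪(e s - σ s) + σ t, adjoint D (p (t - s))⟫ + ⟪r t, p (t - s)⟫)
    (F' := fun s => -⟪r s - r t, D (adjoint D (p (t - s)))⟫ -
      ⟪σ s - σ t, adjoint D (D (adjoint D (p (t - s))))⟫)
    (B := (R + S) * c * ‖φ‖) (β := β) ht.le hβ
    (((hc.add continuousOn_const).inner ((adjoint D).continuous.comp hpc').continuousOn).add
      (continuousOn_const.inner hpc'.continuousOn))
    (fun s hs => by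
      refine ((((hd s hs).add_const (σ t)).inner ℝ (hpd' s)).add
        ((hasDerivAt_const s (r t)).inner ℝ (hpd s))).congr_deriv ?_
      rw [inner_neg_left, ContinuousLinearMap.adjoint_inner_left]
      simp only [inner_add_left, inner_sub_left, map_add, map_sub, inner_zero_left,
        ContinuousLinearMap.adjoint_inner_right]
      ring)
    (fun s hs => by
      have hτ : 0 < t - s := sub_pos.mpr hs.2
      have hsm : s ∈ Set.Icc 0 t := ⟨hs.1.le, hs.2.le⟩
      have hτβ : 0 < (t - s) ^ β := Real.rpow_pos_of_pos hτ _
      have hτh := (hrp _ hτ).1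
      have e1 := (neg_le_abs _).trans ((abs_real_inner_le_norm (r s - r t)
        (D (adjoint D (p (t - s))))).trans
        (mul_le_mul (hr' s hsm) (hb2 _ hτ) (norm_nonneg _) (by positivity)))
      have e2 := (neg_le_abs _).trans ((abs_real_inner_le_norm (σ s - σ t)
        (adjoint D (D (adjoint D (p (t - s)))))).trans
        (mul_le_mul (hσ' s hsm) (hb3 _ hτ) (norm_nonneg _) (by positivity)))
      have e3 : (t - s) ^ (β - 1) = (t - s) ^ β * (t - s)⁻¹ := by
        rw [Real.rpow_sub_one hτ.ne', div_eq_mul_inv]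
      have e5 : S * (t - s) ^ (1 / 2 : ℝ) * (c * (t - s) ^ β) *
          (‖φ‖ * ((t - s) * (t - s) ^ (1 / 2 : ℝ))⁻¹) =
          S * c * ‖φ‖ * ((t - s) ^ β * (t - s)⁻¹) := by field_simp
      rw [e5] at e2
      rw [e3]
      linarith)
  have h0 : ⟪(e 0 - σ 0) + σ t, adjoint D (p t)⟫ + ⟪r t, p t⟫ ≤ (R + S) * ‖φ‖ := by
    have e1 : e 0 - σ 0 + σ t = -(σ 0 - σ t) := by rw [he0]; abel
    have e2 := hσ 0 ht0
    have hth := (hrp _ ht).1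
    rw [sub_zero] at e2
    rw [e1, inner_neg_left]
    have e3 := (neg_le_abs _).trans ((abs_real_inner_le_norm (σ 0 - σ t) (adjoint D (p t))).trans
      (mul_le_mul e2 (hb1 t ht) (norm_nonneg _) (by positivity)))
    have e4 := (le_abs_self _).trans ((abs_real_inner_le_norm (r t) (p t)).trans
      (mul_le_mul (hr t htt) (hb0 t ht.le) (norm_nonneg _) hR))
    have e5 : S * t ^ (1 / 2 : ℝ) * (‖φ‖ * (t ^ (1 / 2 : ℝ))⁻¹) = S * ‖φ‖ := by field_simp
    rw [e5] at e3
    linarith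
  simp only [sub_add_cancel, sub_self, sub_zero, hp0,
    ContinuousLinearMap.adjoint_inner_right] at hmain
  rw [← inner_add_left, ← hφ, real_inner_self_eq_norm_sq] at hmain
  have h3 : ‖φ‖ ^ 2 ≤ (R + S) * (1 + c / β * t ^ β) * ‖φ‖ := by
    rw [ContinuousLinearMap.adjoint_inner_right] at h0
    refine (hmain.trans (add_le_add_left h0 _)).trans (le_of_eq ?_)
    ring
  rcases (norm_nonneg φ).eq_or_lt with h4 | h4
  · rw [← h4]
    have := Real.rpow_nonneg ht.le β
    positivity
  · rw [sq] at h3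
    exact le_of_mul_le_mul_right h3 h4

end Semigroup

end LDG
end

/-! ### The scheme in coordinates: numerical fluxes and the discrete derivative -/

noncomputable section

namespace LDG

variable {N : ℕ}

/-! ## Numerical fluxes -/

/-- The same kind of boundary conditions with zero data. -/
def Boundary.homogeneous : Boundary → Boundary
  | .periodic => .periodic
  | .mixed _ _ => .mixed 0 0

/-- The boundary condition for a function whose flux is taken from the same side as `u` is with
the choice `fl`. -/
def HasBoundaryValue (fl : Flux) (bc : Boundary) (t : ℝ) (f : ℝ → ℝ) : Prop :=
  match bc, fl with
  | .periodic, _ => f 0 = f (2 * Real.pi)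
  | .mixed g₀ _, .minusPlus => f 0 = g₀ t
  | .mixed _ g₁, .plusMinus => f (2 * Real.pi) = g₁ t

theorem SatisfiesBoundary.hasBoundaryValue {fl : Flux} {bc : Boundary} {u : ℝ → ℝ → ℝ} {t : ℝ}
    (h : SatisfiesBoundary fl bc u t) : HasBoundaryValue fl bc t (fun x => u x t) ∧
      HasBoundaryValue fl.flip bc t (fun x => spaceDeriv u x t) := by
  cases bc <;> cases fl
  · exact h
  · exact h
  · exact h
  · exact ⟨h.2, h.1⟩

theorem fluxQ_eq_fluxU_flip (M : Mesh N) (fl : Flux) (bc : Boundary) (t : ℝ) (v : Fin N → ℝ[X]) :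
    fluxQ M fl bc t v = fluxU M fl.flip bc t v := by
  cases fl <;> cases bc <;> rfl

theorem traceMinus_succ (M : Mesh N) (ext : ℝ) (v : Fin N → ℝ[X]) (j : Fin N) :
    traceMinus M ext v j.succ = (v j).eval (M.right j) := rfl

theorem traceMinus_zero (M : Mesh N) (ext : ℝ) (v : Fin N → ℝ[X]) :
    traceMinus M ext v 0 = ext := rfl

theorem tracePlus_castSucc (M : Mesh N) (ext : ℝ) (v : Fin N → ℝ[X]) (j : Fin N) :
    tracePlus M ext v j.castSucc = (v j).eval (M.left j) := by
  simp [tracePlus]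

theorem tracePlus_last (M : Mesh N) (ext : ℝ) (v : Fin N → ℝ[X]) :
    tracePlus M ext v (Fin.last N) = ext := by
  simp [tracePlus]

theorem traceMinus_add (M : Mesh N) (a b : ℝ) (v w : Fin N → ℝ[X]) (i : Fin (N + 1)) :
    traceMinus M (a + b) (v + w) i = traceMinus M a v i + traceMinus M b w i := by
  refine Fin.cases ?_ (fun j => ?_) i
  · simp only [traceMinus_zero]
  · simp only [traceMinus_succ, Pi.add_apply, eval_add]

theorem tracePlus_add (M : Mesh N) (a b : ℝ) (v w : Fin N → ℝ[X]) (i : Fin (N + 1)) :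
    tracePlus M (a + b) (v + w) i = tracePlus M a v i + tracePlus M b w i := by
  refine Fin.lastCases ?_ (fun j => ?_) i
  · simp only [tracePlus_last]
  · simp only [tracePlus_castSucc, Pi.add_apply, eval_add]

theorem traceMinus_smul (M : Mesh N) (c a : ℝ) (v : Fin N → ℝ[X]) (i : Fin (N + 1)) :
    traceMinus M (c * a) (c • v) i = c * traceMinus M a v i := by
  refine Fin.cases ?_ (fun j => ?_) i
  · simp only [traceMinus_zero]
  · simp only [traceMinus_succ, Pi.smul_apply, eval_smul, smul_eq_mul]

theorem tracePlus_smul (M : Mesh N) (c a : ℝ) (v : Fin N → ℝ[X]) (i : Fin (N + 1)) :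
    tracePlus M (c * a) (c • v) i = c * tracePlus M a v i := by
  refine Fin.lastCases ?_ (fun j => ?_) i
  · simp only [tracePlus_last]
  · simp only [tracePlus_castSucc, Pi.smul_apply, eval_smul, smul_eq_mul]

/-- The numerical flux with zero boundary data. -/
def homFlux (M : Mesh N) (fl : Flux) (bc : Boundary) (v : Fin N → ℝ[X]) : Fin (N + 1) → ℝ :=
  fluxU M fl bc.homogeneous 0 v

theorem homFlux_add (M : Mesh N) (fl : Flux) (bc : Boundary) (v w : Fin N → ℝ[X])
    (i : Fin (N + 1)) : homFlux M fl bc (v + w) i = homFlux M fl bc v i + homFlux M fl bc w i := by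
  cases fl <;> cases bc <;>
    simp only [homFlux, Boundary.homogeneous, fluxU, Pi.zero_apply, ← traceMinus_add,
      ← tracePlus_add, add_zero]

theorem homFlux_smul (M : Mesh N) (fl : Flux) (bc : Boundary) (c : ℝ) (v : Fin N → ℝ[X])
    (i : Fin (N + 1)) : homFlux M fl bc (c • v) i = c * homFlux M fl bc v i := by
  cases fl <;> cases bc <;>
    simp only [homFlux, Boundary.homogeneous, fluxU, Pi.zero_apply, ← traceMinus_smul,
      ← tracePlus_smul, mul_zero]

theorem Mesh.pos (M : Mesh N) : 0 < N := by
  rcases Nat.eq_zero_or_pos N with rfl | h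
  · have h1 := M.node_zero
    have h2 := M.node_last
    rw [show Fin.last 0 = 0 from rfl, h1] at h2
    exact absurd h2 two_pi_pos'.ne
  · exact h

/-- The values at the nodes of `f`, minus the numerical flux of `w`, are the numerical flux with
zero data of `I - w`, if `I` interpolates `f` where the flux is taken. -/
theorem sub_fluxU_eq (M : Mesh N) {fl : Flux} {bc : Boundary} {t : ℝ} {f : ℝ → ℝ}
    (hf : HasBoundaryValue fl bc t f) {I : Fin N → ℝ[X]}
    (hI : ∀ j, (I j).eval (fl.endpoint (M.left j) (M.right j)) =
      f (fl.endpoint (M.left j) (M.right j))) (w : Fin N → ℝ[X]) (i : Fin (N + 1)) :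
    f (M.node i) - fluxU M fl bc t w i = homFlux M fl bc (I - w) i := by
  obtain ⟨n, rfl⟩ : ∃ n, N = n + 1 := ⟨N - 1, by have := M.pos; omega⟩
  cases fl
  · have hI' : ∀ j, (I j).eval (M.right j) = f (M.right j) := hI
    cases bc
    · refine Fin.cases ?_ (fun j => ?_) i
      · simp only [homFlux, Boundary.homogeneous, fluxU, traceMinus_zero, ← Fin.succ_last,
          traceMinus_succ, Pi.sub_apply, eval_sub, hI', M.node_zero]
        rw [show f 0 = f (2 * Real.pi) from hf, ← M.node_last]
        rfl
      · simp only [homFlux, Boundary.homogeneous, fluxU, traceMinus_succ, Pi.sub_apply, eval_sub,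
          hI']
        rfl
    · refine Fin.cases ?_ (fun j => ?_) i
      · simp only [homFlux, Boundary.homogeneous, fluxU, traceMinus_zero, Pi.zero_apply,
          M.node_zero]
        exact sub_eq_zero.mpr hf
      · simp only [homFlux, Boundary.homogeneous, fluxU, traceMinus_succ, Pi.sub_apply, eval_sub,
          hI']
        rfl
  · have hI' : ∀ j, (I j).eval (M.left j) = f (M.left j) := hI
    cases bc
    · refine Fin.lastCases ?_ (fun j => ?_) i
      · have h0 : (0 : Fin (n + 1 + 1)) = (0 : Fin (n + 1)).castSucc := rfl
        simp only [homFlux, Boundary.homogeneous, fluxU, tracePlus_last, h0,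
          tracePlus_castSucc, Pi.sub_apply, eval_sub, hI', M.node_last]
        rw [← show f 0 = f (2 * Real.pi) from hf, ← M.node_zero]
        rfl
      · simp only [homFlux, Boundary.homogeneous, fluxU, tracePlus_castSucc, Pi.sub_apply,
          eval_sub, hI']
        rfl
    · refine Fin.lastCases ?_ (fun j => ?_) i
      · simp only [homFlux, Boundary.homogeneous, fluxU, tracePlus_last, Pi.zero_apply,
          M.node_last]
        exact sub_eq_zero.mpr hf
      · simp only [homFlux, Boundary.homogeneous, fluxU, tracePlus_castSucc, Pi.sub_apply,
          eval_sub, hI']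
        rfl

/-! ## The discrete derivative -/

/-- The right-hand side of the equation on cell `j`. -/
def cellForm (M : Mesh N) (p : Fin N → ℝ[X]) (P : Fin (N + 1) → ℝ) (v : Fin N → ℝ[X])
    (j : Fin N) : ℝ :=
  -(∫ x in M.left j..M.right j, (p j).eval x * (v j).derivative.eval x)
      + P j.succ * (v j).eval (M.right j) - P j.castSucc * (v j).eval (M.left j)

theorem integral_add_eval_mul (p q w : ℝ[X]) (a b : ℝ) :
    ∫ x in a..b, (p + q).eval x * w.eval x =
      (∫ x in a..b, p.eval x * w.eval x) + ∫ x in a..b, q.eval x * w.eval x := by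
  simp only [eval_add, add_mul]
  exact intervalIntegral.integral_add (intervalIntegrable_eval_mul _ _ _ _)
    (intervalIntegrable_eval_mul _ _ _ _)

theorem integral_smul_eval_mul (c : ℝ) (p w : ℝ[X]) (a b : ℝ) :
    ∫ x in a..b, (c • p).eval x * w.eval x = c * ∫ x in a..b, p.eval x * w.eval x := by
  simp only [eval_smul, smul_eq_mul, mul_assoc]
  exact intervalIntegral.integral_const_mul _ _

theorem integral_mul_add_eval (p v w : ℝ[X]) (a b : ℝ) :
    ∫ x in a..b, p.eval x * (v + w).eval x =
      (∫ x in a..b, p.eval x * v.eval x) + ∫ x in a..b, p.eval x * w.eval x := by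
  simpa only [mul_comm] using integral_add_eval_mul v w p a b

theorem integral_mul_smul_eval (c : ℝ) (p w : ℝ[X]) (a b : ℝ) :
    ∫ x in a..b, p.eval x * (c • w).eval x = c * ∫ x in a..b, p.eval x * w.eval x := by
  simpa only [mul_comm] using integral_smul_eval_mul c w p a b

/-- The bilinear form of the discrete derivative with zero boundary data. -/
def derivForm (M : Mesh N) (fl : Flux) (bc : Boundary) :
    (Fin N → ℝ[X]) →ₗ[ℝ] (Fin N → ℝ[X]) →ₗ[ℝ] ℝ :=
  LinearMap.mk₂ ℝ (fun v w => ∑ j, cellForm M v (homFlux M fl bc v) w j)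
    (fun v₁ v₂ w => by
      rw [← Finset.sum_add_distrib]
      refine Finset.sum_congr rfl fun j _ => ?_
      simp only [cellForm, homFlux_add, Pi.add_apply, integral_add_eval_mul]
      ring)
    (fun c v w => by
      rw [smul_eq_mul, Finset.mul_sum]
      refine Finset.sum_congr rfl fun j _ => ?_
      simp only [cellForm, homFlux_smul, Pi.smul_apply, integral_smul_eval_mul]
      ring)
    (fun v w₁ w₂ => by
      rw [← Finset.sum_add_distrib]
      refine Finset.sum_congr rfl fun j _ => ?_
      simp only [cellForm, Pi.add_apply, derivative_add, integral_mul_add_eval]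
      simp only [eval_add]
      ring)
    (fun c v w => by
      rw [smul_eq_mul, Finset.mul_sum]
      refine Finset.sum_congr rfl fun j _ => ?_
      simp only [cellForm, Pi.smul_apply, derivative_smul, integral_mul_smul_eval]
      simp only [eval_smul, smul_eq_mul]
      ring)

theorem derivForm_apply (M : Mesh N) (fl : Flux) (bc : Boundary) (v w : Fin N → ℝ[X]) :
    derivForm M fl bc v w = ∑ j, cellForm M v (homFlux M fl bc v) w j := rfl

theorem homFlux_periodic_last (M : Mesh N) (fl : Flux) (v : Fin N → ℝ[X]) :
    homFlux M fl .periodic v (Fin.last N) = homFlux M fl .periodic v 0 := by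
  obtain ⟨n, rfl⟩ : ∃ n, N = n + 1 := ⟨N - 1, by have := M.pos; omega⟩
  cases fl
  · simp only [homFlux, Boundary.homogeneous, fluxU, traceMinus_zero, ← Fin.succ_last,
      traceMinus_succ]
  · have h0 : (0 : Fin (n + 1 + 1)) = (0 : Fin (n + 1)).castSucc := rfl
    simp only [homFlux, Boundary.homogeneous, fluxU, tracePlus_last, h0, tracePlus_castSucc]

/-- Periodic fluxes agree at the two ends. For mixed conditions each end has one flux with zero
datum, so both products vanish. -/
theorem homFlux_mul_last (M : Mesh N) (fl : Flux) (bc : Boundary) (v w : Fin N → ℝ[X]) :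
    homFlux M fl bc v (Fin.last N) * homFlux M fl.flip bc w (Fin.last N) =
      homFlux M fl bc v 0 * homFlux M fl.flip bc w 0 := by
  cases bc
  · rw [homFlux_periodic_last, homFlux_periodic_last]
  · cases fl <;> simp [homFlux, Boundary.homogeneous, fluxU, Flux.flip, traceMinus_zero,
      tracePlus_last]

/-- At each node one flux comes from the left and the other from the right, so that at either end of
a cell one of them is the inner trace. This discrete product rule makes the node terms telescope
over the mesh. -/
theorem homFlux_cell (M : Mesh N) (fl : Flux) (bc : Boundary) (v w : Fin N → ℝ[X]) (j : Fin N) :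
    homFlux M fl bc v j.succ * (w j).eval (M.right j) -
        homFlux M fl bc v j.castSucc * (w j).eval (M.left j) +
      (homFlux M fl.flip bc w j.succ * (v j).eval (M.right j) -
        homFlux M fl.flip bc w j.castSucc * (v j).eval (M.left j)) =
      (homFlux M fl bc v j.succ * homFlux M fl.flip bc w j.succ -
        homFlux M fl bc v j.castSucc * homFlux M fl.flip bc w j.castSucc) +
      ((v j).eval (M.right j) * (w j).eval (M.right j) -
        (v j).eval (M.left j) * (w j).eval (M.left j)) := by
  cases fl <;> cases bc <;>
    simp only [homFlux, Boundary.homogeneous, fluxU, Flux.flip, traceMinus_succ,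
      tracePlus_castSucc] <;> ring

/-- The discrete derivatives with opposite fluxes are adjoint up to sign. -/
theorem derivForm_flip (M : Mesh N) (fl : Flux) (bc : Boundary) (v w : Fin N → ℝ[X]) :
    derivForm M fl.flip bc w v = -derivForm M fl bc v w := by
  rw [eq_neg_iff_add_eq_zero, derivForm_apply, derivForm_apply, ← Finset.sum_add_distrib]
  have h : ∀ j, cellForm M w (homFlux M fl.flip bc w) v j + cellForm M v (homFlux M fl bc v) w j =
      homFlux M fl bc v j.succ * homFlux M fl.flip bc w j.succ -
        homFlux M fl bc v j.castSucc * homFlux M fl.flip bc w j.castSucc := fun j => by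
    have h1 := integral_derivative_mul (v j) (w j) (M.left j) (M.right j)
    have h2 : ∫ x in M.left j..M.right j, (v j).derivative.eval x * (w j).eval x =
        ∫ x in M.left j..M.right j, (w j).eval x * (v j).derivative.eval x := by
      simp only [mul_comm]
    have h3 := homFlux_cell M fl bc v w j
    rw [h2] at h1
    simp only [cellForm]
    linarith
  rw [Finset.sum_congr rfl fun j _ => h j]
  refine (sum_succ_sub_castSucc fun i =>
    homFlux M fl bc v i * homFlux M fl.flip bc w i).trans ?_
  rw [homFlux_mul_last, sub_self]

/-! ## Coordinates with respect to an orthonormal basis -/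

/-- The coordinate space of the finite element space. -/
abbrev FESpace (N k : ℕ) : Type := EuclideanSpace ℝ (Fin N × Fin (k + 1))

/-- The normalized Legendre polynomial of degree `i.2` on the cell `i.1`. -/
def feBasis (M : Mesh N) (k : ℕ) (i : Fin N × Fin (k + 1)) : Fin N → ℝ[X] :=
  Pi.single i.1 (√((2 * (i.2 : ℕ) + 1) / M.cellSize i.1) •
    legendreOn (M.left i.1) (M.right i.1) i.2)

/-- The inner product of `L²(0, 2π)`. -/
def l2Inner (M : Mesh N) (v w : Fin N → ℝ[X]) : ℝ :=
  ∑ j, ∫ x in M.left j..M.right j, (v j).eval x * (w j).eval x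

/-- The `L²` coordinates. -/
def feCoord (M : Mesh N) (k : ℕ) : (Fin N → ℝ[X]) →ₗ[ℝ] FESpace N k where
  toFun v := WithLp.toLp 2 fun i => l2Inner M v (feBasis M k i)
  map_add' v w := by
    ext i
    simp only [l2Inner, Pi.add_apply, integral_add_eval_mul, Finset.sum_add_distrib,
      PiLp.add_apply]
  map_smul' c v := by
    ext i
    simp only [l2Inner, Pi.smul_apply, integral_smul_eval_mul, Finset.mul_sum, PiLp.smul_apply,
      smul_eq_mul, RingHom.id_apply]

theorem feCoord_apply (M : Mesh N) (k : ℕ) (v : Fin N → ℝ[X]) (i : Fin N × Fin (k + 1)) :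
    feCoord M k v i = l2Inner M v (feBasis M k i) := rfl

/-- The function with given coordinates. -/
def feReal (M : Mesh N) (k : ℕ) : FESpace N k →ₗ[ℝ] (Fin N → ℝ[X]) where
  toFun c := ∑ i, c i • feBasis M k i
  map_add' c d := by simp only [PiLp.add_apply, add_smul, Finset.sum_add_distrib]
  map_smul' a c := by
    simp only [PiLp.smul_apply, smul_assoc, Finset.smul_sum, RingHom.id_apply]

theorem feReal_apply (M : Mesh N) (k : ℕ) (c : FESpace N k) :
    feReal M k c = ∑ i, c i • feBasis M k i := rfl

theorem feBasis_mem (M : Mesh N) (k : ℕ) (i : Fin N × Fin (k + 1)) :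
    feBasis M k i ∈ feSpace N k := fun j => by
  rcases eq_or_ne j i.1 with rfl | h
  · rw [feBasis, Pi.single_eq_same]
    exact (natDegree_smul_le _ _).trans
      ((natDegree_legendreOn_le _ _ _).trans (Nat.lt_succ_iff.mp i.2.2))
  · rw [feBasis, Pi.single_eq_of_ne h, natDegree_zero]
    exact Nat.zero_le _

theorem l2Inner_feBasis (M : Mesh N) (k : ℕ) (v : Fin N → ℝ[X]) (i : Fin N × Fin (k + 1)) :
    l2Inner M v (feBasis M k i) = √((2 * (i.2 : ℕ) + 1) / M.cellSize i.1) *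
      ∫ x in M.left i.1..M.right i.1, (v i.1).eval x *
        (legendreOn (M.left i.1) (M.right i.1) i.2).eval x := by
  rw [l2Inner, Finset.sum_eq_single i.1]
  · rw [feBasis, Pi.single_eq_same, integral_mul_smul_eval]
  · intro j _ hj
    rw [feBasis, Pi.single_eq_of_ne hj]
    simp
  · simp

theorem feReal_feCoord (M : Mesh N) {k : ℕ} {v : Fin N → ℝ[X]} (hv : v ∈ feSpace N k) :
    feReal M k (feCoord M k v) = v := by
  funext j
  refine Polynomial.funext fun x => ?_
  rw [eval_eq_sum_legendreOn (M.left_lt_right j) (hv j) x, Finset.sum_range, feReal_apply,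
    Fintype.sum_prod_type, Finset.sum_apply, eval_finsetSum, Finset.sum_eq_single j]
  · rw [Finset.sum_apply, eval_finsetSum]
    refine Finset.sum_congr rfl fun m _ => ?_
    rw [Pi.smul_apply, eval_smul, feCoord_apply, l2Inner_feBasis, feBasis, Pi.single_eq_same,
      eval_smul, smul_eq_mul, smul_eq_mul]
    have h : √((2 * (m : ℕ) + 1) / M.cellSize j) * √((2 * (m : ℕ) + 1) / M.cellSize j) =
        (2 * (m : ℕ) + 1) / (M.right j - M.left j) :=
      Real.mul_self_sqrt (div_nonneg (by positivity) (M.cellSize_pos j).le)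
    rw [← h]
    ring
  · intro j' _ hj'
    rw [Finset.sum_apply, eval_finsetSum]
    refine Finset.sum_eq_zero fun m _ => ?_
    rw [Pi.smul_apply, feBasis, Pi.single_eq_of_ne hj'.symm]
    simp
  · simp

/-- No degree bound on v: the coordinates see only its L² projection. -/
theorem inner_feCoord (M : Mesh N) {k : ℕ} (v : Fin N → ℝ[X]) (c : FESpace N k) :
    inner ℝ (feCoord M k v) c = l2Inner M v (feReal M k c) := by
  let L : (Fin N → ℝ[X]) →ₗ[ℝ] ℝ :=
    { toFun := fun w => l2Inner M v w
      map_add' := fun w₁ w₂ => by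
        simp only [l2Inner, Pi.add_apply, integral_mul_add_eval, Finset.sum_add_distrib]
      map_smul' := fun a w => by
        simp only [l2Inner, Pi.smul_apply, integral_mul_smul_eval, Finset.mul_sum, smul_eq_mul,
          RingHom.id_apply] }
  change _ = L _
  rw [feReal_apply, map_sum, PiLp.inner_apply]
  refine Finset.sum_congr rfl fun i _ => ?_
  rw [map_smul, smul_eq_mul]
  rfl

theorem l2Norm_eq_norm (M : Mesh N) {k : ℕ} {v : Fin N → ℝ[X]} (hv : v ∈ feSpace N k) :
    l2Norm M v = ‖feCoord M k v‖ := by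
  rw [norm_eq_sqrt_real_inner, inner_feCoord, feReal_feCoord M hv]
  simp only [l2Norm, l2Inner, sq]

/-- The discrete derivative in coordinates. -/
def discreteDeriv (M : Mesh N) (k : ℕ) (fl : Flux) (bc : Boundary) :
    FESpace N k →L[ℝ] FESpace N k :=
  LinearMap.toContinuousLinearMap
    { toFun := fun c => WithLp.toLp 2 fun i => derivForm M fl bc (feReal M k c) (feBasis M k i)
      map_add' := fun c d => by
        ext i
        simp only [map_add, LinearMap.add_apply, PiLp.add_apply]
      map_smul' := fun a c => by
        ext i
        simp only [map_smul, LinearMap.smul_apply, PiLp.smul_apply, RingHom.id_apply] }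

theorem inner_discreteDeriv (M : Mesh N) (k : ℕ) (fl : Flux) (bc : Boundary) (c d : FESpace N k) :
    inner ℝ (discreteDeriv M k fl bc c) d = derivForm M fl bc (feReal M k c) (feReal M k d) := by
  rw [feReal_apply M k d, map_sum, PiLp.inner_apply]
  refine Finset.sum_congr rfl fun i _ => ?_
  rw [map_smul, smul_eq_mul]
  rfl

theorem discreteDeriv_feCoord_apply (M : Mesh N) {k : ℕ} (fl : Flux) (bc : Boundary)
    {v : Fin N → ℝ[X]} (hv : v ∈ feSpace N k) (i : Fin N × Fin (k + 1)) :
    discreteDeriv M k fl bc (feCoord M k v) i = derivForm M fl bc v (feBasis M k i) := by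
  change derivForm M fl bc (feReal M k (feCoord M k v)) (feBasis M k i) = _
  rw [feReal_feCoord M hv]

theorem adjoint_discreteDeriv_feCoord_apply (M : Mesh N) {k : ℕ} (fl : Flux) (bc : Boundary)
    {v : Fin N → ℝ[X]} (hv : v ∈ feSpace N k) (i : Fin N × Fin (k + 1)) :
    ContinuousLinearMap.adjoint (discreteDeriv M k fl bc) (feCoord M k v) i =
      -derivForm M fl.flip bc v (feBasis M k i) := by
  have h1 : ContinuousLinearMap.adjoint (discreteDeriv M k fl bc) (feCoord M k v) i =
      inner ℝ (EuclideanSpace.single i (1 : ℝ))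
        (ContinuousLinearMap.adjoint (discreteDeriv M k fl bc) (feCoord M k v)) := by
    rw [EuclideanSpace.inner_single_left]; simp
  have h2 : feReal M k (EuclideanSpace.single i (1 : ℝ)) = feBasis M k i := by
    rw [feReal_apply, Finset.sum_eq_single i]
    · simp
    · intro j _ hj
      simp [hj]
    · simp
  rw [h1, ContinuousLinearMap.adjoint_inner_right, inner_discreteDeriv, feReal_feCoord M hv, h2,
    derivForm_flip, neg_neg]

end LDG
end

noncomputable section

namespace LDG

/-! ## Corrected interpolants on a cell -/

section Cell

variable {a b : ℝ}

/-- The coefficient of the `n`-th correction function, for a family `w` of successive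
derivatives. -/
def chainCoef (fl : Flux) (k : ℕ) (a b : ℝ) (w : ℕ → ℝ → ℝ) (n : ℕ) : ℝ :=
  coef (Flux.flip^[n] fl) k a b (w n)

/-- The corrected interpolant of `w 0`, for a family `w` of successive derivatives. -/
def correctedInterp (fl : Flux) (k l : ℕ) (a b : ℝ) (w : ℕ → ℝ → ℝ) : ℝ[X] :=
  radau fl k a b (w 0) - ∑ n ∈ Finset.range l,
    (((b - a) / 2) ^ (n + 1) * chainCoef fl k a b w (n + 1)) • corr k a b (n + 1) fl

/-- The consistency error of the corrected interpolant. -/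
def remainder (fl : Flux) (k l : ℕ) (a b : ℝ) (w : ℕ → ℝ → ℝ) : ℝ[X] :=
  (-(((b - a) / 2) ^ l * chainCoef fl k a b w l)) • corr k a b l fl

/-- The projection of the first `m` corrections on `φ`. -/
def correctionMoment (fl : Flux) (k m : ℕ) (a b : ℝ) (w : ℕ → ℝ → ℝ) (φ : ℝ[X]) : ℝ :=
  ∑ n ∈ Finset.range m, ((b - a) / 2) ^ n * chainCoef fl k a b w n *
    ∫ x in a..b, (corr k a b n fl).eval x * φ.eval x

theorem natDegree_correctedInterp_le (hab : a < b) (fl : Flux) (k l : ℕ) {w : ℕ → ℝ → ℝ}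
    (hw : ContinuousOn (w 0) (Set.Icc a b)) : (correctedInterp fl k l a b w).natDegree ≤ k := by
  refine (natDegree_sub_le_of_le (isGaussRadau_radau fl k hab hw).1
    (natDegree_sum_le_of_forall_le _ _ fun n _ => ?_)).trans (max_self k).le
  exact (natDegree_smul_le _ _).trans (natDegree_corr_le hab k _ fl)

theorem natDegree_remainder_le (hab : a < b) (fl : Flux) (k l : ℕ) (w : ℕ → ℝ → ℝ) :
    (remainder fl k l a b w).natDegree ≤ k :=
  (natDegree_smul_le _ _).trans (natDegree_corr_le hab k _ fl)

theorem correctedInterp_eval_endpoint (hab : a < b) (fl : Flux) {k l : ℕ} (hlk : l ≤ k)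
    {w : ℕ → ℝ → ℝ} (hw : ContinuousOn (w 0) (Set.Icc a b)) :
    (correctedInterp fl k l a b w).eval (fl.endpoint a b) = w 0 (fl.endpoint a b) := by
  rw [correctedInterp, eval_sub, (isGaussRadau_radau fl k hab hw).2.2, eval_finsetSum,
    Finset.sum_eq_zero, sub_zero]
  intro n hn
  rw [eval_smul, corr_succ_eval_endpoint hab (by have := Finset.mem_range.mp hn; omega), smul_zero]

theorem integral_sum_smul_mul {ι : Type*} (s : Finset ι) (c : ι → ℝ) (p : ι → ℝ[X]) (φ : ℝ[X])
    (a b : ℝ) : ∫ x in a..b, (∑ i ∈ s, c i • p i).eval x * φ.eval x =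
      ∑ i ∈ s, c i * ∫ x in a..b, (p i).eval x * φ.eval x := by
  simp only [eval_finsetSum, Finset.sum_mul]
  rw [intervalIntegral.integral_finsetSum fun i _ => intervalIntegrable_eval_mul _ _ _ _]
  exact Finset.sum_congr rfl fun i _ => integral_smul_eval_mul _ _ _ _ _

theorem integral_sub_eval_mul (p q w : ℝ[X]) (a b : ℝ) :
    ∫ x in a..b, (p - q).eval x * w.eval x =
      (∫ x in a..b, p.eval x * w.eval x) - ∫ x in a..b, q.eval x * w.eval x := by
  simp only [eval_sub, sub_mul]
  exact intervalIntegral.integral_sub (intervalIntegrable_eval_mul _ _ _ _)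
    (intervalIntegrable_eval_mul _ _ _ _)

theorem integral_correctedInterp_mul (hab : a < b) (fl : Flux) {k : ℕ} (l : ℕ) {w : ℕ → ℝ → ℝ}
    (hw : ContinuousOn (w 0) (Set.Icc a b)) {φ : ℝ[X]} (hφ : φ.natDegree ≤ k) :
    ∫ x in a..b, (correctedInterp fl k l a b w).eval x * φ.eval x =
      (∫ x in a..b, w 0 x * φ.eval x) - correctionMoment fl k (l + 1) a b w φ := by
  have h1 := integral_mul_sub_radau fl hab hw hφ
  rw [correctedInterp, integral_sub_eval_mul, integral_sum_smul_mul, correctionMoment,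
    Finset.sum_range_succ']
  simp only [pow_zero, one_mul, chainCoef, Function.iterate_zero, id, corr] at h1 ⊢
  linarith

/-- Subtracting the remainder removes the last of the l + 1 moments. What is left are the l moments
that also arise from the weak derivative in `integral_sub_correctionMoment`. -/
theorem integral_correctedInterp_sub_remainder_mul (hab : a < b) (fl : Flux) {k : ℕ} (l : ℕ)
    {w : ℕ → ℝ → ℝ} (hw : ContinuousOn (w 0) (Set.Icc a b)) {φ : ℝ[X]} (hφ : φ.natDegree ≤ k) :
    ∫ x in a..b, (correctedInterp fl k l a b w - remainder fl k l a b w).eval x * φ.eval x =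
      (∫ x in a..b, w 0 x * φ.eval x) - correctionMoment fl k l a b w φ := by
  rw [integral_sub_eval_mul, integral_correctedInterp_mul hab fl l hw hφ, remainder,
    integral_smul_eval_mul, correctionMoment, correctionMoment, Finset.sum_range_succ]
  ring

theorem integral_deriv_mul_eval (hab : a ≤ b) {f g : ℝ → ℝ} (hg : ContinuousOn g (Set.Icc a b))
    (hf : ∀ x ∈ Set.Icc a b, HasDerivWithinAt f (g x) (Set.Icc a b) x) (φ : ℝ[X]) :
    ∫ x in a..b, g x * φ.eval x =
      f b * φ.eval b - f a * φ.eval a - ∫ x in a..b, f x * φ.derivative.eval x := by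
  have hfc : ContinuousOn f (Set.Icc a b) := fun x hx => (hf x hx).continuousWithinAt
  have h := integral_eq_sub_of_hasDerivWithinAt_Icc (f := fun x => f x * φ.eval x)
    (g := fun x => g x * φ.eval x + f x * φ.derivative.eval x) hab
    ((hg.mul φ.continuous.continuousOn).add (hfc.mul φ.derivative.continuous.continuousOn))
    fun x hx => (hf x hx).mul (φ.hasDerivAt x).hasDerivWithinAt
  rw [intervalIntegral.integral_add (intervalIntegrable_mul_eval hab hg φ)
    (intervalIntegrable_mul_eval hab hfc _)] at h
  linarith

/-- φ' has degree below k, so the Radau part may be replaced by w 0 and integrated by parts. Each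
correction tested with φ' becomes the preceding function, with opposite flux, tested with φ; its
factor 2/(b-a) cancels one power of (b-a)/2. Thus the weak derivative of the interpolant of w 0
equals w 1 up to exactly the moments of the interpolant of w 1 without its last one. -/
theorem integral_sub_correctionMoment (hab : a < b) (fl : Flux) {k l : ℕ} (hlk : l ≤ k)
    {w : ℕ → ℝ → ℝ} (hw1 : ContinuousOn (w 1) (Set.Icc a b))
    (hw : ∀ x ∈ Set.Icc a b, HasDerivWithinAt (w 0) (w 1 x) (Set.Icc a b) x) {φ : ℝ[X]}
    (hφ : φ.natDegree ≤ k) :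
    (∫ x in a..b, w 1 x * φ.eval x) -
        correctionMoment fl.flip k l a b (fun n => w (n + 1)) φ =
      -(∫ x in a..b, (correctedInterp fl k l a b w).eval x * φ.derivative.eval x) +
        w 0 b * φ.eval b - w 0 a * φ.eval a := by
  have hw0 : ContinuousOn (w 0) (Set.Icc a b) := fun x hx => (hw x hx).continuousWithinAt
  have horth : ∫ x in a..b, (radau fl k a b (w 0)).eval x * φ.derivative.eval x =
      ∫ x in a..b, w 0 x * φ.derivative.eval x := by
    rcases Nat.eq_zero_or_pos φ.natDegree with h0 | h0
    · rw [eq_C_of_natDegree_eq_zero h0]; simp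
    · refine (isGaussRadau_radau fl k hab hw0).2.1 _ ?_
      refine (degree_derivative_lt fun h => ?_).trans_le (degree_le_natDegree.trans (by
        exact_mod_cast hφ))
      rw [h, natDegree_zero] at h0
      exact h0.false
  have hsum : ∀ n ∈ Finset.range l, ((b - a) / 2) ^ (n + 1) * chainCoef fl k a b w (n + 1) *
      (∫ x in a..b, (corr k a b (n + 1) fl).eval x * φ.derivative.eval x) =
      -(((b - a) / 2) ^ n * chainCoef fl.flip k a b (fun n => w (n + 1)) n *
        ∫ x in a..b, (corr k a b n fl.flip).eval x * φ.eval x) := fun n hn => by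
    rw [integral_corr_succ_mul_derivative hab (by have := Finset.mem_range.mp hn; omega) fl hφ]
    have hba : b - a ≠ 0 := (sub_pos.mpr hab).ne'
    simp only [chainCoef, Function.iterate_succ_apply, pow_succ]
    field_simp
  rw [integral_deriv_mul_eval hab.le hw1 hw, correctedInterp, integral_sub_eval_mul, horth,
    integral_sum_smul_mul, Finset.sum_congr rfl hsum, Finset.sum_neg_distrib, correctionMoment]
  ring

theorem remainder_sub (hab : a < b) (fl : Flux) (k l : ℕ) {w w' : ℕ → ℝ → ℝ}
    (hw : ContinuousOn (w l) (Set.Icc a b)) (hw' : ContinuousOn (w' l) (Set.Icc a b)) :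
    remainder fl k l a b w - remainder fl k l a b w' =
      remainder fl k l a b fun n x => w n x - w' n x := by
  rw [remainder, remainder, remainder, ← sub_smul]
  congr 1
  rw [chainCoef, chainCoef, chainCoef, coef_sub _ _ hab.le hw hw']
  ring

end Cell

/-! ## Derivatives in time -/

section Time

variable {a b : ℝ}

theorem HeatRegular.hasDerivWithinAt_integral_eval {p : ℕ} {T U : ℝ} {v : ℕ → ℝ → ℝ → ℝ}
    (h : HeatRegular p 0 T U v) {n : ℕ} (hn : n + 2 ≤ p) (hab : a ≤ b)
    (hsub : Set.Icc a b ⊆ Dom) (φ : ℝ[X]) {s : ℝ} (hs : s ∈ Set.Icc 0 T) :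
    HasDerivWithinAt (fun s => ∫ x in a..b, v n x s * φ.eval x)
      (∫ x in a..b, v (n + 2) x s * φ.eval x) (Set.Icc 0 T) s :=
  hasDerivWithinAt_integral_space (f := fun x s => v n x s * φ.eval x)
    (g := fun x s => v (n + 2) x s * φ.eval x) hab
    (fun s hs => ((h.continuous_space (by omega) hs).mono hsub).mul φ.continuous.continuousOn)
    (((h.continuousOn hn).mono (Set.prod_mono_left hsub)).mul
      (φ.continuous.comp continuous_fst).continuousOn)
    (fun x hx s hs => (h.deriv_time n hn x (hsub hx) s hs).mul_const _) hs

theorem eq_sum_eval_smul_basis {k : ℕ} {p : ℝ[X]} (hp : p.natDegree ≤ k) :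
    p = ∑ i ∈ Finset.range (k + 1),
      p.eval (i : ℝ) • Lagrange.basis (Finset.range (k + 1)) (fun i : ℕ => (i : ℝ)) i := by
  have h := Lagrange.eq_interpolate (s := Finset.range (k + 1)) (v := fun i : ℕ => (i : ℝ)) (f := p)
    (Nat.cast_injective.injOn) (by
      rw [Finset.card_range]
      exact degree_le_natDegree.trans_lt (by exact_mod_cast Nat.lt_succ_of_le hp))
  rw [Lagrange.interpolate_apply] at h
  simp only [smul_eq_C_mul]
  exact h

/-- Polynomials of bounded degree are determined by their values at 0, …, k, so every linear
functional is a fixed finite combination of evaluations. This passes from pointwise time derivatives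
of u_h to those of its moments. -/
theorem hasDerivWithinAt_linearMap_of_eval (Λ : ℝ[X] →ₗ[ℝ] ℝ) {k : ℕ} {p : ℝ → ℝ[X]} {p' : ℝ[X]}
    {S : Set ℝ} {t : ℝ} (ht : t ∈ S) (hp : ∀ s ∈ S, (p s).natDegree ≤ k) (hp' : p'.natDegree ≤ k)
    (h : ∀ x, HasDerivWithinAt (fun s => (p s).eval x) (p'.eval x) S t) :
    HasDerivWithinAt (fun s => Λ (p s)) (Λ p') S t := by
  have h1 : ∀ q : ℝ[X], q.natDegree ≤ k → Λ q = ∑ i ∈ Finset.range (k + 1), q.eval (i : ℝ) *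
      Λ (Lagrange.basis (Finset.range (k + 1)) (fun i : ℕ => (i : ℝ)) i) := fun q hq => by
    conv_lhs => rw [eq_sum_eval_smul_basis hq]
    simp only [map_sum, map_smul, smul_eq_mul]
  rw [h1 p' hp']
  refine HasDerivWithinAt.congr ?_ (fun s hs => h1 _ (hp s hs)) (h1 _ (hp t ht))
  exact HasDerivWithinAt.fun_sum fun i _ => (h i).mul_const _

theorem continuousOn_linearMap_of_eval (Λ : ℝ[X] →ₗ[ℝ] ℝ) {k : ℕ} {p : ℝ → ℝ[X]}
    {S : Set ℝ} (hp : ∀ s ∈ S, (p s).natDegree ≤ k)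
    (h : ∀ x, ContinuousOn (fun s => (p s).eval x) S) : ContinuousOn (fun s => Λ (p s)) S := by
  have h1 : ∀ q : ℝ[X], q.natDegree ≤ k → Λ q = ∑ i ∈ Finset.range (k + 1), q.eval (i : ℝ) *
      Λ (Lagrange.basis (Finset.range (k + 1)) (fun i : ℕ => (i : ℝ)) i) := fun q hq => by
    conv_lhs => rw [eq_sum_eval_smul_basis hq]
    simp only [map_sum, map_smul, smul_eq_mul]
  refine ContinuousOn.congr ?_ (fun s hs => h1 _ (hp s hs))
  exact continuousOn_finsetSum _ fun i _ => (h i).mul continuousOn_const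

theorem HeatRegular.hasDerivWithinAt_coef {p : ℕ} {T U : ℝ} {v : ℕ → ℝ → ℝ → ℝ}
    (h : HeatRegular p 0 T U v) {n : ℕ} (hn : n + 2 ≤ p) (fl : Flux) (k : ℕ) (hab : a ≤ b)
    (hsub : Set.Icc a b ⊆ Dom) {s : ℝ} (hs : s ∈ Set.Icc 0 T) :
    HasDerivWithinAt (fun s => coef fl k a b (fun x => v n x s))
      (coef fl k a b (fun x => v (n + 2) x s)) (Set.Icc 0 T) s := by
  simp only [coef_eq]
  refine ((h.deriv_time n hn _ (hsub (fl.endpoint_mem hab)) s hs).const_mul _).add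
    (HasDerivWithinAt.const_mul _ ?_)
  exact h.hasDerivWithinAt_integral_eval hn hab hsub _ hs

theorem HeatRegular.hasDerivWithinAt_correctionMoment {p m : ℕ} {T U : ℝ} {v : ℕ → ℝ → ℝ → ℝ}
    (h : HeatRegular p 0 T U v) (hm : m + 1 ≤ p) (fl : Flux) (k : ℕ) (hab : a ≤ b)
    (hsub : Set.Icc a b ⊆ Dom) (φ : ℝ[X]) {s : ℝ} (hs : s ∈ Set.Icc 0 T) :
    HasDerivWithinAt (fun s => correctionMoment fl k m a b (fun n x => v n x s) φ)
      (correctionMoment fl k m a b (fun n x => v (n + 2) x s) φ) (Set.Icc 0 T) s := by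
  refine HasDerivWithinAt.fun_sum fun n hn => ?_
  exact ((h.hasDerivWithinAt_coef (by have := Finset.mem_range.mp hn; omega) _ k hab hsub
    hs).const_mul _).mul_const _

theorem HeatRegular.iteratedDerivWithin_coef {p : ℕ} {T U : ℝ} {v : ℕ → ℝ → ℝ → ℝ}
    (h : HeatRegular p 0 T U v) (hT : 0 < T) (fl : Flux) (k : ℕ) (hab : a ≤ b)
    (hsub : Set.Icc a b ⊆ Dom) (n i : ℕ) (hn : n + 2 * i ≤ p) {s : ℝ} (hs : s ∈ Set.Icc 0 T) :
    iteratedDerivWithin i (fun s => coef fl k a b (fun x => v n x s)) (Set.Icc 0 T) s =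
      coef fl k a b (fun x => v (n + 2 * i) x s) := by
  induction i generalizing s with
  | zero => simp
  | succ i ih =>
    rw [iteratedDerivWithin_succ, derivWithin_congr (fun s hs => ih (by omega) hs)
      (ih (by omega) hs)]
    exact (h.hasDerivWithinAt_coef (by omega) fl k hab hsub hs).derivWithin
      (uniqueDiffOn_Icc hT s hs)

end Time

/-! ## Error equations -/

section ErrorEquations

variable {N : ℕ}

/-- The corrected interpolant on a mesh. -/
def meshInterp (M : Mesh N) (fl : Flux) (k l : ℕ) (w : ℕ → ℝ → ℝ) (j : Fin N) : ℝ[X] :=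
  correctedInterp fl k l (M.left j) (M.right j) w

/-- The consistency error of the corrected interpolant on a mesh. -/
def meshRemainder (M : Mesh N) (fl : Flux) (k l : ℕ) (w : ℕ → ℝ → ℝ) (j : Fin N) : ℝ[X] :=
  remainder fl k l (M.left j) (M.right j) w

theorem meshInterp_mem (M : Mesh N) (fl : Flux) (k l : ℕ) {w : ℕ → ℝ → ℝ}
    (hw : ContinuousOn (w 0) Dom) : meshInterp M fl k l w ∈ feSpace N k := fun j =>
  natDegree_correctedInterp_le (M.left_lt_right j) fl k l (hw.mono (M.cell_subset_Dom j))

theorem meshRemainder_mem (M : Mesh N) (fl : Flux) (k l : ℕ) (w : ℕ → ℝ → ℝ) :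
    meshRemainder M fl k l w ∈ feSpace N k := fun j =>
  natDegree_remainder_le (M.left_lt_right j) fl k l w

theorem sub_mem_feSpace {k : ℕ} {v w : Fin N → ℝ[X]} (hv : v ∈ feSpace N k)
    (hw : w ∈ feSpace N k) : v - w ∈ feSpace N k := fun j =>
  (natDegree_sub_le_of_le (hv j) (hw j)).trans (max_self k).le

theorem cellForm_sub (M : Mesh N) (p q : Fin N → ℝ[X]) (P Q : Fin (N + 1) → ℝ)
    (v : Fin N → ℝ[X]) (j : Fin N) :
    cellForm M (p - q) (fun i => P i - Q i) v j = cellForm M p P v j - cellForm M q Q v j := by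
  simp only [cellForm, Pi.sub_apply, integral_sub_eval_mul]
  ring

theorem cellForm_meshInterp (M : Mesh N) (fl : Flux) {k l : ℕ} (hlk : l ≤ k) {w : ℕ → ℝ → ℝ}
    (hw1 : ContinuousOn (w 1) Dom) (hw : ∀ x ∈ Dom, HasDerivWithinAt (w 0) (w 1 x) Dom x)
    {φ : Fin N → ℝ[X]} (hφ : φ ∈ feSpace N k) (j : Fin N) :
    cellForm M (meshInterp M fl k l w) (fun i => w 0 (M.node i)) φ j =
      (∫ x in M.left j..M.right j, w 1 x * (φ j).eval x) -
        correctionMoment fl.flip k l (M.left j) (M.right j) (fun n => w (n + 1)) (φ j) :=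
  (integral_sub_correctionMoment (M.left_lt_right j) fl hlk (hw1.mono (M.cell_subset_Dom j))
    (fun x hx => (hw x (M.cell_subset_Dom j hx)).mono (M.cell_subset_Dom j)) (hφ j)).symm

/-- Since the interpolant matches w 0 where the flux is taken, its homogeneous flux minus that of wh
is the nodal value of w 0 minus the flux of wh with the actual boundary data. -/
theorem derivForm_meshInterp_sub (M : Mesh N) {fl : Flux} {bc : Boundary} {t : ℝ} {k l : ℕ}
    (hlk : l ≤ k) {w : ℕ → ℝ → ℝ} (hw1 : ContinuousOn (w 1) Dom)
    (hw : ∀ x ∈ Dom, HasDerivWithinAt (w 0) (w 1 x) Dom x) (hbc : HasBoundaryValue fl bc t (w 0))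
    {φ : Fin N → ℝ[X]} (hφ : φ ∈ feSpace N k) (wh : Fin N → ℝ[X]) :
    derivForm M fl bc (meshInterp M fl k l w - wh) φ =
      ∑ j, ((∫ x in M.left j..M.right j, w 1 x * (φ j).eval x) -
        correctionMoment fl.flip k l (M.left j) (M.right j) (fun n => w (n + 1)) (φ j) -
        cellForm M wh (fluxU M fl bc t wh) φ j) := by
  have hw0 : ContinuousOn (w 0) Dom := fun x hx => (hw x hx).continuousWithinAt
  rw [derivForm_apply]
  refine Finset.sum_congr rfl fun j _ => ?_
  rw [← cellForm_meshInterp M fl hlk hw1 hw hφ, ← cellForm_sub]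
  congr 1
  funext i
  exact (sub_fluxU_eq M hbc (fun j => correctedInterp_eval_endpoint (M.left_lt_right j) fl hlk
    (hw0.mono (M.cell_subset_Dom j))) wh i).symm

variable {k l : ℕ} {T U : ℝ} {v : ℕ → ℝ → ℝ → ℝ} {M : Mesh N} {fl : Flux} {bc : Boundary}
  {uh qh : ℝ → Fin N → ℝ[X]}

/-- Both q_I minus its remainder and the weak derivative of u_I equal v 1 minus the same moments;
the scheme is subtracted. -/
theorem IsLDGSolution.feCoord_q_error (hsol : IsLDGSolution M k fl bc T uh qh) (hlk : l ≤ k)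
    (hl : 1 ≤ l) (h : HeatRegular (k + l + 1) 0 T U v) {s : ℝ} (hs : s ∈ Set.Icc 0 T)
    (hbc : HasBoundaryValue fl bc s (fun x => v 0 x s)) :
    feCoord M k (meshInterp M fl.flip k l (fun n x => v (n + 1) x s) - qh s) =
      discreteDeriv M k fl bc (feCoord M k (meshInterp M fl k l (fun n x => v n x s) - uh s)) +
        feCoord M k (meshRemainder M fl.flip k l fun n x => v (n + 1) x s) := by
  have hc0 := h.continuous_space (i := 0) (by omega) hs
  have hc1 := h.continuous_space (i := 1) (by omega) hs
  ext i
  rw [PiLp.add_apply, discreteDeriv_feCoord_apply M fl bc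
    (sub_mem_feSpace (meshInterp_mem M fl k l hc0) (hsol.uh_mem s hs)),
    derivForm_meshInterp_sub M hlk (w := fun n x => v n x s) hc1 (h.deriv_space 0 (by omega) s hs)
      hbc (feBasis_mem M k i),
    ← sub_eq_iff_eq_add, feCoord_apply, feCoord_apply, l2Inner, l2Inner, ← Finset.sum_sub_distrib]
  refine Finset.sum_congr rfl fun j _ => ?_
  have h1 := integral_correctedInterp_sub_remainder_mul (M.left_lt_right j) fl.flip l
    (w := fun n x => v (n + 1) x s) (hc1.mono (M.cell_subset_Dom j)) (feBasis_mem M k i j)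
  have h2 : ∫ x in M.left j..M.right j, (qh s j).eval x * (feBasis M k i j).eval x =
    cellForm M (uh s) (fluxU M fl bc s (uh s)) (feBasis M k i) j :=
    hsol.eq_q s hs _ (feBasis_mem M k i) j
  rw [integral_sub_eval_mul] at h1
  rw [Pi.sub_apply, integral_sub_eval_mul, h2, ← h1]
  simp only [meshInterp, meshRemainder]
  ring

theorem l2Inner_shifted_error (h : HeatRegular (k + l + 1) 0 T U v) {s : ℝ} (hs : s ∈ Set.Icc 0 T)
    {φ : Fin N → ℝ[X]} (hφ : φ ∈ feSpace N k) (w : Fin N → ℝ[X]) :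
    l2Inner M (meshInterp M fl k l (fun n x => v n x s) -
        meshRemainder M fl k l (fun n x => v n x s) - w) φ =
      ∑ j, ((∫ x in M.left j..M.right j, v 0 x s * (φ j).eval x) -
        correctionMoment fl k l (M.left j) (M.right j) (fun n x => v n x s) (φ j) -
        ∫ x in M.left j..M.right j, (w j).eval x * (φ j).eval x) := by
  have hc0 := h.continuous_space (i := 0) (by omega) hs
  refine Finset.sum_congr rfl fun j _ => ?_
  have h1 := integral_correctedInterp_sub_remainder_mul (M.left_lt_right j) fl l
    (w := fun n x => v n x s) (hc0.mono (M.cell_subset_Dom j)) (hφ j)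
  rw [Pi.sub_apply, integral_sub_eval_mul, ← h1]
  rfl

/-- Integration against `φ` over an interval. -/
def integralAgainst (a b : ℝ) (φ : ℝ[X]) : ℝ[X] →ₗ[ℝ] ℝ where
  toFun p := ∫ x in a..b, p.eval x * φ.eval x
  map_add' p q := integral_add_eval_mul p q φ a b
  map_smul' c p := integral_smul_eval_mul c p φ a b

theorem IsLDGSolution.continuousOn_shifted_error (hsol : IsLDGSolution M k fl bc T uh qh)
    (hl : 1 ≤ l) (h : HeatRegular (k + l + 1) 0 T U v) :
    ContinuousOn (fun s => feCoord M k (meshInterp M fl k l (fun n x => v n x s) - uh s) -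
      feCoord M k (meshRemainder M fl k l (fun n x => v n x s))) (Set.Icc 0 T) := by
  have hmain : ∀ i, ContinuousOn (fun s => l2Inner M (meshInterp M fl k l (fun n x => v n x s) -
      meshRemainder M fl k l (fun n x => v n x s) - uh s) (feBasis M k i)) (Set.Icc 0 T) :=
    fun i => by
      refine ContinuousOn.congr ?_ fun s hs => l2Inner_shifted_error h hs (feBasis_mem M k i) _
      refine continuousOn_finsetSum _ fun j _ => ContinuousOn.sub (ContinuousOn.sub ?_ ?_) ?_
      · exact fun s hs => (h.hasDerivWithinAt_integral_eval (by omega) (M.left_lt_right j).le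
          (M.cell_subset_Dom j) _ hs).continuousWithinAt
      · exact fun s hs => (h.hasDerivWithinAt_correctionMoment (by omega) fl k
          (M.left_lt_right j).le (M.cell_subset_Dom j) _ hs).continuousWithinAt
      · exact continuousOn_linearMap_of_eval (integralAgainst _ _ _)
          (fun s hs => hsol.uh_mem s hs j) (hsol.continuous_uh j)
  have h2 : ContinuousOn (fun s => feCoord M k (meshInterp M fl k l (fun n x => v n x s) -
      meshRemainder M fl k l (fun n x => v n x s) - uh s)) (Set.Icc 0 T) :=
    (PiLp.continuous_toLp 2 _).comp_continuousOn (continuousOn_pi.mpr hmain)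
  refine h2.congr fun s _ => ?_
  simp only [map_sub]
  abel

/-- After subtraction of the remainder only moments of v 0 and coefficients of v n with n < l are
left, and these can be differentiated in time with the regularity available. The time derivative
shifts the family by two, and this is again the weak derivative of the interpolant of v 1. -/
theorem IsLDGSolution.hasDerivWithinAt_shifted_error (hsol : IsLDGSolution M k fl bc T uh qh)
    (hlk : l ≤ k) (hl : 1 ≤ l) (h : HeatRegular (k + l + 1) 0 T U v) {s : ℝ}
    (hs : s ∈ Set.Ioc 0 T) (hbc : HasBoundaryValue fl.flip bc s (fun x => v 1 x s)) :
    HasDerivWithinAt (fun s => feCoord M k (meshInterp M fl k l (fun n x => v n x s) - uh s) -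
        feCoord M k (meshRemainder M fl k l (fun n x => v n x s)))
      (-(ContinuousLinearMap.adjoint (discreteDeriv M k fl bc)
        (feCoord M k (meshInterp M fl.flip k l (fun n x => v (n + 1) x s) - qh s))))
      (Set.Icc 0 T) s := by
  have hs' : s ∈ Set.Icc 0 T := ⟨hs.1.le, hs.2⟩
  have hc1 := h.continuous_space (i := 1) (by omega) hs'
  have hc2 := h.continuous_space (i := 2) (by omega) hs'
  obtain ⟨uht, huht, hder, heq⟩ := hsol.eq_u s hs
  have hmain : ∀ i, HasDerivWithinAt (fun s => l2Inner M
      (meshInterp M fl k l (fun n x => v n x s) -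
        meshRemainder M fl k l (fun n x => v n x s) - uh s) (feBasis M k i))
      (-(ContinuousLinearMap.adjoint (discreteDeriv M k fl bc)
        (feCoord M k (meshInterp M fl.flip k l (fun n x => v (n + 1) x s) - qh s))) i)
      (Set.Icc 0 T) s := fun i => by
    rw [adjoint_discreteDeriv_feCoord_apply M fl bc (sub_mem_feSpace
      (meshInterp_mem M fl.flip k l hc1) (hsol.qh_mem s hs')), neg_neg,
      derivForm_meshInterp_sub M hlk (w := fun n x => v (n + 1) x s) hc2
        (h.deriv_space 1 (by omega) s hs') hbc (feBasis_mem M k i), Flux.flip_flip]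
    refine HasDerivWithinAt.congr ?_ (fun s hs => l2Inner_shifted_error h hs (feBasis_mem M k i) _)
      (l2Inner_shifted_error h hs' (feBasis_mem M k i) _)
    refine HasDerivWithinAt.fun_sum fun j _ => HasDerivWithinAt.sub (HasDerivWithinAt.sub ?_ ?_) ?_
    · exact h.hasDerivWithinAt_integral_eval (n := 0) (by omega) (M.left_lt_right j).le
        (M.cell_subset_Dom j) _ hs'
    · exact h.hasDerivWithinAt_correctionMoment (by omega) fl k
        (M.left_lt_right j).le (M.cell_subset_Dom j) _ hs'
    · have h1 : ∫ x in M.left j..M.right j, (uht j).eval x * (feBasis M k i j).eval x =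
        cellForm M (qh s) (fluxQ M fl bc s (qh s)) (feBasis M k i) j :=
        heq _ (feBasis_mem M k i) j
      rw [← fluxQ_eq_fluxU_flip, ← h1]
      exact hasDerivWithinAt_linearMap_of_eval (integralAgainst _ _ _) hs'
        (fun s hs => hsol.uh_mem s hs j) (huht j) (hder j)
  have h2 : HasDerivWithinAt (fun s => feCoord M k (meshInterp M fl k l (fun n x => v n x s) -
      meshRemainder M fl k l (fun n x => v n x s) - uh s))
      (-(ContinuousLinearMap.adjoint (discreteDeriv M k fl bc)
        (feCoord M k (meshInterp M fl.flip k l (fun n x => v (n + 1) x s) - qh s))))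
      (Set.Icc 0 T) s := by
    rw [hasDerivWithinAt_iff_hasFDerivWithinAt, hasFDerivWithinAt_euclidean]
    intro i
    refine (hmain i).hasFDerivWithinAt.congr_fderiv ?_
    ext
    simp
  have h3 : ∀ s, feCoord M k (meshInterp M fl k l (fun n x => v n x s) - uh s) -
      feCoord M k (meshRemainder M fl k l (fun n x => v n x s)) =
      feCoord M k (meshInterp M fl k l (fun n x => v n x s) -
        meshRemainder M fl k l (fun n x => v n x s) - uh s) := fun s => by
    simp only [map_sub]
    abel
  simpa only [h3] using h2

end ErrorEquations

end LDG
end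

noncomputable section

namespace LDG

variable {N : ℕ}

/-! ## The interpolants of the statement -/

section Interpolants

variable {k : ℕ} {a b : ℝ}

theorem F₁_eq_corr (k : ℕ) (a b : ℝ) (i : ℕ) :
    F₁ k a b (i + 1) = corr k a b (2 * i + 1) .plusMinus := by
  induction i with
  | zero => rfl
  | succ i ih =>
    have h : F₁ k a b (i + 1 + 1) = stepPlus k a b (stepMinus k a b (F₁ k a b (i + 1))) := by
      simp only [F₁, Nat.add_sub_cancel]
      exact Function.iterate_succ_apply' _ _ _
    rw [h, ih]
    rfl

theorem F₂_eq_corr (k : ℕ) (a b : ℝ) (i : ℕ) :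
    F₂ k a b (i + 1) = corr k a b (2 * i + 1) .minusPlus := by
  induction i with
  | zero => rfl
  | succ i ih =>
    have h : F₂ k a b (i + 1 + 1) = stepMinus k a b (stepPlus k a b (F₂ k a b (i + 1))) := by
      simp only [F₂, Nat.add_sub_cancel]
      exact Function.iterate_succ_apply' _ _ _
    rw [h, ih]
    rfl

theorem Fbar₁_eq_corr (k : ℕ) (a b : ℝ) (i : ℕ) :
    Fbar₁ k a b (i + 1) = corr k a b (2 * i + 2) .minusPlus := by
  rw [Fbar₁, F₁_eq_corr]; rfl

theorem Fbar₂_eq_corr (k : ℕ) (a b : ℝ) (i : ℕ) :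
    Fbar₂ k a b (i + 1) = corr k a b (2 * i + 2) .plusMinus := by
  rw [Fbar₂, F₂_eq_corr]; rfl

theorem sum_odd_add_sum_even (l : ℕ) (G : ℕ → ℝ[X]) :
    ∑ i ∈ Finset.range ((l + 1) / 2), G (2 * i + 1) + ∑ i ∈ Finset.range (l / 2), G (2 * i + 2) =
      ∑ n ∈ Finset.range l, G (n + 1) := by
  induction l with
  | zero => simp
  | succ l ih =>
    rw [Finset.sum_range_succ, ← ih]
    rcases Nat.even_or_odd' l with ⟨c, rfl | rfl⟩
    · rw [show (2 * c + 1 + 1) / 2 = c + 1 by omega, show (2 * c + 1) / 2 = c by omega,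
        show 2 * c / 2 = c by omega, Finset.sum_range_succ]
      abel
    · rw [show (2 * c + 1 + 1 + 1) / 2 = c + 1 by omega, show (2 * c + 1 + 1) / 2 = c + 1 by omega,
        show (2 * c + 1) / 2 = c by omega, Finset.sum_range_succ _ c, Finset.sum_range_succ _ c]
      abel

theorem sum_Icc_one_eq (m : ℕ) (G : ℕ → ℝ[X]) :
    ∑ i ∈ Finset.Icc 1 m, G i = ∑ i ∈ Finset.range m, G (i + 1) := by
  induction m with
  | zero => simp
  | succ m ih => rw [Finset.sum_Icc_succ_top (by omega), ih, Finset.sum_range_succ]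

/-- The two sums of the statement are the odd and the even terms of one chain of corrections of
length l. -/
theorem correctionSum_eq {l : ℕ} {A : ℕ → ℝ} {F : ℕ → ℝ[X]} {B : ℕ → ℝ} {Fbar : ℕ → ℝ[X]}
    {c : ℕ → ℝ} {P : ℕ → ℝ[X]} (hA : ∀ i, 2 * i + 1 ≤ l → A (i + 1) = c (2 * i + 1))
    (hF : ∀ i, F (i + 1) = P (2 * i + 1)) (hB : ∀ i, 2 * i + 2 ≤ l → B (i + 1) = c (2 * i + 2))
    (hFbar : ∀ i, Fbar (i + 1) = P (2 * i + 2)) :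
    correctionSum l a b A F B Fbar =
      ∑ n ∈ Finset.range l, (((b - a) / 2) ^ (n + 1) * c (n + 1)) • P (n + 1) := by
  rw [← sum_odd_add_sum_even l fun n => (((b - a) / 2) ^ n * c n) • P n, correctionSum,
    sum_Icc_one_eq, sum_Icc_one_eq]
  congr 1
  · refine Finset.sum_congr rfl fun i hi => ?_
    have := Finset.mem_range.mp hi
    rw [hA i (by omega), hF, smul_eq_C_mul]
    rfl
  · refine Finset.sum_congr rfl fun i hi => ?_
    have := Finset.mem_range.mp hi
    rw [hB i (by omega), hFbar, smul_eq_C_mul]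
    rfl

theorem flip_iterate_even (fl : Flux) (i : ℕ) : Flux.flip^[2 * i] fl = fl := by
  rw [Function.Involutive.iterate_two_mul Flux.flip_flip]; rfl

variable {l : ℕ} {fl : Flux} {T U : ℝ} {u : ℝ → ℝ → ℝ}

/-- The classical space derivatives. -/
def spaceDerivs (u : ℝ → ℝ → ℝ) (i : ℕ) (x s : ℝ) : ℝ :=
  iteratedDerivWithin i (fun y => u y s) Dom x

theorem spaceDerivs_zero (u : ℝ → ℝ → ℝ) : spaceDerivs u 0 = u := by
  funext x s
  simp [spaceDerivs]

theorem spaceDerivs_one (u : ℝ → ℝ → ℝ) : spaceDerivs u 1 = spaceDeriv u := by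
  funext x s
  rw [spaceDerivs, iteratedDerivWithin_one, spaceDeriv]

theorem coefG_eq (h : HeatRegular (k + l + 1) 0 T U (spaceDerivs u)) (hT : 0 < T) (fl : Flux)
    (hab : a ≤ b) (hsub : Set.Icc a b ⊆ Dom) {i : ℕ} (hi : 2 * i ≤ k + l + 1) {t : ℝ}
    (ht : t ∈ Set.Icc 0 T) :
    coefG fl k a b T u t i = coef fl k a b (fun x => spaceDerivs u (2 * i) x t) := by
  have h1 := h.iteratedDerivWithin_coef hT fl k hab hsub 0 i (by omega) ht
  rw [zero_add, spaceDerivs_zero] at h1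
  rw [← h1]
  cases fl <;> rfl

theorem coefQ_eq (h : HeatRegular (k + l + 1) 0 T U (spaceDerivs u)) (hT : 0 < T) (fl : Flux)
    (hab : a ≤ b) (hsub : Set.Icc a b ⊆ Dom) {i : ℕ} (hi : 1 + 2 * i ≤ k + l + 1) {t : ℝ}
    (ht : t ∈ Set.Icc 0 T) :
    coefQ fl k a b T u t i = coef fl.flip k a b (fun x => spaceDerivs u (1 + 2 * i) x t) := by
  have h1 := h.iteratedDerivWithin_coef hT fl.flip k hab hsub 1 i (by omega) ht
  rw [spaceDerivs_one] at h1
  rw [← h1]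
  cases fl <;> rfl

theorem W₂_eq (h : HeatRegular (k + l + 1) 0 T U (spaceDerivs u)) (hT : 0 < T) (fl : Flux)
    (hab : a ≤ b) (hsub : Set.Icc a b ⊆ Dom) {t : ℝ} (ht : t ∈ Set.Icc 0 T) :
    W₂ fl k l a b T u t = ∑ n ∈ Finset.range l, (((b - a) / 2) ^ (n + 1) *
      chainCoef fl k a b (fun n x => spaceDerivs u n x t) (n + 1)) • corr k a b (n + 1) fl := by
  -- Odd corrections of u carry Q_{i-1}, which by q = u_x and the heat equation is a coefficient of
  -- the space derivative of order 2i - 1; with the index shifted to i + 1 the order is 2i + 1.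
  have hA : ∀ i, 2 * i + 1 ≤ l → coefQ fl k a b T u t (i + 1 - 1) =
      chainCoef fl k a b (fun n x => spaceDerivs u n x t) (2 * i + 1) := fun i hi => by
    rw [Nat.add_sub_cancel, coefQ_eq h hT fl hab hsub (by omega) ht, chainCoef,
      Function.iterate_succ_apply, flip_iterate_even, add_comm 1]
  have hB : ∀ i, 2 * i + 2 ≤ l → coefG fl k a b T u t (i + 1) =
      chainCoef fl k a b (fun n x => spaceDerivs u n x t) (2 * i + 2) := fun i hi => by
    rw [coefG_eq h hT fl hab hsub (by omega) ht, chainCoef, show 2 * i + 2 = 2 * (i + 1) by ring,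
      flip_iterate_even]
  cases fl
  · exact correctionSum_eq (P := fun n => corr k a b n .minusPlus)
      (A := fun i => coefQ .minusPlus k a b T u t (i - 1)) hA (F₂_eq_corr k a b) hB
      (Fbar₁_eq_corr k a b)
  · exact correctionSum_eq (P := fun n => corr k a b n .plusMinus)
      (A := fun i => coefQ .plusMinus k a b T u t (i - 1)) hA (F₁_eq_corr k a b) hB
      (Fbar₂_eq_corr k a b)

theorem W₁_eq (h : HeatRegular (k + l + 1) 0 T U (spaceDerivs u)) (hT : 0 < T) (fl : Flux)
    (hab : a ≤ b) (hsub : Set.Icc a b ⊆ Dom) {t : ℝ} (ht : t ∈ Set.Icc 0 T) :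
    W₁ fl k l a b T u t = ∑ n ∈ Finset.range l, (((b - a) / 2) ^ (n + 1) *
      chainCoef fl.flip k a b (fun n x => spaceDerivs u (n + 1) x t) (n + 1)) •
        corr k a b (n + 1) fl.flip := by
  have hA : ∀ i, 2 * i + 1 ≤ l → coefG fl k a b T u t (i + 1) =
      chainCoef fl.flip k a b (fun n x => spaceDerivs u (n + 1) x t) (2 * i + 1) := fun i hi => by
    rw [coefG_eq h hT fl hab hsub (by omega) ht, chainCoef,
      Function.iterate_succ_apply, flip_iterate_even, Flux.flip_flip]
    rfl
  have hB : ∀ i, 2 * i + 2 ≤ l → coefQ fl k a b T u t (i + 1) =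
      chainCoef fl.flip k a b (fun n x => spaceDerivs u (n + 1) x t) (2 * i + 2) := fun i hi => by
    rw [coefQ_eq h hT fl hab hsub (by omega) ht, chainCoef, show 2 * i + 2 = 2 * (i + 1) by ring,
      flip_iterate_even, add_comm 1]
  cases fl
  · exact correctionSum_eq (P := fun n => corr k a b n .plusMinus) hA (F₁_eq_corr k a b) hB
      (Fbar₂_eq_corr k a b)
  · exact correctionSum_eq (P := fun n => corr k a b n .minusPlus) hA (F₂_eq_corr k a b) hB
      (Fbar₁_eq_corr k a b)

theorem interpU_eq (h : HeatRegular (k + l + 1) 0 T U (spaceDerivs u)) (hT : 0 < T) (M : Mesh N)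
    (fl : Flux) {t : ℝ} (ht : t ∈ Set.Icc 0 T) :
    interpU M fl k l T u t = meshInterp M fl k l fun n x => spaceDerivs u n x t := by
  funext j
  have h0 : interpU M fl k l T u t j = radau fl k (M.left j) (M.right j) (fun x => u x t) -
      W₂ fl k l (M.left j) (M.right j) T u t := by cases fl <;> rfl
  rw [h0, W₂_eq h hT fl (M.left_lt_right j).le (M.cell_subset_Dom j) ht, meshInterp,
    correctedInterp, spaceDerivs_zero]

theorem interpQ_eq (h : HeatRegular (k + l + 1) 0 T U (spaceDerivs u)) (hT : 0 < T) (M : Mesh N)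
    (fl : Flux) {t : ℝ} (ht : t ∈ Set.Icc 0 T) :
    interpQ M fl k l T u t =
      meshInterp M fl.flip k l fun n x => spaceDerivs u (n + 1) x t := by
  funext j
  have h0 : interpQ M fl k l T u t j = radau fl.flip k (M.left j) (M.right j) (fun x => spaceDeriv u x t) -
      W₁ fl k l (M.left j) (M.right j) T u t := by cases fl <;> rfl
  rw [h0, W₁_eq h hT fl (M.left_lt_right j).le (M.cell_subset_Dom j) ht, meshInterp,
    correctedInterp, spaceDerivs_one]

end Interpolants

/-! ## Bounds for the consistency errors -/

theorem Mesh.size_nonneg (M : Mesh N) : 0 ≤ M.size :=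
  Real.iSup_nonneg fun j => (M.cellSize_pos j).le

/-- On a cell the remainder is at most a constant times h_j^{k+l} √(h_j κ_j), and its L² norm gains
another √h_j. The quantity κ_j is kept general: it is U² h_j for a Lipschitz bound, an integral of a
squared derivative, or a squared oscillation over h_j. -/
theorem exists_meshRemainder_bound (k l : ℕ) : ∃ K : ℝ, 0 < K ∧
    ∀ (N : ℕ) (M : Mesh N) (fl : Flux) (w : ℕ → ℝ → ℝ) (κ : Fin N → ℝ) (Q : ℝ),
      ContinuousOn (w l) Dom →
      (∀ i < k, ∀ x ∈ Dom, HasDerivWithinAt (w (l + i)) (w (l + i + 1) x) Dom x) →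
      (∀ j, ∀ x ∈ Set.Icc (M.left j) (M.right j),
        (w (l + k) x - w (l + k) (M.left j)) ^ 2 ≤ M.cellSize j * κ j) →
      ∑ j, κ j ≤ Q →
      ‖feCoord M k (meshRemainder M fl k l w)‖ ≤ K * M.size ^ (k + l + 1) * √Q := by
  obtain ⟨K₁, hK₁, h1⟩ := exists_coef_approx k
  obtain ⟨K₂, hK₂, h2⟩ := exists_corr_bound k l
  refine ⟨K₁ * K₂, by positivity, fun N M fl w κ Q hwc hw hκ hQ => ?_⟩
  have hs := M.size_nonneg
  have hκ0 : ∀ j, 0 ≤ κ j := fun j => by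
    have := hκ j _ (Set.left_mem_Icc.mpr (M.left_lt_right j).le)
    exact nonneg_of_mul_nonneg_right ((sq_nonneg _).trans this) (M.cellSize_pos j)
  have hQ0 : 0 ≤ Q := (Finset.sum_nonneg fun j _ => hκ0 j).trans hQ
  rw [← l2Norm_eq_norm M (meshRemainder_mem M fl k l w), l2Norm]
  refine Real.sqrt_le_iff.mpr ⟨by positivity, ?_⟩
  have hterm : ∀ j, ∫ x in M.left j..M.right j, ((meshRemainder M fl k l w j).eval x) ^ 2 ≤
      (K₁ * K₂ * M.size ^ (k + l + 1)) ^ 2 * κ j := fun j => by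
    have hab := M.left_lt_right j
    have hh := M.cellSize_pos j
    have hle := M.cellSize_le_size j
    set c := M.cellSize j with hc
    have hcba : M.right j - M.left j = c := rfl
    have hco : |chainCoef fl k (M.left j) (M.right j) w l| ≤ K₁ * (√(c * κ j) * c ^ k) := by
      have := h1 (Flux.flip^[l] fl) _ _ hab (fun i => w (l + i)) (√(c * κ j))
        (hwc.mono (M.cell_subset_Dom j))
        (fun i hi x hx => (hw i hi x (M.cell_subset_Dom j hx)).mono (M.cell_subset_Dom j))
        (fun x hx => Real.abs_le_sqrt (hκ j x hx))
      rwa [hcba] at this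
    have hpt : ∀ x ∈ Set.Icc (M.left j) (M.right j),
        |(meshRemainder M fl k l w j).eval x| ≤ c ^ l * (K₁ * (√(c * κ j) * c ^ k)) * K₂ :=
      fun x hx => by
        have h3 := h2 fl _ _ hab x hx
        rw [meshRemainder, remainder, eval_smul, smul_eq_mul, abs_mul, abs_neg, abs_mul, hcba,
          abs_of_nonneg (by positivity : 0 ≤ (c / 2) ^ l)]
        have h4 : (c / 2) ^ l ≤ c ^ l := pow_le_pow_left₀ (by positivity) (by linarith) l
        gcongr
    have hint := abs_integral_mul_le hab.le hpt hpt
    simp only [← sq] at hint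
    refine (le_abs_self _).trans (hint.trans ?_)
    rw [hcba]
    calc (c ^ l * (K₁ * (√(c * κ j) * c ^ k)) * K₂) ^ 2 * c =
        (K₁ * K₂) ^ 2 * (c ^ (k + l)) ^ 2 * (√(c * κ j)) ^ 2 * c := by ring
      _ = (K₁ * K₂) ^ 2 * (c ^ (k + l + 1)) ^ 2 * κ j := by
        rw [Real.sq_sqrt (mul_nonneg hh.le (hκ0 j))]; ring
      _ ≤ (K₁ * K₂) ^ 2 * (M.size ^ (k + l + 1)) ^ 2 * κ j := by
        have := hκ0 j
        gcongr
      _ = _ := by ring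
  refine (Finset.sum_le_sum fun j _ => hterm j).trans ?_
  rw [← Finset.mul_sum, mul_pow _ (√Q), Real.sq_sqrt hQ0]
  gcongr

theorem feCoord_meshRemainder_sub (M : Mesh N) (fl : Flux) (k l : ℕ) {w w' : ℕ → ℝ → ℝ}
    (hw : ContinuousOn (w l) Dom) (hw' : ContinuousOn (w' l) Dom) :
    feCoord M k (meshRemainder M fl k l w) - feCoord M k (meshRemainder M fl k l w') =
      feCoord M k (meshRemainder M fl k l fun n x => w n x - w' n x) := by
  rw [← map_sub]
  congr 1
  funext j
  exact remainder_sub (M.left_lt_right j) fl k l (hw.mono (M.cell_subset_Dom j))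
    (hw'.mono (M.cell_subset_Dom j))

theorem exists_consistency_bound (k l : ℕ) : ∃ C : ℝ, 0 < C ∧ ∀ (N : ℕ) (M : Mesh N) (fl : Flux)
    (t U : ℝ) (v : ℕ → ℝ → ℝ → ℝ), 0 ≤ U → HeatRegular (k + l + 1) 0 t U v →
    ∀ s ∈ Set.Icc 0 t, ‖feCoord M k (meshRemainder M fl k l fun n x => v (n + 1) x s)‖ ≤
      C * M.size ^ (k + l + 1) * U := by
  obtain ⟨K, hK, h1⟩ := exists_meshRemainder_bound k l
  refine ⟨K * √(2 * Real.pi), by positivity, fun N M fl t U v hU h s hs => ?_⟩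
  have h2 := h1 N M fl (fun n x => v (n + 1) x s) (fun j => U ^ 2 * M.cellSize j)
    (U ^ 2 * (2 * Real.pi)) (h.continuous_space (by omega) hs)
    (fun i hi => h.deriv_space (l + i + 1) (by omega) s hs)
    (fun j x hx => by
      have e1 := h.lipschitz (l + k + 1) (by omega) s hs x (M.cell_subset_Dom j hx) _
        (M.left_mem_Dom j)
      have e2 : |x - M.left j| ≤ M.cellSize j := by
        rw [abs_of_nonneg (sub_nonneg.mpr hx.1)]
        exact sub_le_sub_right hx.2 _
      have e3 := abs_le.mp (e1.trans (mul_le_mul_of_nonneg_left e2 hU))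
      refine (sq_le_sq' e3.1 e3.2).trans (le_of_eq ?_)
      ring)
    (by rw [← Finset.mul_sum, M.sum_cellSize])
  refine h2.trans (le_of_eq ?_)
  rw [Real.sqrt_mul (sq_nonneg U), Real.sqrt_sq hU]
  ring

theorem sqrt_mul_rpow_eighth {C U q : ℝ} (hC : 0 ≤ C) (hU : 0 ≤ U) (hq : 0 ≤ q) :
    √(C * U ^ 2 * q ^ (1 / 8 : ℝ)) = √C * U * q ^ (1 / 16 : ℝ) := by
  rw [Real.sqrt_mul (by positivity), Real.sqrt_mul hC, Real.sqrt_sq hU,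
    Real.sqrt_eq_rpow (q ^ _), ← Real.rpow_mul hq]
  norm_num

/-- In σ the coefficient of v l is bounded through the next derivative of order k+l+1 in L², whose
increments are pointwise of order √(t-s) and in L² better by the smoothing gain. In r the derivative
of order k+l+1 is already the oscillating quantity, so the sum over cells in
`exists_global_increment_bound` is used. The exponent 1/8 for squares becomes 1/16. -/
theorem exists_consistency_increment_bound (k l : ℕ) (hl : 1 ≤ l) (hk : 1 ≤ k) :
    ∃ C : ℝ, 0 < C ∧ ∀ (N : ℕ) (M : Mesh N) (fl : Flux)
    (t U : ℝ) (v : ℕ → ℝ → ℝ → ℝ), 0 ≤ U → 0 < t → HeatRegular (k + l + 1) 0 t U v →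
    ∀ s ∈ Set.Icc 0 t,
      ‖feCoord M k (meshRemainder M fl k l fun n x => v n x s) -
        feCoord M k (meshRemainder M fl k l fun n x => v n x t)‖ ≤
        C * M.size ^ (k + l + 1) * U * (t - s) ^ (1 / 2 : ℝ) ∧
      ‖feCoord M k (meshRemainder M fl k l fun n x => v n x s) -
        feCoord M k (meshRemainder M fl k l fun n x => v n x t)‖ ≤
        C * M.size ^ (k + l + 1) * U * (t - s) ^ (1 / 2 : ℝ) *
          ((2 / min t 1) ^ (1 / 16 : ℝ) * (t - s) ^ (1 / 16 : ℝ)) ∧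
      ‖feCoord M k (meshRemainder M fl.flip k l fun n x => v (n + 1) x s) -
        feCoord M k (meshRemainder M fl.flip k l fun n x => v (n + 1) x t)‖ ≤
        C * M.size ^ (k + l + 1) * U *
          ((2 / min t 1) ^ (1 / 16 : ℝ) * (t - s) ^ (1 / 16 : ℝ)) := by
  obtain ⟨K, hK, h1⟩ := exists_meshRemainder_bound k l
  obtain ⟨C, hC, h2⟩ := exists_global_increment_bound
  refine ⟨K * √(C + 32 * Real.pi), by positivity, fun N M fl t U v hU ht h s hs => ?_⟩
  have hτ : 0 ≤ t - s := sub_nonneg.mpr hs.2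
  have hm : 0 < min t 1 := lt_min ht one_pos
  have htm : t ∈ Set.Icc 0 t := ⟨ht.le, le_rfl⟩
  have hsize := M.size_nonneg
  have hpi := Real.pi_pos
  -- The shift makes the space derivative of order k+l+1 play the role of v 2.
  have hH : HeatRegular 2 0 t U (fun i => v (i + (k + l - 1))) :=
    HeatRegular.shift _ (by rwa [show 2 + (k + l - 1) = k + l + 1 by omega])
  have hHs := hH.continuous_space le_rfl hs
  have hHt := hH.continuous_space le_rfl htm
  obtain ⟨hY2, hY⟩ := h2 t U _ hU ht hH s hs
  replace hY := hY N M
  have hHb := fun x (hx : x ∈ Dom) => hH.abs_time_diff_two_le hs.1 hs.2 le_rfl hx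
  simp only [show 2 + (k + l - 1) = k + l + 1 by omega] at hY2 hY hHs hHt hHb
  have hq : 0 ≤ 2 * (t - s) / min t 1 := by positivity
  have hqe : (2 * (t - s) / min t 1) ^ (1 / 16 : ℝ) =
      (2 / min t 1) ^ (1 / 16 : ℝ) * (t - s) ^ (1 / 16 : ℝ) := by
    rw [← Real.mul_rpow (by positivity) hτ]
    congr 1; ring
  have hrtC : √C ≤ √(C + 32 * Real.pi) := Real.sqrt_le_sqrt (by linarith)
  have hrtpi : √(32 * Real.pi) ≤ √(C + 32 * Real.pi) := Real.sqrt_le_sqrt (by linarith)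
  have hσ := fun Q (hQ : ∫ x in (0 : ℝ)..2 * Real.pi, (v (k + l + 1) x t - v (k + l + 1) x s) ^ 2 ≤
      Q) => h1 N M fl (fun n x => v n x s - v n x t)
    (fun j => ∫ y in M.left j..M.right j, (v (k + l + 1) y t - v (k + l + 1) y s) ^ 2) Q
    ((h.continuous_space (by omega) hs).sub (h.continuous_space (by omega) htm))
    (fun i hi x hx => (h.deriv_space (l + i) (by omega) s hs x hx).sub
      (h.deriv_space (l + i) (by omega) t htm x hx))
    (fun j x hx => by
      have e := sq_sub_le_integral_of_deriv (f := fun x => v (l + k) x s - v (l + k) x t)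
        (f' := fun x => v (l + k + 1) x s - v (l + k + 1) x t) hx
        (((h.continuous_space (by omega) hs).sub (h.continuous_space (by omega) htm)).mono
          (M.cell_subset_Dom j))
        (fun y hy => ((h.deriv_space (l + k) (by omega) s hs y (M.cell_subset_Dom j hy)).sub
          (h.deriv_space (l + k) (by omega) t htm y (M.cell_subset_Dom j hy))).mono
          (M.cell_subset_Dom j))
      refine e.trans (le_of_eq ?_)
      rw [Mesh.cellSize, add_comm l k]
      congr 1
      exact intervalIntegral.integral_congr fun y _ => by ring)
    (by rw [M.sum_integral (f := fun y => (v (k + l + 1) y t - v (k + l + 1) y s) ^ 2)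
      ((hHt.sub hHs).pow 2)]; exact hQ)
  rw [feCoord_meshRemainder_sub M fl k l (h.continuous_space (by omega) hs)
    (h.continuous_space (by omega) htm), feCoord_meshRemainder_sub M fl.flip k l
    (w := fun n x => v (n + 1) x s) (w' := fun n x => v (n + 1) x t)
    (h.continuous_space (by omega) hs) (h.continuous_space (by omega) htm)]
  refine ⟨?_, ?_, ?_⟩
  · refine (hσ (32 * Real.pi * U ^ 2 * (t - s)) ?_).trans ?_
    · refine (integral_Dom_le_const (B := 16 * U ^ 2 * (t - s)) ((hHt.sub hHs).pow 2)
        fun x hx => ?_).trans (le_of_eq (by ring))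
      have e1 := abs_le.mp (hHb x hx)
      refine (sq_le_sq' e1.1 e1.2).trans (le_of_eq ?_)
      rw [mul_pow, Real.sq_sqrt hτ]; ring
    · rw [Real.sqrt_mul (by positivity), Real.sqrt_mul (by positivity), Real.sqrt_sq hU,
        Real.sqrt_eq_rpow (t - s)]
      have := Real.rpow_nonneg hτ (1 / 2)
      calc K * M.size ^ (k + l + 1) * (√(32 * Real.pi) * U * (t - s) ^ (1 / 2 : ℝ)) ≤
          K * M.size ^ (k + l + 1) * (√(C + 32 * Real.pi) * U * (t - s) ^ (1 / 2 : ℝ)) := by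
            gcongr
        _ = _ := by ring
  · refine (hσ _ hY2).trans ?_
    rw [mul_right_comm (C * U ^ 2), Real.sqrt_mul (by positivity), Real.sqrt_eq_rpow (t - s),
      sqrt_mul_rpow_eighth hC.le hU hq, hqe]
    have := Real.rpow_nonneg hτ (1 / 2)
    have := Real.rpow_nonneg hτ (1 / 16)
    calc K * M.size ^ (k + l + 1) * (√C * U * ((2 / min t 1) ^ (1 / 16 : ℝ) *
          (t - s) ^ (1 / 16 : ℝ)) * (t - s) ^ (1 / 2 : ℝ)) ≤
        K * M.size ^ (k + l + 1) * (√(C + 32 * Real.pi) * U * ((2 / min t 1) ^ (1 / 16 : ℝ) *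
          (t - s) ^ (1 / 16 : ℝ)) * (t - s) ^ (1 / 2 : ℝ)) := by gcongr
      _ = _ := by ring
  -- The oscillation on a cell is attained at some point, so the bound for arbitrary choices of one
  -- point per cell applies to the maxima.
  · have hmax : ∀ j, ∃ x ∈ Set.Icc (M.left j) (M.right j), ∀ y ∈ Set.Icc (M.left j) (M.right j),
        ((v (k + l + 1) y t - v (k + l + 1) y s) -
          (v (k + l + 1) (M.left j) t - v (k + l + 1) (M.left j) s)) ^ 2 ≤
        ((v (k + l + 1) x t - v (k + l + 1) x s) -
          (v (k + l + 1) (M.left j) t - v (k + l + 1) (M.left j) s)) ^ 2 := fun j =>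
      isCompact_Icc.exists_isMaxOn (Set.nonempty_Icc.mpr (M.left_lt_right j).le)
        ((((hHt.sub hHs).mono (M.cell_subset_Dom j)).sub continuousOn_const).pow 2)
    choose x hx hxmax using hmax
    have e1 := h1 N M fl.flip (fun n x => v (n + 1) x s - v (n + 1) x t) _ _
      ((h.continuous_space (by omega) hs).sub (h.continuous_space (by omega) htm))
      (fun i hi x hx => (h.deriv_space (l + i + 1) (by omega) s hs x hx).sub
        (h.deriv_space (l + i + 1) (by omega) t htm x hx))
      (fun j y hy => by
        rw [mul_div_cancel₀ _ (M.cellSize_pos j).ne']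
        refine le_trans (le_of_eq ?_) (hxmax j y hy)
        rw [add_comm l k]
        ring) (hY x hx)
    refine e1.trans ?_
    rw [sqrt_mul_rpow_eighth hC.le hU hq, hqe]
    have := Real.rpow_nonneg hτ (1 / 16)
    calc K * M.size ^ (k + l + 1) * (√C * U * ((2 / min t 1) ^ (1 / 16 : ℝ) *
          (t - s) ^ (1 / 16 : ℝ))) ≤
        K * M.size ^ (k + l + 1) * (√(C + 32 * Real.pi) * U * ((2 / min t 1) ^ (1 / 16 : ℝ) *
          (t - s) ^ (1 / 16 : ℝ))) := by gcongr
      _ = _ := by ring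

end LDG
end

noncomputable section

namespace LDG

/-! ## Superconvergence -/

/-- The base 2t/min(t,1) is at least 1, so the exponent may be raised to 1/2. For t ≤ 1 the base is
2: the blow-up of the constant as t → 0 is compensated. -/
theorem rpow_sixteenth_le {t : ℝ} (ht : 0 < t) :
    (2 / min t 1) ^ (1 / 16 : ℝ) * t ^ (1 / 16 : ℝ) ≤ 2 * (1 + √t) := by
  have hm : 0 < min t 1 := lt_min ht one_pos
  rw [← Real.mul_rpow (by positivity) ht.le]
  have hs := Real.sqrt_nonneg t
  have h1 : 1 ≤ 2 / min t 1 * t := by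
    rw [div_mul_eq_mul_div, one_le_div hm]
    linarith [min_le_left t 1]
  have h2 := Real.rpow_le_rpow_of_exponent_le h1 (show (1 / 16 : ℝ) ≤ 1 / 2 by norm_num)
  refine h2.trans ?_
  rw [← Real.sqrt_eq_rpow]
  refine Real.sqrt_le_iff.mpr ⟨by positivity, ?_⟩
  have h3 : 2 / min t 1 * t ≤ 2 * (1 + t) := by
    rcases le_total t 1 with h | h
    · rw [min_eq_left h, div_mul_cancel₀ _ ht.ne']; linarith
    · rw [min_eq_right h]; linarith
  nlinarith [Real.sq_sqrt ht.le]

/-- Error bounds at the positive time `t` in terms of the derivatives of the solution. -/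
theorem exists_error_bound (k l : ℕ) (hl : 1 ≤ l) (hlk : l ≤ k) : ∃ K : ℝ, 0 < K ∧
    ∀ (N : ℕ) (M : Mesh N) (fl : Flux) (bc : Boundary) (T t U : ℝ) (v : ℕ → ℝ → ℝ → ℝ)
      (uh qh : ℝ → Fin N → ℝ[X]) (V : ℝ), 0 ≤ U → t ∈ Set.Icc 0 T →
      HeatRegular (k + l + 1) 0 T V v → HeatRegular (k + l + 1) 0 t U v →
      IsLDGSolution M k fl bc T uh qh →
      (∀ s ∈ Set.Icc 0 T, HasBoundaryValue fl bc s (fun x => v 0 x s) ∧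
        HasBoundaryValue fl.flip bc s (fun x => v 1 x s)) →
      uh 0 = meshInterp M fl k l (fun n x => v n x 0) →
      ‖feCoord M k (meshInterp M fl k l (fun n x => v n x t) - uh t)‖ ≤
        K * (1 + t) * M.size ^ (k + l + 1) * U ∧
      ‖feCoord M k (meshInterp M fl.flip k l (fun n x => v (n + 1) x t) - qh t)‖ ≤
        K * (1 + √t) * M.size ^ (k + l + 1) * U := by
  obtain ⟨C₁, hC₁, h1⟩ := exists_consistency_bound k l
  obtain ⟨C₂, hC₂, h2⟩ := exists_consistency_increment_bound k l hl (hl.trans hlk)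
  -- With R = S = B and β = 1/16 the bound for q is 2B(1 + 16·2(1 + √t)) ≤ 66(1 + √t)B; the bound
  -- 5B√t for u is smaller.
  refine ⟨66 * (C₁ + C₂), by positivity, ?_⟩
  intro N M fl bc T t U v uh qh V hU htT hT h hsol hbc hinit
  have hsize : 0 ≤ M.size ^ (k + l + 1) := pow_nonneg M.size_nonneg _
  have hsub : Set.Icc 0 t ⊆ Set.Icc 0 T := Set.Icc_subset_Icc_right htT.2
  set B := (C₁ + C₂) * M.size ^ (k + l + 1) * U with hB
  have hB0 : 0 ≤ B := by positivity
  set e : ℝ → FESpace N k := fun s => feCoord M k (meshInterp M fl k l (fun n x => v n x s) - uh s)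
    with he
  set σ : ℝ → FESpace N k := fun s => feCoord M k (meshRemainder M fl k l fun n x => v n x s)
  set r : ℝ → FESpace N k := fun s =>
    feCoord M k (meshRemainder M fl.flip k l fun n x => v (n + 1) x s)
  set D := discreteDeriv M k fl bc
  have he0 : e 0 = 0 := by simp only [he]; rw [hinit, sub_self, map_zero]
  have hE : ∀ s ∈ Set.Icc 0 T,
      feCoord M k (meshInterp M fl.flip k l (fun n x => v (n + 1) x s) - qh s) =
        D (e s) + r s := fun s hs =>
    hsol.feCoord_q_error hlk hl hT hs (hbc s hs).1
  have hr : ∀ s ∈ Set.Icc 0 t, ‖r s‖ ≤ B := fun s hs => by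
    refine (h1 N M fl.flip t U v hU h s hs).trans ?_
    rw [hB]
    gcongr
    linarith
  have hs0 := Real.sqrt_nonneg t
  have ht0 := htT.1
  rw [hE t htT]
  change ‖e t‖ ≤ _ ∧ _
  have hK1 : 66 * (C₁ + C₂) * (1 + t) * M.size ^ (k + l + 1) * U = 66 * (1 + t) * B := by
    rw [hB]; ring
  have hK2 : 66 * (C₁ + C₂) * (1 + √t) * M.size ^ (k + l + 1) * U = 66 * (1 + √t) * B := by
    rw [hB]; ring
  rw [hK1, hK2]
  -- At t = 0 there is nothing to smooth: e 0 = 0 and the error of q is r 0.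
  rcases ht0.eq_or_lt with rfl | ht
  · have := hr 0 ⟨le_rfl, le_rfl⟩
    rw [he0, norm_zero, map_zero, zero_add, Real.sqrt_zero]
    constructor <;> linarith
  have hle : C₂ * M.size ^ (k + l + 1) * U ≤ B := by rw [hB]; gcongr; linarith
  have hinc := fun s hs => h2 N M fl t U v hU ht h s hs
  set c := (2 / min t 1) ^ (1 / 16 : ℝ) with hc
  have hc0 : 0 ≤ c := Real.rpow_nonneg (div_nonneg zero_le_two (lt_min ht one_pos).le) _
  have hcont : ContinuousOn (fun s => e s - σ s) (Set.Icc 0 t) :=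
    (hsol.continuousOn_shifted_error hl hT).mono hsub
  have hderiv : ∀ s ∈ Set.Ioo 0 t, HasDerivAt (fun s => e s - σ s)
      (-(ContinuousLinearMap.adjoint D (D (e s) + r s))) s := fun s hs => by
    have hsT : s < T := hs.2.trans_le htT.2
    rw [← hE s ⟨hs.1.le, hsT.le⟩]
    exact (hsol.hasDerivWithinAt_shifted_error hlk hl hT ⟨hs.1, hsT.le⟩
      (hbc s ⟨hs.1.le, hsT.le⟩).2).hasDerivAt (Icc_mem_nhds hs.1 hsT)
  have hpow : ∀ s ∈ Set.Icc 0 t, ∀ β : ℝ, 0 ≤ (t - s) ^ β := fun s hs β =>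
    Real.rpow_nonneg (sub_nonneg.mpr hs.2) β
  have hσ : ∀ s ∈ Set.Icc 0 t, ‖σ s - σ t‖ ≤ B * (t - s) ^ (1 / 2 : ℝ) := fun s hs =>
    (hinc s hs).1.trans (mul_le_mul_of_nonneg_right hle (hpow s hs _))
  have hσ' : ∀ s ∈ Set.Icc 0 t, ‖σ s - σ t‖ ≤
      B * (t - s) ^ (1 / 2 : ℝ) * (c * (t - s) ^ (1 / 16 : ℝ)) := fun s hs =>
    (hinc s hs).2.1.trans (mul_le_mul_of_nonneg_right
      (mul_le_mul_of_nonneg_right hle (hpow s hs _)) (mul_nonneg hc0 (hpow s hs _)))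
  have hr' : ∀ s ∈ Set.Icc 0 t, ‖r s - r t‖ ≤ B * (c * (t - s) ^ (1 / 16 : ℝ)) := fun s hs =>
    (hinc s hs).2.2.trans (mul_le_mul_of_nonneg_right hle (mul_nonneg hc0 (hpow s hs _)))
  constructor
  · refine (norm_le_of_duhamel ht he0 hcont hderiv hr hσ).trans ?_
    rw [← Real.sqrt_eq_rpow]
    have h3 : √t ≤ 1 + t := by nlinarith [Real.sq_sqrt ht.le]
    nlinarith
  · refine (norm_add_le_of_duhamel ht (by norm_num : (0 : ℝ) < 1 / 16) hc0 he0 hcont hderiv hr hσ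
      hr' hσ').trans ?_
    have h3 := rpow_sixteenth_le ht
    have h4 : c / (1 / 16) * t ^ (1 / 16 : ℝ) = 16 * (c * t ^ (1 / 16 : ℝ)) := by ring
    rw [h4]
    nlinarith

end LDG
end

/-! ### Superconvergence for the interpolants of the statement -/

theorem theorem4p1 (k l : ℕ) (hl : 1 ≤ l) (hlk : l ≤ k) (c : ℝ) :
    ∃ K : ℝ, 0 < K ∧
      ∀ (N : ℕ) (M : LDG.Mesh N), M.QuasiUniform c →
      ∀ (fl : LDG.Flux) (bc : LDG.Boundary) (T : ℝ), 0 < T →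
      ∀ u : ℝ → ℝ → ℝ, LDG.IsHeatSolution fl bc (k + l + 2) T u →
      ∀ uh qh : ℝ → Fin N → Polynomial ℝ, LDG.IsLDGSolution M k fl bc T uh qh →
      uh 0 = LDG.interpU M fl k l T u 0 →
      ∀ t ∈ Set.Icc 0 T,
        LDG.l2Norm M (LDG.interpU M fl k l T u t - uh t) ≤
          K * (1 + t) * M.size ^ (k + l + 1) * (LDG.supSobolevNorm (k + l + 2) u t).toReal ∧
        LDG.l2Norm M (LDG.interpQ M fl k l T u t - qh t) ≤
          K * (1 + Real.sqrt t) * M.size ^ (k + l + 1) *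
            (LDG.supSobolevNorm (k + l + 2) u t).toReal := by
  obtain ⟨K, hK, h⟩ := LDG.exists_error_bound k l hl hlk
  refine ⟨K, hK, fun N M _ fl bc T hT u hu uh qh hsol hinit t ht => ?_⟩
  have hreg : ∀ s ∈ Set.Icc 0 T, LDG.HeatRegular (k + l + 1) 0 s
      (LDG.supSobolevNorm (k + l + 2) u s).toReal (LDG.spaceDerivs u) := fun s hs =>
    LDG.IsHeatSolution.heatRegular (by omega) hu hs
  have hregT := hreg T ⟨hT.le, le_rfl⟩
  have h0 : (0 : ℝ) ∈ Set.Icc 0 T := ⟨le_rfl, hT.le⟩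
  have hc0 := hregT.continuous_space (i := 0) (by omega) ht
  have hc1 := hregT.continuous_space (i := 1) (by omega) ht
  rw [LDG.interpU_eq hregT hT M fl h0] at hinit
  rw [LDG.interpU_eq hregT hT M fl ht, LDG.interpQ_eq hregT hT M fl ht,
    LDG.l2Norm_eq_norm M (LDG.sub_mem_feSpace (LDG.meshInterp_mem M fl k l hc0)
      (hsol.uh_mem t ht)),
    LDG.l2Norm_eq_norm M (LDG.sub_mem_feSpace (LDG.meshInterp_mem M fl.flip k l hc1)
      (hsol.qh_mem t ht))]
  -- Two instances of regularity: on [0,T] it justifies the error equations, on [0,t] it provides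
  -- the constant, so the bound involves the norm only up to time t.
  refine h N M fl bc T t _ (LDG.spaceDerivs u) uh qh _ ENNReal.toReal_nonneg ht hregT (hreg t ht)
    hsol (fun s hs => ?_) hinit
  rw [LDG.spaceDerivs_zero, LDG.spaceDerivs_one]
  exact (hu.boundary s hs).hasBoundaryValue
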